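/- An $n\times n$ integer matrix $A=(a_{ij})$ is a Cartan matrix (of rank $n$) if $a_{ii}=2$, $a_{ij}\le 0$ for $i\ne j$, and $a_{ij}=0$ implies $a_{ji}=0$; it is indecomposable if no simultaneous permutation of rows and columns turns it into a direct sum of two smaller Cartan matrices. Let $\mathfrak h$ be the real vector space with basis $\alpha_1^\vee,\dots,\alpha_n^\vee$, let $\omega_1,\dots,\omega_n$ be the dual basis of $\mathfrak h^*$, and put $\alpha_i=\sum_j a_{ji}\omega_j$. The Weyl group $W(A)$ is the group of automorphisms of $\mathfrak h^*$ generated by the reflections $\sigma_i(\lambda)=\lambda-\langle\lambda,\alpha_i^\vee\rangle\alpha_i$, and $l(w)$ is the least length of a word in the $\sigma_i$ that represents $w$. The Poincaré series of the flag manifold $F(A)$ is $P_{F(A)}(q)=\sum_{w\in W(A)}q^{2l(w)}$. The Coxeter graph of $A$ has the vertices $1,\dots,n$; vertices $i\neq j$ are joined if and only if $a_{ij}\ne 0$, and this edge has the label $\min(a_{ij}a_{ji},4)\in\{1,2,3,4\}$. The reduced Coxeter graph is the underlying graph without labels. Theorem. (a) Every indecomposable Cartan matrix of rank 3 or 4 has,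 after a suitable renumbering of $1,\dots,n$, one of the labelled Coxeter graphs listed below: there are 30 lists of labels in rank 3 (types 3-I, 3-II) and 663 in rank 4 (types 4-I to 4-VI). (b) For every Cartan matrix $A$ that has, after renumbering, the labelled Coxeter graph of a row below, $P_{F(A)}(q)$ is the expansion as a power series of the rational function of $t=q^2$ given in that row. Notation: $[k]=1+t+\cdots+t^{k-1}$; a string such as $123$ at the start of a row stands for the list of labels $(r_1,r_2,r_3)=(1,2,3)$; lists of labels of the same type that have the same rational function share a row. Type 3-I: the path $1-2-3$; $r_1,r_2$ label the edges $12,23$. - $11$: $[4][3][2]$ - $12$: $[6][4][2]$ - $13$: $\frac{[6][2]}{1-t-t^5+t^6}$ - $14$: $\frac{[3][2][2]}{1-t^2-t^3}$ - $22$: $\frac{[4][2]}{1-t-t^3+t^4}$ - $23$: $\frac{[6][4]}{1-t+t^2-2t^3+t^4-2t^5+t^6-t^7+t^8}$ - $24$: $\frac{[4][2]}{1-t-t^3}$ - $33$: $\frac{[6][2]}{1-t-t^3-t^5+t^6}$ - $34$: $\frac{[6][2]}{1-t-t^3-t^5}$ - $44$: $\frac{[2][2]}{1-t-t^2}$ Type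 3-II: the triangle; $r_1,r_2,r_3$ label its three edges (in any order). - $111$: $\frac{[3]}{1-2t+t^2}$ - $112$: $\frac{[4][3][2]}{1-t^2-t^3-t^4+t^6}$ - $113$: $\frac{[6][2]}{1-t-t^2+t^3-t^4-t^5+t^6}$ - $114$: $\frac{[3][2]}{1-t-t^2}$ - $122$: $\frac{[4][3][2]}{1-t^2-2t^3-t^4+t^6}$ - $123$: $\frac{[6][4]}{1-t-t^3-t^4-t^5-t^7+t^8}$ - $124$: $\frac{[4][3][2]}{1-t^2-2t^3-2t^4-t^5}$ - $133$: $\frac{[6][2]}{1-t-t^2-t^4-t^5+t^6}$ - $134$: $\frac{[6][2]}{1-t-t^2-t^4-t^5}$ - $144$: $\frac{[3][2]}{1-t-t^2-t^3}$ - $222$: $\frac{[4][2]}{1-t-t^2-t^3+t^4}$ - $223$: $\frac{[6][4]}{1-t-2t^3-2t^5-t^7+t^8}$ - $224$: $\frac{[4][2]}{1-t-t^2-t^3}$ - $233$: $\frac{[6][4]}{1-t-2t^3-t^4-2t^5-t^7+t^8}$ - $234$: $\frac{[6][4]}{1-t-2t^3-t^4-2t^5-t^6-t^7}$ - $244$: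 $\frac{[4][2]}{1-t-t^2-t^3-t^4}$ - $333$: $\frac{[6][2]}{1-t-t^2-t^3-t^4-t^5+t^6}$ - $334$: $\frac{[6][2]}{1-t-t^2-t^3-t^4-t^5}$ - $344$: $\frac{[6][2]}{1-t-t^2-t^3-t^4-t^5-t^6}$ - $444$: $\frac{[2]}{1-2t}$ Type 4-I: the path $1-2-3-4$; $r_1,r_2,r_3$ label the edges $12,23,34$. - $111$: $[5][4][3][2]$ - $112$: $[8][6][4][2]$ - $113$: $\frac{[6][4][2]}{1-t-t^4+t^8}$ - $114$: $\frac{[4][3][2]}{1-t-t^3}$ - $121$: $[12][8][6][2]$ - $122$: $\frac{[6][4][2]}{1-t-t^3+t^8}$ - $123$: $\frac{[6][4][2]}{1-t-t^3-t^4+t^8}$ - $124$: $\frac{[6][4][2]}{1-t-t^3-t^4-t^6}$ - $131$: $\frac{[6][2]}{1-2t+t^2-t^4+t^6}$ - $132$: $\frac{[6][4][2]}{1-t-t^3-t^4-t^5+t^8+t^9}$ - $133$: $\frac{[6][2][2]}{1-t-t^2-t^4-t^5+t^6+t^7}$ - $134$: $\frac{[6][2]}{1-2t+t^2-t^3-t^5+t^6}$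 - $141$: $\frac{[3][2][2]}{1-t-t^2}$ - $142$: $\frac{[4][3][2][2]}{1-t^2-2t^3-2t^4-t^5}$ - $143$: $\frac{[6][2][2]}{1-t-t^2-t^4-t^5}$ - $144$: $\frac{[3][2][2]}{1-t-t^2-t^3}$ - $212$: $\frac{[4](1+t^3)[2]}{1-2t+t^2-t^5+2t^6-t^7}$ - $213$: $\frac{[6][4][2]}{1-t-t^3-t^5+t^6+t^8}$ - $214$: $\frac{[6][4][2]}{1-t-t^3-t^5}$ - $222$: $\frac{[4][2][2]}{1-t-t^2-t^3+t^4+t^5}$ - $223$: $\frac{[6][4][2]}{1-t-2t^3-t^5+t^8+t^9}$ - $224$: $\frac{[4][2][2]}{1-t-t^2-t^3+t^5}$ - $232$: $\frac{[6][4][2]}{1-t-2t^3-2t^5+t^8+t^9}$ - $233$: $\frac{[6][4][2]}{1-t-2t^3-t^4-2t^5+t^8+t^9}$ - $234$: $\frac{[6][4][2]}{1-t-2t^3-t^4-2t^5-t^6+t^9}$ - $242$: $\frac{[4][2][2]}{1-t-t^2-t^3}$ - $243$: $\frac{[6][4][2]}{1-t-2t^3-t^4-2t^5-t^6-t^7}$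 - $244$: $\frac{[4][2][2]}{1-t-t^2-t^3-t^4}$ - $313$: $\frac{[6][2][2]}{1-t-t^2-t^5+t^6+t^7}$ - $314$: $\frac{[6][2][2]}{1-t-t^2-t^5+t^7}$ - $323$: $\frac{[6][4][2]}{1-t-2t^3-t^4-t^5+t^8+t^9}$ - $324$: $\frac{[6][4][2]}{1-t-2t^3-t^4-t^5-t^6+t^9}$ - $333$: $\frac{[6][2][2]}{1-t-t^2-t^3-t^4-t^5+t^6+t^7}$ - $334$: $\frac{[6][2][2]}{1-t-t^2-t^3-t^4-t^5+t^7}$ - $343$: $\frac{[6][2][2]}{1-t-t^2-t^3-t^4-t^5}$ - $344$: $\frac{[6][2][2]}{1-t-t^2-t^3-t^4-t^5-t^6}$ - $414$: $\frac{[3][2][2]}{1-t-t^2-t^3+t^4}$ - $424$: $\frac{[4][2]}{1-2t+t^2-2t^3+t^4}$ - $434$: $\frac{[6][2]}{1-2t+t^2-2t^3+t^4-2t^5+t^6}$ - $444$: $\frac{[2][2]}{1-2t}$ Type 4-II: the star with centre $1$; $r_1,r_2,r_3$ label the edges $12,13,14$. - $111$: $[6][4][4][2]$ - $112$: $\frac{[4](1+t^3)[2]}{1-2t+t^2-t^5+2t^6-t^7}$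 - $113$: $\frac{[6][4][2]}{1-t-t^3-2t^5+t^6+t^8+t^9}$ - $114$: $\frac{[4][3][2][2]}{1-t^2-2t^3-t^4-t^5}$ - $122$: $\frac{[4](1+t^3)[2]}{1-2t+t^2-t^3+t^4-t^5+t^6}$ - $123$: $\frac{[6][4][2]}{1-t-2t^3-2t^5+t^6+t^8+t^9}$ - $124$: $\frac{[6][4][2]}{1-t-2t^3-2t^5-t^7}$ - $133$: $\frac{[6][2][2]}{1-t-t^2-t^3-2t^5+t^6+2t^7}$ - $134$: $\frac{[6][2][2]}{1-t-t^2-t^3-2t^5+t^7}$ - $144$: $\frac{[3][2][2][2]}{1-2t^2-3t^3-t^4}$ - $222$: $\frac{[4][2][2]}{1-t-t^2-2t^3+t^4+2t^5}$ - $223$: $\frac{[6][4][2]}{1-t-3t^3-2t^5+t^8+2t^9}$ - $224$: $\frac{[4][2][2]}{1-t-t^2-2t^3+t^5}$ - $233$: $\frac{[6][4][2]}{1-t-3t^3-t^4-3t^5+t^8+2t^9}$ - $234$: $\frac{[6][4][2]}{1-t-3t^3-t^4-3t^5-t^6-t^7+t^9}$ - $244$: $\frac{[4][2][2]}{1-t-t^2-2t^3-t^4}$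 - $333$: $\frac{[6][2][2]}{1-t-t^2-2t^3-t^4-2t^5+t^6+2t^7}$ - $334$: $\frac{[6][2][2]}{1-t-t^2-2t^3-t^4-2t^5+t^7}$ - $344$: $\frac{[6][2][2]}{1-t-t^2-2t^3-t^4-2t^5-t^6}$ - $444$: $\frac{[2][2][2]}{1-t-2t^2-t^3}$ Type 4-III: the triangle $234$ with a pendant edge $12$; $r_1,r_2,r_3,r_4$ label the edges $12,23,24,34$. - $1111$: $\frac{[4][3]}{1-2t+t^2-t^3+t^4}$ - $1112$: $\frac{[4][3][2][2]}{1-2t^2-2t^3+t^5+t^6}$ - $1113$: $\frac{[6][4][2]}{1-t-t^2-t^4-t^5+t^8}$ - $1114$: $\frac{[4][3][2]}{1-t-t^2-t^3}$ - $1121$: $\frac{[6][4][2]}{1-t-t^2-t^4+t^8}$ - $1122$: $\frac{[6][4][2]}{1-t-t^2-t^3-t^5+t^8}$ - $1123$: $\frac{[6][4][2]}{1-t-t^2-t^3-t^4-t^5+t^8}$ - $1124$: $\frac{[6][4][2]}{1-t-t^2-t^3-t^4-t^5-t^6}$ - $1131$: $\frac{[6][4]}{1-2t+t^2-t^3-t^4+t^8}$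 - $1132$: $\frac{[6][4][2]}{1-t-t^2-t^3-t^4-2t^5+t^8+t^9}$ - $1133$: $\frac{[6][4][2]}{1-t-t^2-t^3-2t^4-2t^5+t^8+t^9}$ - $1134$: $\frac{[6][4]}{1-2t+t^2-2t^3-2t^5+t^6-t^7+t^8}$ - $1141$: $\frac{[4][3][2]}{1-t-t^2-t^3-t^4}$ - $1142$: $\frac{[4][3][2][2]}{1-2t^2-3t^3-2t^4-t^5}$ - $1143$: $\frac{[6][4][2]}{1-t-t^2-t^3-2t^4-2t^5-t^6-t^7}$ - $1144$: $\frac{[4][3][2]}{1-t-t^2-2t^3-t^4-t^5}$ - $1221$: $\frac{[6][4][2]}{1-t-t^2-t^3-t^4+t^8}$ - $1222$: $\frac{[4](1+t^3)[2]}{1-2t-t^5+t^6}$ - $1223$: $\frac{[6][4][2]}{1-t-t^2-2t^3-t^4-t^5+t^8}$ - $1224$: $\frac{[4](1+t^3)[2]}{1-2t-t^4}$ - $1231,\,2131$: $\frac{[6][4][2]}{1-t-t^2-t^3-2t^4-t^5+t^8+t^9}$ - $1232,\,2132$: $\frac{[6][4][2]}{1-t-t^2-2t^3-t^4-2t^5+t^8+t^9}$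 - $1233,\,2133$: $\frac{[6][4][2]}{1-t-t^2-2t^3-2t^4-2t^5+t^8+t^9}$ - $1234,\,2134$: $\frac{[6][4][2]}{1-t-t^2-2t^3-2t^4-2t^5-t^6+t^9}$ - $1241,\,2141$: $\frac{[6][4][2]}{1-t-t^2-t^3-2t^4-t^5-t^6-t^7}$ - $1242,\,2142$: $\frac{[6][4][2]}{1-t-t^2-2t^3-t^4-2t^5-t^6-t^7}$ - $1243,\,2143$: $\frac{[6][4][2]}{1-t-t^2-2t^3-2t^4-2t^5-t^6-t^7}$ - $1244,\,2144$: $\frac{[6][4][2]}{1-t-t^2-2t^3-2t^4-2t^5-2t^6-t^7-t^8}$ - $1331,\,3131$: $\frac{[6][2]}{1-2t-t^4-t^5+2t^6}$ - $1332,\,3132$: $\frac{[6][4][2]}{1-t-t^2-2t^3-2t^4-3t^5+t^8+2t^9}$ - $1333,\,3133$: $\frac{[6][2][2]}{1-t-2t^2-t^3-t^4-2t^5+t^6+2t^7}$ - $1334,\,3134$: $\frac{[6][2]}{1-2t-t^3-2t^5+2t^6}$ - $1341,\,3141,\,4131$: $\frac{[6][2]}{1-2t-t^4-t^5+t^6}$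 - $1342,\,3142,\,4132$: $\frac{[6][4][2]}{1-t-t^2-2t^3-2t^4-3t^5-t^6-t^7+t^9}$ - $1343,\,3143,\,4133$: $\frac{[6][2][2]}{1-t-2t^2-t^3-t^4-2t^5+t^7}$ - $1344,\,3144,\,4134$: $\frac{[6][2]}{1-2t-t^3-2t^5+t^6}$ - $1441,\,4141$: $\frac{[3][2][2]}{1-t-2t^2-t^3}$ - $1442,\,4142$: $\frac{[4][3][2][2]}{1-2t^2-4t^3-4t^4-3t^5-t^6}$ - $1443,\,4143$: $\frac{[6][2][2]}{1-t-2t^2-t^3-t^4-2t^5-t^6}$ - $1444,\,4144$: $\frac{[3][2][2]}{1-t-2t^2-2t^3}$ - $2111$: $\frac{[6][4][2]}{1-t-t^2-t^4+t^6+t^8}$ - $2112$: $\frac{[6][4][2]}{1-t-t^2-t^3-t^5+t^6+t^8}$ - $2113$: $\frac{[6][4][2]}{1-t-t^2-t^3-t^4-t^5+t^6+t^8}$ - $2114$: $\frac{[6][4][2]}{1-t-t^2-t^3-t^4-t^5}$ - $2121$: $\frac{[6][4][2]}{1-t-t^2-t^3-t^4+t^8+t^9}$ - $2122$: $\frac{[6][4][2]}{1-t-t^2-2t^3-t^5+t^8+t^9}$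 - $2123$: $\frac{[6][4][2]}{1-t-t^2-2t^3-t^4-t^5+t^8+t^9}$ - $2124$: $\frac{[6][4][2]}{1-t-t^2-2t^3-t^4-t^5-t^6+t^9}$ - $2221$: $\frac{[4][3][2]}{1-t-t^2-3t^3+t^5+2t^6}$ - $2222$: $\frac{[4][2][2]}{1-t-2t^2-2t^3+t^4+2t^5}$ - $2223$: $\frac{[6][4][2]}{1-t-t^2-3t^3-t^4-t^5-t^6+t^8+2t^9}$ - $2224$: $\frac{[4][2]}{1-2t-2t^3+2t^4}$ - $2231,\,3221$: $\frac{[6][4]}{1-2t+t^2-3t^3+t^4-2t^5+t^6-t^7+2t^8}$ - $2232,\,3222$: $\frac{[6][4][2]}{1-t-t^2-3t^3-t^4-2t^5-t^6+t^8+2t^9}$ - $2233,\,3223$: $\frac{[6][4][2]}{1-t-t^2-3t^3-2t^4-2t^5-t^6+t^8+2t^9}$ - $2234,\,3224$: $\frac{[6][4]}{1-2t+t^2-4t^3+2t^4-4t^5+2t^6-2t^7+2t^8}$ - $2241,\,4221$: $\frac{[4][3][2]}{1-t-t^2-3t^3-t^4+t^6}$ - $2242,\,4222$: $\frac{[4][2][2]}{1-t-2t^2-2t^3+t^5}$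 - $2243,\,4223$: $\frac{[6][4][2]}{1-t-t^2-3t^3-2t^4-2t^5-2t^6-t^7+t^9}$ - $2244,\,4224$: $\frac{[4][2]}{1-2t-2t^3+t^4}$ - $2331,\,3231$: $\frac{[6][4]}{1-2t+t^2-3t^3-2t^5+t^6-t^7+2t^8}$ - $2332,\,3232$: $\frac{[6][4][2]}{1-t-t^2-3t^3-2t^4-3t^5-t^6+t^8+2t^9}$ - $2333,\,3233$: $\frac{[6][4][2]}{1-t-t^2-3t^3-3t^4-3t^5-t^6+t^8+2t^9}$ - $2334,\,3234$: $\frac{[6][4]}{1-2t+t^2-4t^3+t^4-4t^5+2t^6-2t^7+2t^8}$ - $2341,\,3241,\,4231$: $\frac{[6][4]}{1-2t+t^2-3t^3-2t^5-t^7+t^8}$ - $2342,\,3242,\,4232$: $\frac{[6][4][2]}{1-t-t^2-3t^3-2t^4-3t^5-2t^6-t^7+t^9}$ - $2343,\,3243,\,4233$: $\frac{[6][4][2]}{1-t-t^2-3t^3-3t^4-3t^5-2t^6-t^7+t^9}$ - $2344,\,3244,\,4234$: $\frac{[6][4]}{1-2t+t^2-4t^3+t^4-4t^5+t^6-2t^7+t^8}$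 - $2441,\,4241$: $\frac{[4][3][2]}{1-t-t^2-3t^3-2t^4-t^5}$ - $2442,\,4242$: $\frac{[4][2][2]}{1-t-2t^2-2t^3-t^4}$ - $2443,\,4243$: $\frac{[6][4][2]}{1-t-t^2-3t^3-3t^4-3t^5-3t^6-2t^7-t^8}$ - $2444,\,4244$: $\frac{[4][2]}{1-2t-2t^3}$ - $3111$: $\frac{[6][2]}{1-2t+t^3-t^4-t^5+2t^6}$ - $3112$: $\frac{[6][4][2]}{1-t-t^2-t^3-t^4-2t^5+t^6+t^8+2t^9}$ - $3113$: $\frac{[6][2][2]}{1-t-2t^2-2t^5+t^6+2t^7}$ - $3114$: $\frac{[6][2]}{1-2t-2t^5+2t^6}$ - $3121$: $\frac{[6][4]}{1-2t+t^2-2t^3-t^5+t^6-t^7+2t^8}$ - $3122$: $\frac{[6][4][2]}{1-t-t^2-2t^3-t^4-2t^5+t^8+2t^9}$ - $3123$: $\frac{[6][4][2]}{1-t-t^2-2t^3-2t^4-2t^5+t^8+2t^9}$ - $3124$: $\frac{[6][4]}{1-2t+t^2-3t^3+t^4-3t^5+2t^6-2t^7+2t^8}$ - $3331$: $\frac{[6][2]}{1-2t-t^3-t^4-t^5+2t^6}$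 - $3332$: $\frac{[6][4][2]}{1-t-t^2-3t^3-3t^4-4t^5-t^6+t^8+2t^9}$ - $3333$: $\frac{[6][2][2]}{1-t-2t^2-2t^3-2t^4-2t^5+t^6+2t^7}$ - $3334$: $\frac{[6][2]}{1-2t-2t^3-2t^5+2t^6}$ - $3341,\,4331$: $\frac{[6][2]}{1-2t-t^3-t^4-t^5+t^6}$ - $3342,\,4332$: $\frac{[6][4][2]}{1-t-t^2-3t^3-3t^4-4t^5-2t^6-t^7+t^9}$ - $3343,\,4333$: $\frac{[6][2][2]}{1-t-2t^2-2t^3-2t^4-2t^5+t^7}$ - $3344,\,4334$: $\frac{[6][2]}{1-2t-2t^3-2t^5+t^6}$ - $3441,\,4341$: $\frac{[6][2]}{1-2t-t^3-t^4-t^5}$ - $3442,\,4342$: $\frac{[6][4][2]}{1-t-t^2-3t^3-3t^4-4t^5-3t^6-2t^7-t^8}$ - $3443,\,4343$: $\frac{[6][2][2]}{1-t-2t^2-2t^3-2t^4-2t^5-t^6}$ - $3444,\,4344$: $\frac{[6][2]}{1-2t-2t^3-2t^5}$ - $4111$: $\frac{[3][2][2]}{1-t-2t^2+t^4}$ - $4112$: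 $\frac{[4][3][2][2]}{1-2t^2-3t^3-2t^4-t^5+t^6+t^7}$ - $4113$: $\frac{[6][2][2]}{1-t-2t^2-2t^5+t^7}$ - $4114$: $\frac{[3][2][2]}{1-t-2t^2-t^3+t^4}$ - $4121$: $\frac{[4][3][2]}{1-t-t^2-2t^3-t^4+t^6}$ - $4122$: $\frac{[4][3][2][2]}{1-2t^2-4t^3-3t^4-t^5+t^6+t^7}$ - $4123$: $\frac{[6][4][2]}{1-t-t^2-2t^3-2t^4-2t^5-t^6-t^7+t^9}$ - $4124$: $\frac{[4][3][2]}{1-t-t^2-3t^3-t^4-t^5+t^6}$ - $4441$: $\frac{[3][2][2]}{1-t-2t^2-2t^3-t^4}$ - $4442$: $\frac{[4][2][2]}{1-t-2t^2-2t^3-2t^4-t^5}$ - $4443$: $\frac{[6][2][2]}{1-t-2t^2-2t^3-2t^4-2t^5-2t^6-t^7}$ - $4444$: $\frac{[2][2]}{1-2t-t^2}$ Type 4-IV: the 4-cycle; $r_1,r_2,r_3,r_4$ label the edges $12,23,34,41$. - $1111$: $\frac{[4]}{1-3t+3t^2-t^3}$ - $1112$: $\frac{[4](1+t^3)[2]}{1-2t+2t^3-2t^4+2t^6-t^7}$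 - $1113$: $\frac{[6][4]}{1-2t+t^2-t^3-t^5+t^6+t^8}$ - $1114$: $\frac{[4][3][2]}{1-t-t^2-t^3}$ - $1122$: $\frac{[4](1+t^3)[2]}{1-2t+t^3-t^4+t^6}$ - $1123$: $\frac{[6][4][2]}{1-t-t^2-t^3-t^4-t^5+t^7+t^8+t^9}$ - $1124$: $\frac{[6][4][2]}{1-t-t^2-t^3-t^4-t^5-t^6}$ - $1133$: $\frac{[6][4]}{1-2t+t^2-2t^3-2t^5+2t^6-t^7+2t^8}$ - $1134$: $\frac{[6][4]}{1-2t+t^2-2t^3-2t^5+t^6-t^7+t^8}$ - $1144$: $\frac{[4][3][2]}{1-t-t^2-2t^3-t^4-t^5}$ - $1212$: $\frac{[4](1+t^3)[2]}{1-2t+t^3-t^4+2t^6-t^7}$ - $1213$: $\frac{[6][4][2]}{1-t-t^2-t^3-t^4-t^5+t^6+t^7+t^8+t^9}$ - $1214$: $\frac{[6][4][2]}{1-t-t^2-t^3-t^4-t^5}$ - $1222$: $\frac{[4](1+t^3)[2]}{1-2t+t^7}$ - $1223$: $\frac{[6][4][2]}{1-t-t^2-2t^3-t^4-t^5+t^7+t^8+2t^9}$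 - $1224$: $\frac{[6][4][2]}{1-t-t^2-2t^3-t^4-t^5-t^6+t^9}$ - $1232$: $\frac{[6][4][2]}{1-t-t^2-2t^3-t^4-t^5+t^7+t^8+t^9}$ - $1233$: $\frac{[6][4][2]}{1-t-t^2-2t^3-2t^4-2t^5+t^7+t^8+2t^9}$ - $1234,\,1243$: $\frac{[6][4][2]}{1-t-t^2-2t^3-2t^4-2t^5-t^6+t^9}$ - $1242$: $\frac{[4](1+t^3)[2]}{1-2t-t^4}$ - $1244$: $\frac{[6][4][2]}{1-t-t^2-2t^3-2t^4-2t^5-2t^6-t^7-t^8}$ - $1313$: $\frac{[6][2]}{1-2t-2t^5+3t^6}$ - $1314$: $\frac{[6][2]}{1-2t-2t^5+2t^6}$ - $1323$: $\frac{[6][4]}{1-2t+t^2-3t^3+t^4-3t^5+3t^6-2t^7+3t^8}$ - $1324$: $\frac{[6][4]}{1-2t+t^2-3t^3+t^4-3t^5+2t^6-2t^7+2t^8}$ - $1333$: $\frac{[6][2]}{1-2t-t^3-2t^5+3t^6}$ - $1334,\,1343$: $\frac{[6][2]}{1-2t-t^3-2t^5+2t^6}$ - $1344,\,1434$: $\frac{[6][2]}{1-2t-t^3-2t^5+t^6}$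 - $1414$: $\frac{[3][2][2]}{1-t-2t^2-t^3+t^4}$ - $1424$: $\frac{[4][3][2]}{1-t-t^2-3t^3-t^4-t^5+t^6}$ - $1444$: $\frac{[3][2][2]}{1-t-2t^2-2t^3}$ - $2222$: $\frac{[4][2]}{1-2t-2t^3+3t^4}$ - $2223$: $\frac{[6][4]}{1-2t+t^2-4t^3+3t^4-4t^5+3t^6-2t^7+3t^8}$ - $2224$: $\frac{[4][2]}{1-2t-2t^3+2t^4}$ - $2233,\,2323$: $\frac{[6][4]}{1-2t+t^2-4t^3+2t^4-4t^5+3t^6-2t^7+3t^8}$ - $2234,\,2324$: $\frac{[6][4]}{1-2t+t^2-4t^3+2t^4-4t^5+2t^6-2t^7+2t^8}$ - $2244,\,2424$: $\frac{[4][2]}{1-2t-2t^3+t^4}$ - $2333$: $\frac{[6][4]}{1-2t+t^2-4t^3+t^4-4t^5+3t^6-2t^7+3t^8}$ - $2334,\,2343$: $\frac{[6][4]}{1-2t+t^2-4t^3+t^4-4t^5+2t^6-2t^7+2t^8}$ - $2344,\,2434$: $\frac{[6][4]}{1-2t+t^2-4t^3+t^4-4t^5+t^6-2t^7+t^8}$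 - $2444$: $\frac{[4][2]}{1-2t-2t^3}$ - $3333$: $\frac{[6][2]}{1-2t-2t^3-2t^5+3t^6}$ - $3334$: $\frac{[6][2]}{1-2t-2t^3-2t^5+2t^6}$ - $3344,\,3434$: $\frac{[6][2]}{1-2t-2t^3-2t^5+t^6}$ - $3444$: $\frac{[6][2]}{1-2t-2t^3-2t^5}$ - $4444$: $\frac{[2][2]}{1-2t-t^2}$ Type 4-V: the 4-cycle $1234$ with the diagonal $13$; $r_1,r_2,r_3,r_4,r_5$ label the edges $12,14,32,34,13$. - $11111$: $\frac{[4][3]}{1-2t+t^5}$ - $11112$: $\frac{[4][3][2]}{1-t-2t^2-t^3+t^5+t^6}$ - $11113$: $\frac{[6][4]}{1-2t-2t^4+t^8}$ - $11114$: $\frac{[4][3]}{1-2t-t^3}$ - $11121$: $\frac{[6][4][2]}{1-t-2t^2-t^4-t^5+t^6+t^8+t^9}$ - $11122$: $\frac{[6][4][2]}{1-t-2t^2-t^3-t^4-t^5+t^8+t^9}$ - $11123$: $\frac{[6][4][2]}{1-t-2t^2-t^3-2t^4-2t^5+t^8+t^9}$ - $11124$: $\frac{[6][4][2]}{1-t-2t^2-t^3-2t^4-2t^5-t^6-t^7}$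 - $11131$: $\frac{[6][4]}{1-2t-2t^4+t^6-t^7+2t^8}$ - $11132,\,11231$: $\frac{[6][4]}{1-2t-t^3-t^4-t^5+t^6-t^7+2t^8}$ - $11133,\,11331$: $\frac{[6][4]}{1-2t-t^3-2t^4-t^5+t^6-t^7+2t^8}$ - $11134,\,11143,\,11341$: $\frac{[6][4]}{1-2t-t^3-2t^4-t^5-t^7+t^8}$ - $11141$: $\frac{[4][3][2]}{1-t-2t^2-t^3-t^4+t^6}$ - $11142,\,11241$: $\frac{[4][3][2]}{1-t-2t^2-2t^3-t^4+t^6}$ - $11144,\,11441$: $\frac{[4][3][2]}{1-t-2t^2-2t^3-2t^4-t^5}$ - $11221$: $\frac{[4][3][2]}{1-t-2t^2-2t^3+t^5+2t^6}$ - $11222$: $\frac{[4][3][2]}{1-t-2t^2-3t^3+t^5+2t^6}$ - $11223,\,11232$: $\frac{[6][4]}{1-2t-2t^3-2t^5+t^6-t^7+2t^8}$ - $11224,\,11242$: $\frac{[4][3][2]}{1-t-2t^2-3t^3-t^4+t^6}$ - $11233,\,11332$: $\frac{[6][4]}{1-2t-2t^3-t^4-2t^5+t^6-t^7+2t^8}$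 - $11234,\,11243,\,11342$: $\frac{[6][4]}{1-2t-2t^3-t^4-2t^5-t^7+t^8}$ - $11244,\,11442$: $\frac{[4][3][2]}{1-t-2t^2-3t^3-2t^4-t^5}$ - $11333$: $\frac{[6][4]}{1-2t-2t^3-2t^4-2t^5+t^6-t^7+2t^8}$ - $11334,\,11343$: $\frac{[6][4]}{1-2t-2t^3-2t^4-2t^5-t^7+t^8}$ - $11344,\,11443$: $\frac{[6][4]}{1-2t-2t^3-2t^4-2t^5-t^6-t^7}$ - $11444$: $\frac{[4][3][2]}{1-t-2t^2-3t^3-3t^4-2t^5-t^6}$ - $12121,\,12211$: $\frac{[6][4][2]}{1-t-2t^2-t^3-t^4-t^5+t^6+t^8+t^9}$ - $12122,\,12212$: $\frac{[6][4][2]}{1-t-2t^2-2t^3-t^4-t^5+t^8+t^9}$ - $12123,\,12213$: $\frac{[6][4][2]}{1-t-2t^2-2t^3-2t^4-2t^5+t^8+t^9}$ - $12124,\,12214$: $\frac{[6][4][2]}{1-t-2t^2-2t^3-2t^4-2t^5-t^6-t^7}$ - $12131,\,12311$: $\frac{[6][4][2]}{1-t-2t^2-t^3-2t^4-2t^5+t^6+t^8+2t^9}$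 - $12132,\,12231,\,12312,\,12321$: $\frac{[6][4][2]}{1-t-2t^2-2t^3-2t^4-2t^5+t^8+2t^9}$ - $12133,\,12313,\,12331$: $\frac{[6][4][2]}{1-t-2t^2-2t^3-3t^4-3t^5+t^8+2t^9}$ - $12134,\,12143,\,12314,\,12341,\,12413,\,12431$: $\frac{[6][4][2]}{1-t-2t^2-2t^3-3t^4-3t^5-t^6-t^7+t^9}$ - $12141,\,12411$: $\frac{[6][4][2]}{1-t-2t^2-t^3-2t^4-2t^5-t^7+t^9}$ - $12142,\,12241,\,12412,\,12421$: $\frac{[6][4][2]}{1-t-2t^2-2t^3-2t^4-2t^5-t^6-t^7+t^9}$ - $12144,\,12414,\,12441$: $\frac{[6][4][2]}{1-t-2t^2-2t^3-3t^4-3t^5-2t^6-2t^7-t^8}$ - $12221$: $\frac{[6][4][2]}{1-t-2t^2-2t^3-t^4-t^5+t^8+2t^9}$ - $12222$: $\frac{[6][4][2]}{1-t-2t^2-3t^3-t^4-t^5-t^6+t^8+2t^9}$ - $12223,\,12232,\,12322$: $\frac{[6][4][2]}{1-t-2t^2-3t^3-2t^4-2t^5-t^6+t^8+2t^9}$ -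 $12224,\,12242,\,12422$: $\frac{[6][4][2]}{1-t-2t^2-3t^3-2t^4-2t^5-2t^6-t^7+t^9}$ - $12233,\,12323,\,12332$: $\frac{[6][4][2]}{1-t-2t^2-3t^3-3t^4-3t^5-t^6+t^8+2t^9}$ - $12234,\,12243,\,12324,\,12342,\,12423,\,12432$: $\frac{[6][4][2]}{1-t-2t^2-3t^3-3t^4-3t^5-2t^6-t^7+t^9}$ - $12244,\,12424,\,12442$: $\frac{[6][4][2]}{1-t-2t^2-3t^3-3t^4-3t^5-3t^6-2t^7-t^8}$ - $12333$: $\frac{[6][4][2]}{1-t-2t^2-3t^3-4t^4-4t^5-t^6+t^8+2t^9}$ - $12334,\,12343,\,12433$: $\frac{[6][4][2]}{1-t-2t^2-3t^3-4t^4-4t^5-2t^6-t^7+t^9}$ - $12344,\,12434,\,12443$: $\frac{[6][4][2]}{1-t-2t^2-3t^3-4t^4-4t^5-3t^6-2t^7-t^8}$ - $12444$: $\frac{[6][4][2]}{1-t-2t^2-3t^3-4t^4-4t^5-4t^6-3t^7-2t^8-t^9}$ - $13131,\,13311$: $\frac{[6][2]}{1-2t-t^2+t^3-t^4-2t^5+3t^6}$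 - $13132,\,13231,\,13312,\,13321$: $\frac{[6][4]}{1-2t-2t^3-t^4-2t^5+2t^6-2t^7+3t^8}$ - $13133,\,13313,\,13331$: $\frac{[6][2]}{1-2t-t^2-t^4-2t^5+3t^6}$ - $13134,\,13143,\,13314,\,13341,\,13413,\,13431,\,14331$: $\frac{[6][2]}{1-2t-t^2-t^4-2t^5+2t^6}$ - $13141,\,13411$: $\frac{[6][2]}{1-2t-t^2+t^3-t^4-2t^5+2t^6}$ - $13142,\,13241,\,13412,\,13421,\,14231,\,14321$: $\frac{[6][4]}{1-2t-2t^3-t^4-2t^5+t^6-2t^7+2t^8}$ - $13144,\,13414,\,13441,\,14143,\,14341,\,14413,\,14431$: $\frac{[6][2]}{1-2t-t^2-t^4-2t^5+t^6}$ - $13221$: $\frac{[6][4]}{1-2t-2t^3-2t^5+2t^6-2t^7+3t^8}$ - $13222,\,22231$: $\frac{[6][4]}{1-2t-3t^3+t^4-3t^5+2t^6-2t^7+3t^8}$ - $13223,\,13232,\,13322,\,22331,\,23231,\,23321$: $\frac{[6][4]}{1-2t-3t^3-3t^5+2t^6-2t^7+3t^8}$ - $13224,\,13242,\,13422,\,14223,\,14232,\,14322,\,22341,\,23241,\,23421$: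 $\frac{[6][4]}{1-2t-3t^3-3t^5+t^6-2t^7+2t^8}$ - $13233,\,13323,\,13332,\,23331$: $\frac{[6][4]}{1-2t-3t^3-t^4-3t^5+2t^6-2t^7+3t^8}$ - $13234,\,13243,\,13324,\,13342,\,13423,\,13432,\,14233,\,14323,\,14332,\,23341,\,23431,\,24331$: $\frac{[6][4]}{1-2t-3t^3-t^4-3t^5+t^6-2t^7+2t^8}$ - $13244,\,13424,\,13442,\,14234,\,14243,\,14324,\,14342,\,14423,\,14432,\,23441,\,24341,\,24431$: $\frac{[6][4]}{1-2t-3t^3-t^4-3t^5-2t^7+t^8}$ - $13333,\,33331$: $\frac{[6][2]}{1-2t-t^2-t^3-t^4-2t^5+3t^6}$ - $13334,\,13343,\,13433,\,14333,\,33341$: $\frac{[6][2]}{1-2t-t^2-t^3-t^4-2t^5+2t^6}$ - $13344,\,13434,\,13443,\,14334,\,14343,\,14433,\,33441,\,34341,\,34431$: $\frac{[6][2]}{1-2t-t^2-t^3-t^4-2t^5+t^6}$ - $13444,\,14344,\,14434,\,14443,\,34441$: $\frac{[6][2]}{1-2t-t^2-t^3-t^4-2t^5}$ - $14141,\,14411$: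 $\frac{[3][2][2]}{1-t-3t^2-t^3+t^4}$ - $14142,\,14241,\,14412,\,14421$: $\frac{[4][3][2]}{1-t-2t^2-3t^3-2t^4-t^5+t^6}$ - $14144,\,14414,\,14441$: $\frac{[3][2][2]}{1-t-3t^2-2t^3}$ - $14221$: $\frac{[4][3][2]}{1-t-2t^2-3t^3-t^4+2t^6}$ - $14222,\,22241$: $\frac{[4][3][2]}{1-t-2t^2-4t^3-t^4+2t^6}$ - $14224,\,14242,\,14422,\,22441,\,24241,\,24421$: $\frac{[4][3][2]}{1-t-2t^2-4t^3-2t^4-t^5+t^6}$ - $14244,\,14424,\,14442,\,24441$: $\frac{[4][3][2]}{1-t-2t^2-4t^3-3t^4-2t^5}$ - $14444,\,44441$: $\frac{[3][2][2]}{1-t-3t^2-3t^3-t^4}$ - $22221$: $\frac{[4][3][2]}{1-t-2t^2-4t^3+t^5+3t^6}$ - $22222$: $\frac{[4][2]}{1-2t-t^2-2t^3+3t^4}$ - $22223,\,22232$: $\frac{[6][4]}{1-2t-4t^3+2t^4-4t^5+2t^6-2t^7+3t^8}$ - $22224,\,22242$: $\frac{[4][2]}{1-2t-t^2-2t^3+2t^4}$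 - $22233,\,22332,\,23232,\,23322$: $\frac{[6][4]}{1-2t-4t^3+t^4-4t^5+2t^6-2t^7+3t^8}$ - $22234,\,22243,\,22342,\,23242,\,23422$: $\frac{[6][4]}{1-2t-4t^3+t^4-4t^5+t^6-2t^7+2t^8}$ - $22244,\,22442,\,24242,\,24422$: $\frac{[4][2]}{1-2t-t^2-2t^3+t^4}$ - $22333,\,23233,\,23323,\,23332$: $\frac{[6][4]}{1-2t-4t^3-4t^5+2t^6-2t^7+3t^8}$ - $22334,\,22343,\,23234,\,23243,\,23324,\,23342,\,23423,\,23432,\,24332$: $\frac{[6][4]}{1-2t-4t^3-4t^5+t^6-2t^7+2t^8}$ - $22344,\,22443,\,23244,\,23424,\,23442,\,24243,\,24342,\,24423,\,24432$: $\frac{[6][4]}{1-2t-4t^3-4t^5-2t^7+t^8}$ - $22444,\,24244,\,24424,\,24442$: $\frac{[4][2]}{1-2t-t^2-2t^3}$ - $23333,\,33332$: $\frac{[6][4]}{1-2t-4t^3-t^4-4t^5+2t^6-2t^7+3t^8}$ - $23334,\,23343,\,23433,\,24333,\,33342$: $\frac{[6][4]}{1-2t-4t^3-t^4-4t^5+t^6-2t^7+2t^8}$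 - $23344,\,23434,\,23443,\,24334,\,24343,\,24433,\,33442,\,34342,\,34432$: $\frac{[6][4]}{1-2t-4t^3-t^4-4t^5-2t^7+t^8}$ - $23444,\,24344,\,24434,\,24443,\,34442$: $\frac{[6][4]}{1-2t-4t^3-t^4-4t^5-t^6-2t^7}$ - $24444,\,44442$: $\frac{[4][2]}{1-2t-t^2-2t^3-t^4}$ - $33333$: $\frac{[6][2]}{1-2t-t^2-2t^3-t^4-2t^5+3t^6}$ - $33334,\,33343$: $\frac{[6][2]}{1-2t-t^2-2t^3-t^4-2t^5+2t^6}$ - $33344,\,33443,\,34343,\,34433$: $\frac{[6][2]}{1-2t-t^2-2t^3-t^4-2t^5+t^6}$ - $33444,\,34344,\,34434,\,34443$: $\frac{[6][2]}{1-2t-t^2-2t^3-t^4-2t^5}$ - $34444,\,44443$: $\frac{[6][2]}{1-2t-t^2-2t^3-t^4-2t^5-t^6}$ - $44444$: $\frac{[2][2]}{1-2t-2t^2}$ Type 4-VI: the complete graph on four vertices; $r_1,\dots,r_6$ label its six edges, in any order (a row stands for every assignment of the listed labels to the six edges). - $111111$: $\frac{[3][2]}{1-2t-2t^2+3t^3}$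 - $111112$: $\frac{[4][3][2]}{1-t-3t^2-t^3-t^4+t^5+3t^6}$ - $111113$: $\frac{[6][2]}{1-2t-2t^2+3t^3-2t^4-2t^5+3t^6}$ - $111114$: $\frac{[3][2]}{1-2t-2t^2+2t^3}$ - $111122$: $\frac{[4][3][2]}{1-t-3t^2-2t^3-t^4+t^5+3t^6}$ - $111123$: $\frac{[6][4]}{1-2t-t^2-3t^4+t^6-2t^7+3t^8}$ - $111124$: $\frac{[4][3][2]}{1-t-3t^2-2t^3-2t^4+2t^6}$ - $111133$: $\frac{[6][2]}{1-2t-2t^2+2t^3-2t^4-2t^5+3t^6}$ - $111134$: $\frac{[6][2]}{1-2t-2t^2+2t^3-2t^4-2t^5+2t^6}$ - $111144$: $\frac{[3]}{1-3t+t^2}$ - $111222$: $\frac{[4][3][2]}{1-t-3t^2-3t^3-t^4+t^5+3t^6}$ - $111223$: $\frac{[6][4]}{1-2t-t^2-t^3-2t^4-t^5+t^6-2t^7+3t^8}$ - $111224$: $\frac{[4][3][2]}{1-t-3t^2-3t^3-2t^4+2t^6}$ - $111233$: $\frac{[6][4]}{1-2t-t^2-t^3-3t^4-t^5+t^6-2t^7+3t^8}$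 - $111234$: $\frac{[6][4]}{1-2t-t^2-t^3-3t^4-t^5-2t^7+2t^8}$ - $111244$: $\frac{[4][3][2]}{1-t-3t^2-3t^3-3t^4-t^5+t^6}$ - $111333$: $\frac{[6][2]}{1-2t-2t^2+t^3-2t^4-2t^5+3t^6}$ - $111334$: $\frac{[6][2]}{1-2t-2t^2+t^3-2t^4-2t^5+2t^6}$ - $111344$: $\frac{[6][2]}{1-2t-2t^2+t^3-2t^4-2t^5+t^6}$ - $111444$: $\frac{[3][2]}{1-2t-2t^2}$ - $112222$: $\frac{[4][3][2]}{1-t-3t^2-4t^3-t^4+t^5+3t^6}$ - $112223$: $\frac{[6][4]}{1-2t-t^2-2t^3-t^4-2t^5+t^6-2t^7+3t^8}$ - $112224$: $\frac{[4][3][2]}{1-t-3t^2-4t^3-2t^4+2t^6}$ - $112233$: $\frac{[6][4]}{1-2t-t^2-2t^3-2t^4-2t^5+t^6-2t^7+3t^8}$ - $112234$: $\frac{[6][4]}{1-2t-t^2-2t^3-2t^4-2t^5-2t^7+2t^8}$ - $112244$: $\frac{[4][3][2]}{1-t-3t^2-4t^3-3t^4-t^5+t^6}$ - $112333$: $\frac{[6][4]}{1-2t-t^2-2t^3-3t^4-2t^5+t^6-2t^7+3t^8}$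 - $112334$: $\frac{[6][4]}{1-2t-t^2-2t^3-3t^4-2t^5-2t^7+2t^8}$ - $112344$: $\frac{[6][4]}{1-2t-t^2-2t^3-3t^4-2t^5-t^6-2t^7+t^8}$ - $112444$: $\frac{[4][3][2]}{1-t-3t^2-4t^3-4t^4-2t^5}$ - $113333$: $\frac{[6][2]}{1-2t-2t^2-2t^4-2t^5+3t^6}$ - $113334$: $\frac{[6][2]}{1-2t-2t^2-2t^4-2t^5+2t^6}$ - $113344$: $\frac{[6][2]}{1-2t-2t^2-2t^4-2t^5+t^6}$ - $113444$: $\frac{[6][2]}{1-2t-2t^2-2t^4-2t^5}$ - $114444$: $\frac{[3][2]}{1-2t-2t^2-t^3}$ - $122222$: $\frac{[4][3][2]}{1-t-3t^2-5t^3-t^4+t^5+3t^6}$ - $122223$: $\frac{[6][4]}{1-2t-t^2-3t^3-3t^5+t^6-2t^7+3t^8}$ - $122224$: $\frac{[4][3][2]}{1-t-3t^2-5t^3-2t^4+2t^6}$ - $122233$: $\frac{[6][4]}{1-2t-t^2-3t^3-t^4-3t^5+t^6-2t^7+3t^8}$ - $122234$: $\frac{[6][4]}{1-2t-t^2-3t^3-t^4-3t^5-2t^7+2t^8}$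 - $122244$: $\frac{[4][3][2]}{1-t-3t^2-5t^3-3t^4-t^5+t^6}$ - $122333$: $\frac{[6][4]}{1-2t-t^2-3t^3-2t^4-3t^5+t^6-2t^7+3t^8}$ - $122334$: $\frac{[6][4]}{1-2t-t^2-3t^3-2t^4-3t^5-2t^7+2t^8}$ - $122344$: $\frac{[6][4]}{1-2t-t^2-3t^3-2t^4-3t^5-t^6-2t^7+t^8}$ - $122444$: $\frac{[4][3][2]}{1-t-3t^2-5t^3-4t^4-2t^5}$ - $123333$: $\frac{[6][4]}{1-2t-t^2-3t^3-3t^4-3t^5+t^6-2t^7+3t^8}$ - $123334$: $\frac{[6][4]}{1-2t-t^2-3t^3-3t^4-3t^5-2t^7+2t^8}$ - $123344$: $\frac{[6][4]}{1-2t-t^2-3t^3-3t^4-3t^5-t^6-2t^7+t^8}$ - $123444$: $\frac{[6][4]}{1-2t-t^2-3t^3-3t^4-3t^5-2t^6-2t^7}$ - $124444$: $\frac{[4][3][2]}{1-t-3t^2-5t^3-5t^4-3t^5-t^6}$ - $133333$: $\frac{[6][2]}{1-2t-2t^2-t^3-2t^4-2t^5+3t^6}$ - $133334$: $\frac{[6][2]}{1-2t-2t^2-t^3-2t^4-2t^5+2t^6}$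 - $133344$: $\frac{[6][2]}{1-2t-2t^2-t^3-2t^4-2t^5+t^6}$ - $133444$: $\frac{[6][2]}{1-2t-2t^2-t^3-2t^4-2t^5}$ - $134444$: $\frac{[6][2]}{1-2t-2t^2-t^3-2t^4-2t^5-t^6}$ - $144444$: $\frac{[3][2]}{1-2t-2t^2-2t^3}$ - $222222$: $\frac{[4][2]}{1-2t-2t^2-2t^3+3t^4}$ - $222223$: $\frac{[6][4]}{1-2t-t^2-4t^3+t^4-4t^5+t^6-2t^7+3t^8}$ - $222224$: $\frac{[4][2]}{1-2t-2t^2-2t^3+2t^4}$ - $222233$: $\frac{[6][4]}{1-2t-t^2-4t^3-4t^5+t^6-2t^7+3t^8}$ - $222234$: $\frac{[6][4]}{1-2t-t^2-4t^3-4t^5-2t^7+2t^8}$ - $222244$: $\frac{[4][2]}{1-2t-2t^2-2t^3+t^4}$ - $222333$: $\frac{[6][4]}{1-2t-t^2-4t^3-t^4-4t^5+t^6-2t^7+3t^8}$ - $222334$: $\frac{[6][4]}{1-2t-t^2-4t^3-t^4-4t^5-2t^7+2t^8}$ - $222344$: $\frac{[6][4]}{1-2t-t^2-4t^3-t^4-4t^5-t^6-2t^7+t^8}$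 - $222444$: $\frac{[4][2]}{1-2t-2t^2-2t^3}$ - $223333$: $\frac{[6][4]}{1-2t-t^2-4t^3-2t^4-4t^5+t^6-2t^7+3t^8}$ - $223334$: $\frac{[6][4]}{1-2t-t^2-4t^3-2t^4-4t^5-2t^7+2t^8}$ - $223344$: $\frac{[6][4]}{1-2t-t^2-4t^3-2t^4-4t^5-t^6-2t^7+t^8}$ - $223444$: $\frac{[6][4]}{1-2t-t^2-4t^3-2t^4-4t^5-2t^6-2t^7}$ - $224444$: $\frac{[4][2]}{1-2t-2t^2-2t^3-t^4}$ - $233333$: $\frac{[6][4]}{1-2t-t^2-4t^3-3t^4-4t^5+t^6-2t^7+3t^8}$ - $233334$: $\frac{[6][4]}{1-2t-t^2-4t^3-3t^4-4t^5-2t^7+2t^8}$ - $233344$: $\frac{[6][4]}{1-2t-t^2-4t^3-3t^4-4t^5-t^6-2t^7+t^8}$ - $233444$: $\frac{[6][4]}{1-2t-t^2-4t^3-3t^4-4t^5-2t^6-2t^7}$ - $234444$: $\frac{[6][4]}{1-2t-t^2-4t^3-3t^4-4t^5-3t^6-2t^7-t^8}$ - $244444$: $\frac{[4][2]}{1-2t-2t^2-2t^3-2t^4}$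 - $333333$: $\frac{[6][2]}{1-2t-2t^2-2t^3-2t^4-2t^5+3t^6}$ - $333334$: $\frac{[6][2]}{1-2t-2t^2-2t^3-2t^4-2t^5+2t^6}$ - $333344$: $\frac{[6][2]}{1-2t-2t^2-2t^3-2t^4-2t^5+t^6}$ - $333444$: $\frac{[6][2]}{1-2t-2t^2-2t^3-2t^4-2t^5}$ - $334444$: $\frac{[6][2]}{1-2t-2t^2-2t^3-2t^4-2t^5-t^6}$ - $344444$: $\frac{[6][2]}{1-2t-2t^2-2t^3-2t^4-2t^5-2t^6}$ - $444444$: $\frac{[2]}{1-3t}$ -/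

import Mathlib

namespace KacMoody

open PowerSeries

/-- A (generalized) Cartan matrix of size `n`. -/
structure CartanMat (n : ℕ) where
  /-- the entries `a i j` -/
  a : Matrix (Fin n) (Fin n) ℤ
  diag : ∀ i, a i i = 2
  nonpos : ∀ i j, i ≠ j → a i j ≤ 0
  zero_symm : ∀ i j, a i j = 0 → a j i = 0

namespace CartanMat

variable {n : ℕ} (A : CartanMat n)

/-- `A` is not, up to a simultaneous permutation of rows and columns, a direct sum of two
Cartan matrices of smaller (positive) size. -/
def Indecomposable : Prop :=
  ¬ ∃ I : Set (Fin n), I.Nonempty ∧ Iᶜ.Nonempty ∧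
    ∀ i ∈ I, ∀ j ∈ Iᶜ, A.a i j = 0 ∧ A.a j i = 0

/-! The space `𝔥*` is `Fin n → ℝ`: the vector `x` stands for `∑ j, x j • ω j`, where `ω` is the
basis of `𝔥*` dual to the basis of simple coroots `α∨ j` of `𝔥`. -/

/-- The simple root `α i = ∑ j, a j i • ω j`. -/
def simpleRoot (i : Fin n) : Fin n → ℝ := fun j => (A.a j i : ℝ)

/-- The simple coroot `α∨ i`, as the linear form `x ↦ ⟨x, α∨ i⟩` on `𝔥*`. -/
def simpleCoroot (i : Fin n) : Module.Dual ℝ (Fin n → ℝ) := LinearMap.proj i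

theorem simpleCoroot_simpleRoot (i : Fin n) : simpleCoroot i (A.simpleRoot i) = 2 := by
  simp [simpleCoroot, simpleRoot, A.diag i]

/-- The Weyl reflection `σ i : x ↦ x - ⟨x, α∨ i⟩ • α i` of `𝔥*`. -/
noncomputable def simpleReflection (i : Fin n) : (Fin n → ℝ) ≃ₗ[ℝ] (Fin n → ℝ) :=
  Module.reflection (A.simpleCoroot_simpleRoot i)

/-- The Weyl group `W(A)`: the group of linear automorphisms of `𝔥*` generated by the
Weyl reflections `σ i`. -/
def weylGroup : Subgroup ((Fin n → ℝ) ≃ₗ[ℝ] (Fin n → ℝ)) :=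
  Subgroup.closure (Set.range A.simpleReflection)

/-- The length of `w ∈ W(A)`: the least `k` such that `w` is a product of `k` of the `σ i`. -/
noncomputable def length (w : A.weylGroup) : ℕ :=
  sInf {k | ∃ l : List (Fin n), l.length = k ∧ (l.map A.simpleReflection).prod = w}

/-- The Poincaré series `P_{F(A)}(q) = ∑_{w ∈ W(A)} q ^ (2 * length w)`, in the variable
`q = PowerSeries.X`. -/
noncomputable def poincareSeries : ℤ⟦X⟧ :=
  PowerSeries.mk fun m => (Nat.card {w : A.weylGroup // 2 * A.length w = m} : ℤ)

/-- The label of the pair `i ≠ j` in the Coxeter graph: `0` (no edge), `1`, `2`, `3`, `4` as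
`a i j * a j i` is `0`, `1`, `2`, `3`, or at least `4`. The order of `σ i * σ j` is
`2`, `3`, `4`, `6`, `∞` accordingly. -/
def edgeLabel (i j : Fin n) : ℕ := min (A.a i j * A.a j i).toNat 4

/-- For a list `E` of the edges of a graph on `Fin n` and a list `r` of positive labels: after a
renumbering `e` of the vertices, the Coxeter graph of `A` is the graph with the edges `E`, and
the `k`-th edge of `E` carries the `k`-th label of `r`. -/
def HasCoxeterGraph (E : List (Fin n × Fin n)) (r : List ℕ) : Prop :=
  ∃ e : Equiv.Perm (Fin n),
    E.map (fun p => A.edgeLabel (e p.1) (e p.2)) = r ∧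
    ∀ i j, i ≠ j → (i, j) ∉ E → (j, i) ∉ E → A.edgeLabel (e i) (e j) = 0

/-- The same with the labels of `r` placed on the edges of `E` in any order. -/
def HasCoxeterGraphUpToOrder (E : List (Fin n × Fin n)) (r : List ℕ) : Prop :=
  ∃ r' : List ℕ, r'.Perm r ∧ A.HasCoxeterGraph E r'

end CartanMat

/-- The polynomial in `t` with the given list of coefficients, the constant one first. -/
noncomputable def ofCoeffs (c : List ℤ) : Polynomial ℤ :=
  c.foldr (fun a p => Polynomial.C a + Polynomial.X * p) 0

/-- The coefficients of `[k] = 1 + t + ⋯ + t ^ (k - 1)`. -/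
def q (k : ℕ) : List ℤ := List.replicate k 1

/-- The coefficients of `1 + t ^ 3`. -/
def cubeOne : List ℤ := [1,0,0,1]

/-- An entry of the tables: a rational function of `t`, and the labels it belongs to. -/
structure Entry where
  /-- the lists of edge labels `[r₁, r₂, …]` that have this rational function -/
  labels : List (List ℕ)
  /-- the factors of the numerator, each by its coefficients -/
  num : List (List ℤ)
  /-- the coefficients of the denominator, the constant one first -/
  den : List ℤ

/-- The numerator `N(t)`. -/
noncomputable def Entry.N (x : Entry) : Polynomial ℤ := (x.num.map ofCoeffs).prod

/-- The denominator `D(t)`. -/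
noncomputable def Entry.D (x : Entry) : Polynomial ℤ := ofCoeffs x.den

/-- `P(q) = N(t) / D(t)` with `t = q ^ 2`, as formal power series in `q`. -/
def Entry.Represents (x : Entry) (P : ℤ⟦X⟧) : Prop :=
  IsUnit (Polynomial.aeval (PowerSeries.X ^ 2 : ℤ⟦X⟧) x.D) ∧
    P * Polynomial.aeval (PowerSeries.X ^ 2 : ℤ⟦X⟧) x.D =
      Polynomial.aeval (PowerSeries.X ^ 2 : ℤ⟦X⟧) x.N

/-! The reduced Coxeter graphs, with the edges in the order in which the tables list the labels. -/

/-- Path with three vertices. -/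
def graph3I : List (Fin 3 × Fin 3) := [(0, 1), (1, 2)]
/-- Triangle. -/
def graph3II : List (Fin 3 × Fin 3) := [(0, 1), (1, 2), (2, 0)]
/-- Path with four vertices. -/
def graph4I : List (Fin 4 × Fin 4) := [(0, 1), (1, 2), (2, 3)]
/-- Star with three leaves. -/
def graph4II : List (Fin 4 × Fin 4) := [(0, 1), (0, 2), (0, 3)]
/-- Triangle with a pendant edge: first the pendant edge, then the two edges of the triangle that
meet it, then the third one. -/
def graph4III : List (Fin 4 × Fin 4) := [(0, 1), (1, 2), (1, 3), (2, 3)]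
/-- Cycle with four vertices. -/
def graph4IV : List (Fin 4 × Fin 4) := [(0, 1), (1, 2), (2, 3), (3, 0)]
/-- Cycle `0 1 2 3` with the diagonal `0 2`: the two edges at `0`, the two edges at `2` (first the
one to `1`, then the one to `3`, at both), and the diagonal. -/
def graph4V : List (Fin 4 × Fin 4) := [(0, 1), (0, 3), (2, 1), (2, 3), (0, 2)]
/-- Complete graph with four vertices. -/
def graph4VI : List (Fin 4 × Fin 4) := [(0, 1), (0, 2), (0, 3), (1, 2), (1, 3), (2, 3)]

/-- The Poincaré series for the reduced Coxeter graph `graph3I`. -/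
def table3I : List Entry := [
  ⟨[[1,1]], [q 4,q 3,q 2], [1]⟩, ⟨[[1,2]], [q 6,q 4,q 2], [1]⟩,
  ⟨[[1,3]], [q 6,q 2], [1,-1,0,0,0,-1,1]⟩, ⟨[[1,4]], [q 3,q 2,q 2], [1,0,-1,-1]⟩,
  ⟨[[2,2]], [q 4,q 2], [1,-1,0,-1,1]⟩, ⟨[[2,3]], [q 6,q 4], [1,-1,1,-2,1,-2,1,-1,1]⟩,
  ⟨[[2,4]], [q 4,q 2], [1,-1,0,-1]⟩, ⟨[[3,3]], [q 6,q 2], [1,-1,0,-1,0,-1,1]⟩,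
  ⟨[[3,4]], [q 6,q 2], [1,-1,0,-1,0,-1]⟩, ⟨[[4,4]], [q 2,q 2], [1,-1,-1]⟩]

/-- The Poincaré series for the reduced Coxeter graph `graph3II`. -/
def table3II : List Entry := [
  ⟨[[1,1,1]], [q 3], [1,-2,1]⟩, ⟨[[1,1,2]], [q 4,q 3,q 2], [1,0,-1,-1,-1,0,1]⟩,
  ⟨[[1,1,3]], [q 6,q 2], [1,-1,-1,1,-1,-1,1]⟩, ⟨[[1,1,4]], [q 3,q 2], [1,-1,-1]⟩,
  ⟨[[1,2,2]], [q 4,q 3,q 2], [1,0,-1,-2,-1,0,1]⟩,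
  ⟨[[1,2,3]], [q 6,q 4], [1,-1,0,-1,-1,-1,0,-1,1]⟩,
  ⟨[[1,2,4]], [q 4,q 3,q 2], [1,0,-1,-2,-2,-1]⟩, ⟨[[1,3,3]], [q 6,q 2], [1,-1,-1,0,-1,-1,1]⟩,
  ⟨[[1,3,4]], [q 6,q 2], [1,-1,-1,0,-1,-1]⟩, ⟨[[1,4,4]], [q 3,q 2], [1,-1,-1,-1]⟩,
  ⟨[[2,2,2]], [q 4,q 2], [1,-1,-1,-1,1]⟩, ⟨[[2,2,3]], [q 6,q 4], [1,-1,0,-2,0,-2,0,-1,1]⟩,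
  ⟨[[2,2,4]], [q 4,q 2], [1,-1,-1,-1]⟩, ⟨[[2,3,3]], [q 6,q 4], [1,-1,0,-2,-1,-2,0,-1,1]⟩,
  ⟨[[2,3,4]], [q 6,q 4], [1,-1,0,-2,-1,-2,-1,-1]⟩, ⟨[[2,4,4]], [q 4,q 2], [1,-1,-1,-1,-1]⟩,
  ⟨[[3,3,3]], [q 6,q 2], [1,-1,-1,-1,-1,-1,1]⟩, ⟨[[3,3,4]], [q 6,q 2], [1,-1,-1,-1,-1,-1]⟩,
  ⟨[[3,4,4]], [q 6,q 2], [1,-1,-1,-1,-1,-1,-1]⟩, ⟨[[4,4,4]], [q 2], [1,-2]⟩]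

/-- The Poincaré series for the reduced Coxeter graph `graph4I`. -/
def table4I : List Entry := [
  ⟨[[1,1,1]], [q 5,q 4,q 3,q 2], [1]⟩, ⟨[[1,1,2]], [q 8,q 6,q 4,q 2], [1]⟩,
  ⟨[[1,1,3]], [q 6,q 4,q 2], [1,-1,0,0,-1,0,0,0,1]⟩, ⟨[[1,1,4]], [q 4,q 3,q 2], [1,-1,0,-1]⟩,
  ⟨[[1,2,1]], [q 12,q 8,q 6,q 2], [1]⟩, ⟨[[1,2,2]], [q 6,q 4,q 2], [1,-1,0,-1,0,0,0,0,1]⟩,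
  ⟨[[1,2,3]], [q 6,q 4,q 2], [1,-1,0,-1,-1,0,0,0,1]⟩,
  ⟨[[1,2,4]], [q 6,q 4,q 2], [1,-1,0,-1,-1,0,-1]⟩, ⟨[[1,3,1]], [q 6,q 2], [1,-2,1,0,-1,0,1]⟩,
  ⟨[[1,3,2]], [q 6,q 4,q 2], [1,-1,0,-1,-1,-1,0,0,1,1]⟩,
  ⟨[[1,3,3]], [q 6,q 2,q 2], [1,-1,-1,0,-1,-1,1,1]⟩, ⟨[[1,3,4]], [q 6,q 2], [1,-2,1,-1,0,-1,1]⟩,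
  ⟨[[1,4,1]], [q 3,q 2,q 2], [1,-1,-1]⟩, ⟨[[1,4,2]], [q 4,q 3,q 2,q 2], [1,0,-1,-2,-2,-1]⟩,
  ⟨[[1,4,3]], [q 6,q 2,q 2], [1,-1,-1,0,-1,-1]⟩, ⟨[[1,4,4]], [q 3,q 2,q 2], [1,-1,-1,-1]⟩,
  ⟨[[2,1,2]], [q 4,cubeOne,q 2], [1,-2,1,0,0,-1,2,-1]⟩,
  ⟨[[2,1,3]], [q 6,q 4,q 2], [1,-1,0,-1,0,-1,1,0,1]⟩,
  ⟨[[2,1,4]], [q 6,q 4,q 2], [1,-1,0,-1,0,-1]⟩, ⟨[[2,2,2]], [q 4,q 2,q 2], [1,-1,-1,-1,1,1]⟩,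
  ⟨[[2,2,3]], [q 6,q 4,q 2], [1,-1,0,-2,0,-1,0,0,1,1]⟩,
  ⟨[[2,2,4]], [q 4,q 2,q 2], [1,-1,-1,-1,0,1]⟩,
  ⟨[[2,3,2]], [q 6,q 4,q 2], [1,-1,0,-2,0,-2,0,0,1,1]⟩,
  ⟨[[2,3,3]], [q 6,q 4,q 2], [1,-1,0,-2,-1,-2,0,0,1,1]⟩,
  ⟨[[2,3,4]], [q 6,q 4,q 2], [1,-1,0,-2,-1,-2,-1,0,0,1]⟩,
  ⟨[[2,4,2]], [q 4,q 2,q 2], [1,-1,-1,-1]⟩, ⟨[[2,4,3]], [q 6,q 4,q 2], [1,-1,0,-2,-1,-2,-1,-1]⟩,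
  ⟨[[2,4,4]], [q 4,q 2,q 2], [1,-1,-1,-1,-1]⟩, ⟨[[3,1,3]], [q 6,q 2,q 2], [1,-1,-1,0,0,-1,1,1]⟩,
  ⟨[[3,1,4]], [q 6,q 2,q 2], [1,-1,-1,0,0,-1,0,1]⟩,
  ⟨[[3,2,3]], [q 6,q 4,q 2], [1,-1,0,-2,-1,-1,0,0,1,1]⟩,
  ⟨[[3,2,4]], [q 6,q 4,q 2], [1,-1,0,-2,-1,-1,-1,0,0,1]⟩,
  ⟨[[3,3,3]], [q 6,q 2,q 2], [1,-1,-1,-1,-1,-1,1,1]⟩,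
  ⟨[[3,3,4]], [q 6,q 2,q 2], [1,-1,-1,-1,-1,-1,0,1]⟩,
  ⟨[[3,4,3]], [q 6,q 2,q 2], [1,-1,-1,-1,-1,-1]⟩,
  ⟨[[3,4,4]], [q 6,q 2,q 2], [1,-1,-1,-1,-1,-1,-1]⟩, ⟨[[4,1,4]], [q 3,q 2,q 2], [1,-1,-1,-1,1]⟩,
  ⟨[[4,2,4]], [q 4,q 2], [1,-2,1,-2,1]⟩, ⟨[[4,3,4]], [q 6,q 2], [1,-2,1,-2,1,-2,1]⟩,
  ⟨[[4,4,4]], [q 2,q 2], [1,-2]⟩]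

/-- The Poincaré series for the reduced Coxeter graph `graph4II`. -/
def table4II : List Entry := [
  ⟨[[1,1,1]], [q 6,q 4,q 4,q 2], [1]⟩, ⟨[[1,1,2]], [q 4,cubeOne,q 2], [1,-2,1,0,0,-1,2,-1]⟩,
  ⟨[[1,1,3]], [q 6,q 4,q 2], [1,-1,0,-1,0,-2,1,0,1,1]⟩,
  ⟨[[1,1,4]], [q 4,q 3,q 2,q 2], [1,0,-1,-2,-1,-1]⟩,
  ⟨[[1,2,2]], [q 4,cubeOne,q 2], [1,-2,1,-1,1,-1,1]⟩,
  ⟨[[1,2,3]], [q 6,q 4,q 2], [1,-1,0,-2,0,-2,1,0,1,1]⟩,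
  ⟨[[1,2,4]], [q 6,q 4,q 2], [1,-1,0,-2,0,-2,0,-1]⟩,
  ⟨[[1,3,3]], [q 6,q 2,q 2], [1,-1,-1,-1,0,-2,1,2]⟩,
  ⟨[[1,3,4]], [q 6,q 2,q 2], [1,-1,-1,-1,0,-2,0,1]⟩,
  ⟨[[1,4,4]], [q 3,q 2,q 2,q 2], [1,0,-2,-3,-1]⟩, ⟨[[2,2,2]], [q 4,q 2,q 2], [1,-1,-1,-2,1,2]⟩,
  ⟨[[2,2,3]], [q 6,q 4,q 2], [1,-1,0,-3,0,-2,0,0,1,2]⟩,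
  ⟨[[2,2,4]], [q 4,q 2,q 2], [1,-1,-1,-2,0,1]⟩,
  ⟨[[2,3,3]], [q 6,q 4,q 2], [1,-1,0,-3,-1,-3,0,0,1,2]⟩,
  ⟨[[2,3,4]], [q 6,q 4,q 2], [1,-1,0,-3,-1,-3,-1,-1,0,1]⟩,
  ⟨[[2,4,4]], [q 4,q 2,q 2], [1,-1,-1,-2,-1]⟩,
  ⟨[[3,3,3]], [q 6,q 2,q 2], [1,-1,-1,-2,-1,-2,1,2]⟩,
  ⟨[[3,3,4]], [q 6,q 2,q 2], [1,-1,-1,-2,-1,-2,0,1]⟩,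
  ⟨[[3,4,4]], [q 6,q 2,q 2], [1,-1,-1,-2,-1,-2,-1]⟩, ⟨[[4,4,4]], [q 2,q 2,q 2], [1,-1,-2,-1]⟩]

/-- The Poincaré series for the reduced Coxeter graph `graph4III`. -/
def table4III : List Entry := [
  ⟨[[1,1,1,1]], [q 4,q 3], [1,-2,1,-1,1]⟩, ⟨[[1,1,1,2]], [q 4,q 3,q 2,q 2], [1,0,-2,-2,0,1,1]⟩,
  ⟨[[1,1,1,3]], [q 6,q 4,q 2], [1,-1,-1,0,-1,-1,0,0,1]⟩,
  ⟨[[1,1,1,4]], [q 4,q 3,q 2], [1,-1,-1,-1]⟩,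
  ⟨[[1,1,2,1]], [q 6,q 4,q 2], [1,-1,-1,0,-1,0,0,0,1]⟩,
  ⟨[[1,1,2,2]], [q 6,q 4,q 2], [1,-1,-1,-1,0,-1,0,0,1]⟩,
  ⟨[[1,1,2,3]], [q 6,q 4,q 2], [1,-1,-1,-1,-1,-1,0,0,1]⟩,
  ⟨[[1,1,2,4]], [q 6,q 4,q 2], [1,-1,-1,-1,-1,-1,-1]⟩,
  ⟨[[1,1,3,1]], [q 6,q 4], [1,-2,1,-1,-1,0,0,0,1]⟩,
  ⟨[[1,1,3,2]], [q 6,q 4,q 2], [1,-1,-1,-1,-1,-2,0,0,1,1]⟩,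
  ⟨[[1,1,3,3]], [q 6,q 4,q 2], [1,-1,-1,-1,-2,-2,0,0,1,1]⟩,
  ⟨[[1,1,3,4]], [q 6,q 4], [1,-2,1,-2,0,-2,1,-1,1]⟩,
  ⟨[[1,1,4,1]], [q 4,q 3,q 2], [1,-1,-1,-1,-1]⟩,
  ⟨[[1,1,4,2]], [q 4,q 3,q 2,q 2], [1,0,-2,-3,-2,-1]⟩,
  ⟨[[1,1,4,3]], [q 6,q 4,q 2], [1,-1,-1,-1,-2,-2,-1,-1]⟩,
  ⟨[[1,1,4,4]], [q 4,q 3,q 2], [1,-1,-1,-2,-1,-1]⟩,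
  ⟨[[1,2,2,1]], [q 6,q 4,q 2], [1,-1,-1,-1,-1,0,0,0,1]⟩,
  ⟨[[1,2,2,2]], [q 4,cubeOne,q 2], [1,-2,0,0,0,-1,1]⟩,
  ⟨[[1,2,2,3]], [q 6,q 4,q 2], [1,-1,-1,-2,-1,-1,0,0,1]⟩,
  ⟨[[1,2,2,4]], [q 4,cubeOne,q 2], [1,-2,0,0,-1]⟩,
  ⟨[[1,2,3,1],[2,1,3,1]], [q 6,q 4,q 2], [1,-1,-1,-1,-2,-1,0,0,1,1]⟩,
  ⟨[[1,2,3,2],[2,1,3,2]], [q 6,q 4,q 2], [1,-1,-1,-2,-1,-2,0,0,1,1]⟩,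
  ⟨[[1,2,3,3],[2,1,3,3]], [q 6,q 4,q 2], [1,-1,-1,-2,-2,-2,0,0,1,1]⟩,
  ⟨[[1,2,3,4],[2,1,3,4]], [q 6,q 4,q 2], [1,-1,-1,-2,-2,-2,-1,0,0,1]⟩,
  ⟨[[1,2,4,1],[2,1,4,1]], [q 6,q 4,q 2], [1,-1,-1,-1,-2,-1,-1,-1]⟩,
  ⟨[[1,2,4,2],[2,1,4,2]], [q 6,q 4,q 2], [1,-1,-1,-2,-1,-2,-1,-1]⟩,
  ⟨[[1,2,4,3],[2,1,4,3]], [q 6,q 4,q 2], [1,-1,-1,-2,-2,-2,-1,-1]⟩,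
  ⟨[[1,2,4,4],[2,1,4,4]], [q 6,q 4,q 2], [1,-1,-1,-2,-2,-2,-2,-1,-1]⟩,
  ⟨[[1,3,3,1],[3,1,3,1]], [q 6,q 2], [1,-2,0,0,-1,-1,2]⟩,
  ⟨[[1,3,3,2],[3,1,3,2]], [q 6,q 4,q 2], [1,-1,-1,-2,-2,-3,0,0,1,2]⟩,
  ⟨[[1,3,3,3],[3,1,3,3]], [q 6,q 2,q 2], [1,-1,-2,-1,-1,-2,1,2]⟩,
  ⟨[[1,3,3,4],[3,1,3,4]], [q 6,q 2], [1,-2,0,-1,0,-2,2]⟩,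
  ⟨[[1,3,4,1],[3,1,4,1],[4,1,3,1]], [q 6,q 2], [1,-2,0,0,-1,-1,1]⟩,
  ⟨[[1,3,4,2],[3,1,4,2],[4,1,3,2]], [q 6,q 4,q 2], [1,-1,-1,-2,-2,-3,-1,-1,0,1]⟩,
  ⟨[[1,3,4,3],[3,1,4,3],[4,1,3,3]], [q 6,q 2,q 2], [1,-1,-2,-1,-1,-2,0,1]⟩,
  ⟨[[1,3,4,4],[3,1,4,4],[4,1,3,4]], [q 6,q 2], [1,-2,0,-1,0,-2,1]⟩,
  ⟨[[1,4,4,1],[4,1,4,1]], [q 3,q 2,q 2], [1,-1,-2,-1]⟩,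
  ⟨[[1,4,4,2],[4,1,4,2]], [q 4,q 3,q 2,q 2], [1,0,-2,-4,-4,-3,-1]⟩,
  ⟨[[1,4,4,3],[4,1,4,3]], [q 6,q 2,q 2], [1,-1,-2,-1,-1,-2,-1]⟩,
  ⟨[[1,4,4,4],[4,1,4,4]], [q 3,q 2,q 2], [1,-1,-2,-2]⟩,
  ⟨[[2,1,1,1]], [q 6,q 4,q 2], [1,-1,-1,0,-1,0,1,0,1]⟩,
  ⟨[[2,1,1,2]], [q 6,q 4,q 2], [1,-1,-1,-1,0,-1,1,0,1]⟩,
  ⟨[[2,1,1,3]], [q 6,q 4,q 2], [1,-1,-1,-1,-1,-1,1,0,1]⟩,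
  ⟨[[2,1,1,4]], [q 6,q 4,q 2], [1,-1,-1,-1,-1,-1]⟩,
  ⟨[[2,1,2,1]], [q 6,q 4,q 2], [1,-1,-1,-1,-1,0,0,0,1,1]⟩,
  ⟨[[2,1,2,2]], [q 6,q 4,q 2], [1,-1,-1,-2,0,-1,0,0,1,1]⟩,
  ⟨[[2,1,2,3]], [q 6,q 4,q 2], [1,-1,-1,-2,-1,-1,0,0,1,1]⟩,
  ⟨[[2,1,2,4]], [q 6,q 4,q 2], [1,-1,-1,-2,-1,-1,-1,0,0,1]⟩,
  ⟨[[2,2,2,1]], [q 4,q 3,q 2], [1,-1,-1,-3,0,1,2]⟩,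
  ⟨[[2,2,2,2]], [q 4,q 2,q 2], [1,-1,-2,-2,1,2]⟩,
  ⟨[[2,2,2,3]], [q 6,q 4,q 2], [1,-1,-1,-3,-1,-1,-1,0,1,2]⟩,
  ⟨[[2,2,2,4]], [q 4,q 2], [1,-2,0,-2,2]⟩,
  ⟨[[2,2,3,1],[3,2,2,1]], [q 6,q 4], [1,-2,1,-3,1,-2,1,-1,2]⟩,
  ⟨[[2,2,3,2],[3,2,2,2]], [q 6,q 4,q 2], [1,-1,-1,-3,-1,-2,-1,0,1,2]⟩,
  ⟨[[2,2,3,3],[3,2,2,3]], [q 6,q 4,q 2], [1,-1,-1,-3,-2,-2,-1,0,1,2]⟩,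
  ⟨[[2,2,3,4],[3,2,2,4]], [q 6,q 4], [1,-2,1,-4,2,-4,2,-2,2]⟩,
  ⟨[[2,2,4,1],[4,2,2,1]], [q 4,q 3,q 2], [1,-1,-1,-3,-1,0,1]⟩,
  ⟨[[2,2,4,2],[4,2,2,2]], [q 4,q 2,q 2], [1,-1,-2,-2,0,1]⟩,
  ⟨[[2,2,4,3],[4,2,2,3]], [q 6,q 4,q 2], [1,-1,-1,-3,-2,-2,-2,-1,0,1]⟩,
  ⟨[[2,2,4,4],[4,2,2,4]], [q 4,q 2], [1,-2,0,-2,1]⟩,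
  ⟨[[2,3,3,1],[3,2,3,1]], [q 6,q 4], [1,-2,1,-3,0,-2,1,-1,2]⟩,
  ⟨[[2,3,3,2],[3,2,3,2]], [q 6,q 4,q 2], [1,-1,-1,-3,-2,-3,-1,0,1,2]⟩,
  ⟨[[2,3,3,3],[3,2,3,3]], [q 6,q 4,q 2], [1,-1,-1,-3,-3,-3,-1,0,1,2]⟩,
  ⟨[[2,3,3,4],[3,2,3,4]], [q 6,q 4], [1,-2,1,-4,1,-4,2,-2,2]⟩,
  ⟨[[2,3,4,1],[3,2,4,1],[4,2,3,1]], [q 6,q 4], [1,-2,1,-3,0,-2,0,-1,1]⟩,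
  ⟨[[2,3,4,2],[3,2,4,2],[4,2,3,2]], [q 6,q 4,q 2], [1,-1,-1,-3,-2,-3,-2,-1,0,1]⟩,
  ⟨[[2,3,4,3],[3,2,4,3],[4,2,3,3]], [q 6,q 4,q 2], [1,-1,-1,-3,-3,-3,-2,-1,0,1]⟩,
  ⟨[[2,3,4,4],[3,2,4,4],[4,2,3,4]], [q 6,q 4], [1,-2,1,-4,1,-4,1,-2,1]⟩,
  ⟨[[2,4,4,1],[4,2,4,1]], [q 4,q 3,q 2], [1,-1,-1,-3,-2,-1]⟩,
  ⟨[[2,4,4,2],[4,2,4,2]], [q 4,q 2,q 2], [1,-1,-2,-2,-1]⟩,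
  ⟨[[2,4,4,3],[4,2,4,3]], [q 6,q 4,q 2], [1,-1,-1,-3,-3,-3,-3,-2,-1]⟩,
  ⟨[[2,4,4,4],[4,2,4,4]], [q 4,q 2], [1,-2,0,-2]⟩, ⟨[[3,1,1,1]], [q 6,q 2], [1,-2,0,1,-1,-1,2]⟩,
  ⟨[[3,1,1,2]], [q 6,q 4,q 2], [1,-1,-1,-1,-1,-2,1,0,1,2]⟩,
  ⟨[[3,1,1,3]], [q 6,q 2,q 2], [1,-1,-2,0,0,-2,1,2]⟩,
  ⟨[[3,1,1,4]], [q 6,q 2], [1,-2,0,0,0,-2,2]⟩, ⟨[[3,1,2,1]], [q 6,q 4], [1,-2,1,-2,0,-1,1,-1,2]⟩,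
  ⟨[[3,1,2,2]], [q 6,q 4,q 2], [1,-1,-1,-2,-1,-2,0,0,1,2]⟩,
  ⟨[[3,1,2,3]], [q 6,q 4,q 2], [1,-1,-1,-2,-2,-2,0,0,1,2]⟩,
  ⟨[[3,1,2,4]], [q 6,q 4], [1,-2,1,-3,1,-3,2,-2,2]⟩,
  ⟨[[3,3,3,1]], [q 6,q 2], [1,-2,0,-1,-1,-1,2]⟩,
  ⟨[[3,3,3,2]], [q 6,q 4,q 2], [1,-1,-1,-3,-3,-4,-1,0,1,2]⟩,
  ⟨[[3,3,3,3]], [q 6,q 2,q 2], [1,-1,-2,-2,-2,-2,1,2]⟩,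
  ⟨[[3,3,3,4]], [q 6,q 2], [1,-2,0,-2,0,-2,2]⟩,
  ⟨[[3,3,4,1],[4,3,3,1]], [q 6,q 2], [1,-2,0,-1,-1,-1,1]⟩,
  ⟨[[3,3,4,2],[4,3,3,2]], [q 6,q 4,q 2], [1,-1,-1,-3,-3,-4,-2,-1,0,1]⟩,
  ⟨[[3,3,4,3],[4,3,3,3]], [q 6,q 2,q 2], [1,-1,-2,-2,-2,-2,0,1]⟩,
  ⟨[[3,3,4,4],[4,3,3,4]], [q 6,q 2], [1,-2,0,-2,0,-2,1]⟩,
  ⟨[[3,4,4,1],[4,3,4,1]], [q 6,q 2], [1,-2,0,-1,-1,-1]⟩,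
  ⟨[[3,4,4,2],[4,3,4,2]], [q 6,q 4,q 2], [1,-1,-1,-3,-3,-4,-3,-2,-1]⟩,
  ⟨[[3,4,4,3],[4,3,4,3]], [q 6,q 2,q 2], [1,-1,-2,-2,-2,-2,-1]⟩,
  ⟨[[3,4,4,4],[4,3,4,4]], [q 6,q 2], [1,-2,0,-2,0,-2]⟩,
  ⟨[[4,1,1,1]], [q 3,q 2,q 2], [1,-1,-2,0,1]⟩,
  ⟨[[4,1,1,2]], [q 4,q 3,q 2,q 2], [1,0,-2,-3,-2,-1,1,1]⟩,
  ⟨[[4,1,1,3]], [q 6,q 2,q 2], [1,-1,-2,0,0,-2,0,1]⟩,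
  ⟨[[4,1,1,4]], [q 3,q 2,q 2], [1,-1,-2,-1,1]⟩,
  ⟨[[4,1,2,1]], [q 4,q 3,q 2], [1,-1,-1,-2,-1,0,1]⟩,
  ⟨[[4,1,2,2]], [q 4,q 3,q 2,q 2], [1,0,-2,-4,-3,-1,1,1]⟩,
  ⟨[[4,1,2,3]], [q 6,q 4,q 2], [1,-1,-1,-2,-2,-2,-1,-1,0,1]⟩,
  ⟨[[4,1,2,4]], [q 4,q 3,q 2], [1,-1,-1,-3,-1,-1,1]⟩,
  ⟨[[4,4,4,1]], [q 3,q 2,q 2], [1,-1,-2,-2,-1]⟩,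
  ⟨[[4,4,4,2]], [q 4,q 2,q 2], [1,-1,-2,-2,-2,-1]⟩,
  ⟨[[4,4,4,3]], [q 6,q 2,q 2], [1,-1,-2,-2,-2,-2,-2,-1]⟩, ⟨[[4,4,4,4]], [q 2,q 2], [1,-2,-1]⟩]

/-- The Poincaré series for the reduced Coxeter graph `graph4IV`. -/
def table4IV : List Entry := [
  ⟨[[1,1,1,1]], [q 4], [1,-3,3,-1]⟩, ⟨[[1,1,1,2]], [q 4,cubeOne,q 2], [1,-2,0,2,-2,0,2,-1]⟩,
  ⟨[[1,1,1,3]], [q 6,q 4], [1,-2,1,-1,0,-1,1,0,1]⟩, ⟨[[1,1,1,4]], [q 4,q 3,q 2], [1,-1,-1,-1]⟩,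
  ⟨[[1,1,2,2]], [q 4,cubeOne,q 2], [1,-2,0,1,-1,0,1]⟩,
  ⟨[[1,1,2,3]], [q 6,q 4,q 2], [1,-1,-1,-1,-1,-1,0,1,1,1]⟩,
  ⟨[[1,1,2,4]], [q 6,q 4,q 2], [1,-1,-1,-1,-1,-1,-1]⟩,
  ⟨[[1,1,3,3]], [q 6,q 4], [1,-2,1,-2,0,-2,2,-1,2]⟩,
  ⟨[[1,1,3,4]], [q 6,q 4], [1,-2,1,-2,0,-2,1,-1,1]⟩,
  ⟨[[1,1,4,4]], [q 4,q 3,q 2], [1,-1,-1,-2,-1,-1]⟩,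
  ⟨[[1,2,1,2]], [q 4,cubeOne,q 2], [1,-2,0,1,-1,0,2,-1]⟩,
  ⟨[[1,2,1,3]], [q 6,q 4,q 2], [1,-1,-1,-1,-1,-1,1,1,1,1]⟩,
  ⟨[[1,2,1,4]], [q 6,q 4,q 2], [1,-1,-1,-1,-1,-1]⟩,
  ⟨[[1,2,2,2]], [q 4,cubeOne,q 2], [1,-2,0,0,0,0,0,1]⟩,
  ⟨[[1,2,2,3]], [q 6,q 4,q 2], [1,-1,-1,-2,-1,-1,0,1,1,2]⟩,
  ⟨[[1,2,2,4]], [q 6,q 4,q 2], [1,-1,-1,-2,-1,-1,-1,0,0,1]⟩,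
  ⟨[[1,2,3,2]], [q 6,q 4,q 2], [1,-1,-1,-2,-1,-1,0,1,1,1]⟩,
  ⟨[[1,2,3,3]], [q 6,q 4,q 2], [1,-1,-1,-2,-2,-2,0,1,1,2]⟩,
  ⟨[[1,2,3,4],[1,2,4,3]], [q 6,q 4,q 2], [1,-1,-1,-2,-2,-2,-1,0,0,1]⟩,
  ⟨[[1,2,4,2]], [q 4,cubeOne,q 2], [1,-2,0,0,-1]⟩,
  ⟨[[1,2,4,4]], [q 6,q 4,q 2], [1,-1,-1,-2,-2,-2,-2,-1,-1]⟩,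
  ⟨[[1,3,1,3]], [q 6,q 2], [1,-2,0,0,0,-2,3]⟩, ⟨[[1,3,1,4]], [q 6,q 2], [1,-2,0,0,0,-2,2]⟩,
  ⟨[[1,3,2,3]], [q 6,q 4], [1,-2,1,-3,1,-3,3,-2,3]⟩,
  ⟨[[1,3,2,4]], [q 6,q 4], [1,-2,1,-3,1,-3,2,-2,2]⟩,
  ⟨[[1,3,3,3]], [q 6,q 2], [1,-2,0,-1,0,-2,3]⟩,
  ⟨[[1,3,3,4],[1,3,4,3]], [q 6,q 2], [1,-2,0,-1,0,-2,2]⟩,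
  ⟨[[1,3,4,4],[1,4,3,4]], [q 6,q 2], [1,-2,0,-1,0,-2,1]⟩,
  ⟨[[1,4,1,4]], [q 3,q 2,q 2], [1,-1,-2,-1,1]⟩,
  ⟨[[1,4,2,4]], [q 4,q 3,q 2], [1,-1,-1,-3,-1,-1,1]⟩, ⟨[[1,4,4,4]], [q 3,q 2,q 2], [1,-1,-2,-2]⟩,
  ⟨[[2,2,2,2]], [q 4,q 2], [1,-2,0,-2,3]⟩, ⟨[[2,2,2,3]], [q 6,q 4], [1,-2,1,-4,3,-4,3,-2,3]⟩,
  ⟨[[2,2,2,4]], [q 4,q 2], [1,-2,0,-2,2]⟩,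
  ⟨[[2,2,3,3],[2,3,2,3]], [q 6,q 4], [1,-2,1,-4,2,-4,3,-2,3]⟩,
  ⟨[[2,2,3,4],[2,3,2,4]], [q 6,q 4], [1,-2,1,-4,2,-4,2,-2,2]⟩,
  ⟨[[2,2,4,4],[2,4,2,4]], [q 4,q 2], [1,-2,0,-2,1]⟩,
  ⟨[[2,3,3,3]], [q 6,q 4], [1,-2,1,-4,1,-4,3,-2,3]⟩,
  ⟨[[2,3,3,4],[2,3,4,3]], [q 6,q 4], [1,-2,1,-4,1,-4,2,-2,2]⟩,
  ⟨[[2,3,4,4],[2,4,3,4]], [q 6,q 4], [1,-2,1,-4,1,-4,1,-2,1]⟩,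
  ⟨[[2,4,4,4]], [q 4,q 2], [1,-2,0,-2]⟩, ⟨[[3,3,3,3]], [q 6,q 2], [1,-2,0,-2,0,-2,3]⟩,
  ⟨[[3,3,3,4]], [q 6,q 2], [1,-2,0,-2,0,-2,2]⟩,
  ⟨[[3,3,4,4],[3,4,3,4]], [q 6,q 2], [1,-2,0,-2,0,-2,1]⟩,
  ⟨[[3,4,4,4]], [q 6,q 2], [1,-2,0,-2,0,-2]⟩, ⟨[[4,4,4,4]], [q 2,q 2], [1,-2,-1]⟩]

/-- The Poincaré series for the reduced Coxeter graph `graph4V`. -/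
def table4V : List Entry := [
  ⟨[[1,1,1,1,1]], [q 4,q 3], [1,-2,0,0,0,1]⟩, ⟨[[1,1,1,1,2]], [q 4,q 3,q 2], [1,-1,-2,-1,0,1,1]⟩,
  ⟨[[1,1,1,1,3]], [q 6,q 4], [1,-2,0,0,-2,0,0,0,1]⟩, ⟨[[1,1,1,1,4]], [q 4,q 3], [1,-2,0,-1]⟩,
  ⟨[[1,1,1,2,1]], [q 6,q 4,q 2], [1,-1,-2,0,-1,-1,1,0,1,1]⟩,
  ⟨[[1,1,1,2,2]], [q 6,q 4,q 2], [1,-1,-2,-1,-1,-1,0,0,1,1]⟩,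
  ⟨[[1,1,1,2,3]], [q 6,q 4,q 2], [1,-1,-2,-1,-2,-2,0,0,1,1]⟩,
  ⟨[[1,1,1,2,4]], [q 6,q 4,q 2], [1,-1,-2,-1,-2,-2,-1,-1]⟩,
  ⟨[[1,1,1,3,1]], [q 6,q 4], [1,-2,0,0,-2,0,1,-1,2]⟩,
  ⟨[[1,1,1,3,2],[1,1,2,3,1]], [q 6,q 4], [1,-2,0,-1,-1,-1,1,-1,2]⟩,
  ⟨[[1,1,1,3,3],[1,1,3,3,1]], [q 6,q 4], [1,-2,0,-1,-2,-1,1,-1,2]⟩,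
  ⟨[[1,1,1,3,4],[1,1,1,4,3],[1,1,3,4,1]], [q 6,q 4], [1,-2,0,-1,-2,-1,0,-1,1]⟩,
  ⟨[[1,1,1,4,1]], [q 4,q 3,q 2], [1,-1,-2,-1,-1,0,1]⟩,
  ⟨[[1,1,1,4,2],[1,1,2,4,1]], [q 4,q 3,q 2], [1,-1,-2,-2,-1,0,1]⟩,
  ⟨[[1,1,1,4,4],[1,1,4,4,1]], [q 4,q 3,q 2], [1,-1,-2,-2,-2,-1]⟩,
  ⟨[[1,1,2,2,1]], [q 4,q 3,q 2], [1,-1,-2,-2,0,1,2]⟩,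
  ⟨[[1,1,2,2,2]], [q 4,q 3,q 2], [1,-1,-2,-3,0,1,2]⟩,
  ⟨[[1,1,2,2,3],[1,1,2,3,2]], [q 6,q 4], [1,-2,0,-2,0,-2,1,-1,2]⟩,
  ⟨[[1,1,2,2,4],[1,1,2,4,2]], [q 4,q 3,q 2], [1,-1,-2,-3,-1,0,1]⟩,
  ⟨[[1,1,2,3,3],[1,1,3,3,2]], [q 6,q 4], [1,-2,0,-2,-1,-2,1,-1,2]⟩,
  ⟨[[1,1,2,3,4],[1,1,2,4,3],[1,1,3,4,2]], [q 6,q 4], [1,-2,0,-2,-1,-2,0,-1,1]⟩,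
  ⟨[[1,1,2,4,4],[1,1,4,4,2]], [q 4,q 3,q 2], [1,-1,-2,-3,-2,-1]⟩,
  ⟨[[1,1,3,3,3]], [q 6,q 4], [1,-2,0,-2,-2,-2,1,-1,2]⟩,
  ⟨[[1,1,3,3,4],[1,1,3,4,3]], [q 6,q 4], [1,-2,0,-2,-2,-2,0,-1,1]⟩,
  ⟨[[1,1,3,4,4],[1,1,4,4,3]], [q 6,q 4], [1,-2,0,-2,-2,-2,-1,-1]⟩,
  ⟨[[1,1,4,4,4]], [q 4,q 3,q 2], [1,-1,-2,-3,-3,-2,-1]⟩,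
  ⟨[[1,2,1,2,1],[1,2,2,1,1]], [q 6,q 4,q 2], [1,-1,-2,-1,-1,-1,1,0,1,1]⟩,
  ⟨[[1,2,1,2,2],[1,2,2,1,2]], [q 6,q 4,q 2], [1,-1,-2,-2,-1,-1,0,0,1,1]⟩,
  ⟨[[1,2,1,2,3],[1,2,2,1,3]], [q 6,q 4,q 2], [1,-1,-2,-2,-2,-2,0,0,1,1]⟩,
  ⟨[[1,2,1,2,4],[1,2,2,1,4]], [q 6,q 4,q 2], [1,-1,-2,-2,-2,-2,-1,-1]⟩,
  ⟨[[1,2,1,3,1],[1,2,3,1,1]], [q 6,q 4,q 2], [1,-1,-2,-1,-2,-2,1,0,1,2]⟩,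
  ⟨[[1,2,1,3,2],[1,2,2,3,1],[1,2,3,1,2],[1,2,3,2,1]], [q 6,q 4,q 2], [1,-1,-2,-2,-2,-2,0,0,1,2]⟩,
  ⟨[[1,2,1,3,3],[1,2,3,1,3],[1,2,3,3,1]], [q 6,q 4,q 2], [1,-1,-2,-2,-3,-3,0,0,1,2]⟩,
  ⟨[[1,2,1,3,4],[1,2,1,4,3],[1,2,3,1,4],[1,2,3,4,1],[1,2,4,1,3],
    [1,2,4,3,1]], [q 6,q 4,q 2], [1,-1,-2,-2,-3,-3,-1,-1,0,1]⟩,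
  ⟨[[1,2,1,4,1],[1,2,4,1,1]], [q 6,q 4,q 2], [1,-1,-2,-1,-2,-2,0,-1,0,1]⟩,
  ⟨[[1,2,1,4,2],[1,2,2,4,1],[1,2,4,1,2],
    [1,2,4,2,1]], [q 6,q 4,q 2], [1,-1,-2,-2,-2,-2,-1,-1,0,1]⟩,
  ⟨[[1,2,1,4,4],[1,2,4,1,4],[1,2,4,4,1]], [q 6,q 4,q 2], [1,-1,-2,-2,-3,-3,-2,-2,-1]⟩,
  ⟨[[1,2,2,2,1]], [q 6,q 4,q 2], [1,-1,-2,-2,-1,-1,0,0,1,2]⟩,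
  ⟨[[1,2,2,2,2]], [q 6,q 4,q 2], [1,-1,-2,-3,-1,-1,-1,0,1,2]⟩,
  ⟨[[1,2,2,2,3],[1,2,2,3,2],[1,2,3,2,2]], [q 6,q 4,q 2], [1,-1,-2,-3,-2,-2,-1,0,1,2]⟩,
  ⟨[[1,2,2,2,4],[1,2,2,4,2],[1,2,4,2,2]], [q 6,q 4,q 2], [1,-1,-2,-3,-2,-2,-2,-1,0,1]⟩,
  ⟨[[1,2,2,3,3],[1,2,3,2,3],[1,2,3,3,2]], [q 6,q 4,q 2], [1,-1,-2,-3,-3,-3,-1,0,1,2]⟩,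
  ⟨[[1,2,2,3,4],[1,2,2,4,3],[1,2,3,2,4],[1,2,3,4,2],[1,2,4,2,3],
    [1,2,4,3,2]], [q 6,q 4,q 2], [1,-1,-2,-3,-3,-3,-2,-1,0,1]⟩,
  ⟨[[1,2,2,4,4],[1,2,4,2,4],[1,2,4,4,2]], [q 6,q 4,q 2], [1,-1,-2,-3,-3,-3,-3,-2,-1]⟩,
  ⟨[[1,2,3,3,3]], [q 6,q 4,q 2], [1,-1,-2,-3,-4,-4,-1,0,1,2]⟩,
  ⟨[[1,2,3,3,4],[1,2,3,4,3],[1,2,4,3,3]], [q 6,q 4,q 2], [1,-1,-2,-3,-4,-4,-2,-1,0,1]⟩,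
  ⟨[[1,2,3,4,4],[1,2,4,3,4],[1,2,4,4,3]], [q 6,q 4,q 2], [1,-1,-2,-3,-4,-4,-3,-2,-1]⟩,
  ⟨[[1,2,4,4,4]], [q 6,q 4,q 2], [1,-1,-2,-3,-4,-4,-4,-3,-2,-1]⟩,
  ⟨[[1,3,1,3,1],[1,3,3,1,1]], [q 6,q 2], [1,-2,-1,1,-1,-2,3]⟩,
  ⟨[[1,3,1,3,2],[1,3,2,3,1],[1,3,3,1,2],[1,3,3,2,1]], [q 6,q 4], [1,-2,0,-2,-1,-2,2,-2,3]⟩,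
  ⟨[[1,3,1,3,3],[1,3,3,1,3],[1,3,3,3,1]], [q 6,q 2], [1,-2,-1,0,-1,-2,3]⟩,
  ⟨[[1,3,1,3,4],[1,3,1,4,3],[1,3,3,1,4],[1,3,3,4,1],[1,3,4,1,3],[1,3,4,3,1],
    [1,4,3,3,1]], [q 6,q 2], [1,-2,-1,0,-1,-2,2]⟩,
  ⟨[[1,3,1,4,1],[1,3,4,1,1]], [q 6,q 2], [1,-2,-1,1,-1,-2,2]⟩,
  ⟨[[1,3,1,4,2],[1,3,2,4,1],[1,3,4,1,2],[1,3,4,2,1],[1,4,2,3,1],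
    [1,4,3,2,1]], [q 6,q 4], [1,-2,0,-2,-1,-2,1,-2,2]⟩,
  ⟨[[1,3,1,4,4],[1,3,4,1,4],[1,3,4,4,1],[1,4,1,4,3],[1,4,3,4,1],[1,4,4,1,3],
    [1,4,4,3,1]], [q 6,q 2], [1,-2,-1,0,-1,-2,1]⟩,
  ⟨[[1,3,2,2,1]], [q 6,q 4], [1,-2,0,-2,0,-2,2,-2,3]⟩,
  ⟨[[1,3,2,2,2],[2,2,2,3,1]], [q 6,q 4], [1,-2,0,-3,1,-3,2,-2,3]⟩,
  ⟨[[1,3,2,2,3],[1,3,2,3,2],[1,3,3,2,2],[2,2,3,3,1],[2,3,2,3,1],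
    [2,3,3,2,1]], [q 6,q 4], [1,-2,0,-3,0,-3,2,-2,3]⟩,
  ⟨[[1,3,2,2,4],[1,3,2,4,2],[1,3,4,2,2],[1,4,2,2,3],[1,4,2,3,2],[1,4,3,2,2],[2,2,3,4,1],
    [2,3,2,4,1],[2,3,4,2,1]], [q 6,q 4], [1,-2,0,-3,0,-3,1,-2,2]⟩,
  ⟨[[1,3,2,3,3],[1,3,3,2,3],[1,3,3,3,2],[2,3,3,3,1]], [q 6,q 4], [1,-2,0,-3,-1,-3,2,-2,3]⟩,
  ⟨[[1,3,2,3,4],[1,3,2,4,3],[1,3,3,2,4],[1,3,3,4,2],[1,3,4,2,3],[1,3,4,3,2],[1,4,2,3,3],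
    [1,4,3,2,3],[1,4,3,3,2],[2,3,3,4,1],[2,3,4,3,1],
    [2,4,3,3,1]], [q 6,q 4], [1,-2,0,-3,-1,-3,1,-2,2]⟩,
  ⟨[[1,3,2,4,4],[1,3,4,2,4],[1,3,4,4,2],[1,4,2,3,4],[1,4,2,4,3],[1,4,3,2,4],[1,4,3,4,2],
    [1,4,4,2,3],[1,4,4,3,2],[2,3,4,4,1],[2,4,3,4,1],
    [2,4,4,3,1]], [q 6,q 4], [1,-2,0,-3,-1,-3,0,-2,1]⟩,
  ⟨[[1,3,3,3,3],[3,3,3,3,1]], [q 6,q 2], [1,-2,-1,-1,-1,-2,3]⟩,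
  ⟨[[1,3,3,3,4],[1,3,3,4,3],[1,3,4,3,3],[1,4,3,3,3],
    [3,3,3,4,1]], [q 6,q 2], [1,-2,-1,-1,-1,-2,2]⟩,
  ⟨[[1,3,3,4,4],[1,3,4,3,4],[1,3,4,4,3],[1,4,3,3,4],[1,4,3,4,3],[1,4,4,3,3],[3,3,4,4,1],
    [3,4,3,4,1],[3,4,4,3,1]], [q 6,q 2], [1,-2,-1,-1,-1,-2,1]⟩,
  ⟨[[1,3,4,4,4],[1,4,3,4,4],[1,4,4,3,4],[1,4,4,4,3],[3,4,4,4,1]], [q 6,q 2], [1,-2,-1,-1,-1,-2]⟩,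
  ⟨[[1,4,1,4,1],[1,4,4,1,1]], [q 3,q 2,q 2], [1,-1,-3,-1,1]⟩,
  ⟨[[1,4,1,4,2],[1,4,2,4,1],[1,4,4,1,2],[1,4,4,2,1]], [q 4,q 3,q 2], [1,-1,-2,-3,-2,-1,1]⟩,
  ⟨[[1,4,1,4,4],[1,4,4,1,4],[1,4,4,4,1]], [q 3,q 2,q 2], [1,-1,-3,-2]⟩,
  ⟨[[1,4,2,2,1]], [q 4,q 3,q 2], [1,-1,-2,-3,-1,0,2]⟩,
  ⟨[[1,4,2,2,2],[2,2,2,4,1]], [q 4,q 3,q 2], [1,-1,-2,-4,-1,0,2]⟩,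
  ⟨[[1,4,2,2,4],[1,4,2,4,2],[1,4,4,2,2],[2,2,4,4,1],[2,4,2,4,1],
    [2,4,4,2,1]], [q 4,q 3,q 2], [1,-1,-2,-4,-2,-1,1]⟩,
  ⟨[[1,4,2,4,4],[1,4,4,2,4],[1,4,4,4,2],[2,4,4,4,1]], [q 4,q 3,q 2], [1,-1,-2,-4,-3,-2]⟩,
  ⟨[[1,4,4,4,4],[4,4,4,4,1]], [q 3,q 2,q 2], [1,-1,-3,-3,-1]⟩,
  ⟨[[2,2,2,2,1]], [q 4,q 3,q 2], [1,-1,-2,-4,0,1,3]⟩, ⟨[[2,2,2,2,2]], [q 4,q 2], [1,-2,-1,-2,3]⟩,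
  ⟨[[2,2,2,2,3],[2,2,2,3,2]], [q 6,q 4], [1,-2,0,-4,2,-4,2,-2,3]⟩,
  ⟨[[2,2,2,2,4],[2,2,2,4,2]], [q 4,q 2], [1,-2,-1,-2,2]⟩,
  ⟨[[2,2,2,3,3],[2,2,3,3,2],[2,3,2,3,2],[2,3,3,2,2]], [q 6,q 4], [1,-2,0,-4,1,-4,2,-2,3]⟩,
  ⟨[[2,2,2,3,4],[2,2,2,4,3],[2,2,3,4,2],[2,3,2,4,2],
    [2,3,4,2,2]], [q 6,q 4], [1,-2,0,-4,1,-4,1,-2,2]⟩,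
  ⟨[[2,2,2,4,4],[2,2,4,4,2],[2,4,2,4,2],[2,4,4,2,2]], [q 4,q 2], [1,-2,-1,-2,1]⟩,
  ⟨[[2,2,3,3,3],[2,3,2,3,3],[2,3,3,2,3],[2,3,3,3,2]], [q 6,q 4], [1,-2,0,-4,0,-4,2,-2,3]⟩,
  ⟨[[2,2,3,3,4],[2,2,3,4,3],[2,3,2,3,4],[2,3,2,4,3],[2,3,3,2,4],[2,3,3,4,2],[2,3,4,2,3],
    [2,3,4,3,2],[2,4,3,3,2]], [q 6,q 4], [1,-2,0,-4,0,-4,1,-2,2]⟩,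
  ⟨[[2,2,3,4,4],[2,2,4,4,3],[2,3,2,4,4],[2,3,4,2,4],[2,3,4,4,2],[2,4,2,4,3],[2,4,3,4,2],
    [2,4,4,2,3],[2,4,4,3,2]], [q 6,q 4], [1,-2,0,-4,0,-4,0,-2,1]⟩,
  ⟨[[2,2,4,4,4],[2,4,2,4,4],[2,4,4,2,4],[2,4,4,4,2]], [q 4,q 2], [1,-2,-1,-2]⟩,
  ⟨[[2,3,3,3,3],[3,3,3,3,2]], [q 6,q 4], [1,-2,0,-4,-1,-4,2,-2,3]⟩,
  ⟨[[2,3,3,3,4],[2,3,3,4,3],[2,3,4,3,3],[2,4,3,3,3],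
    [3,3,3,4,2]], [q 6,q 4], [1,-2,0,-4,-1,-4,1,-2,2]⟩,
  ⟨[[2,3,3,4,4],[2,3,4,3,4],[2,3,4,4,3],[2,4,3,3,4],[2,4,3,4,3],[2,4,4,3,3],[3,3,4,4,2],
    [3,4,3,4,2],[3,4,4,3,2]], [q 6,q 4], [1,-2,0,-4,-1,-4,0,-2,1]⟩,
  ⟨[[2,3,4,4,4],[2,4,3,4,4],[2,4,4,3,4],[2,4,4,4,3],
    [3,4,4,4,2]], [q 6,q 4], [1,-2,0,-4,-1,-4,-1,-2]⟩,
  ⟨[[2,4,4,4,4],[4,4,4,4,2]], [q 4,q 2], [1,-2,-1,-2,-1]⟩,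
  ⟨[[3,3,3,3,3]], [q 6,q 2], [1,-2,-1,-2,-1,-2,3]⟩,
  ⟨[[3,3,3,3,4],[3,3,3,4,3]], [q 6,q 2], [1,-2,-1,-2,-1,-2,2]⟩,
  ⟨[[3,3,3,4,4],[3,3,4,4,3],[3,4,3,4,3],[3,4,4,3,3]], [q 6,q 2], [1,-2,-1,-2,-1,-2,1]⟩,
  ⟨[[3,3,4,4,4],[3,4,3,4,4],[3,4,4,3,4],[3,4,4,4,3]], [q 6,q 2], [1,-2,-1,-2,-1,-2]⟩,
  ⟨[[3,4,4,4,4],[4,4,4,4,3]], [q 6,q 2], [1,-2,-1,-2,-1,-2,-1]⟩,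
  ⟨[[4,4,4,4,4]], [q 2,q 2], [1,-2,-2]⟩]

/-- The Poincaré series for the reduced Coxeter graph `graph4VI`. -/
def table4VI : List Entry := [
  ⟨[[1,1,1,1,1,1]], [q 3,q 2], [1,-2,-2,3]⟩,
  ⟨[[1,1,1,1,1,2]], [q 4,q 3,q 2], [1,-1,-3,-1,-1,1,3]⟩,
  ⟨[[1,1,1,1,1,3]], [q 6,q 2], [1,-2,-2,3,-2,-2,3]⟩, ⟨[[1,1,1,1,1,4]], [q 3,q 2], [1,-2,-2,2]⟩,
  ⟨[[1,1,1,1,2,2]], [q 4,q 3,q 2], [1,-1,-3,-2,-1,1,3]⟩,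
  ⟨[[1,1,1,1,2,3]], [q 6,q 4], [1,-2,-1,0,-3,0,1,-2,3]⟩,
  ⟨[[1,1,1,1,2,4]], [q 4,q 3,q 2], [1,-1,-3,-2,-2,0,2]⟩,
  ⟨[[1,1,1,1,3,3]], [q 6,q 2], [1,-2,-2,2,-2,-2,3]⟩,
  ⟨[[1,1,1,1,3,4]], [q 6,q 2], [1,-2,-2,2,-2,-2,2]⟩, ⟨[[1,1,1,1,4,4]], [q 3], [1,-3,1]⟩,
  ⟨[[1,1,1,2,2,2]], [q 4,q 3,q 2], [1,-1,-3,-3,-1,1,3]⟩,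
  ⟨[[1,1,1,2,2,3]], [q 6,q 4], [1,-2,-1,-1,-2,-1,1,-2,3]⟩,
  ⟨[[1,1,1,2,2,4]], [q 4,q 3,q 2], [1,-1,-3,-3,-2,0,2]⟩,
  ⟨[[1,1,1,2,3,3]], [q 6,q 4], [1,-2,-1,-1,-3,-1,1,-2,3]⟩,
  ⟨[[1,1,1,2,3,4]], [q 6,q 4], [1,-2,-1,-1,-3,-1,0,-2,2]⟩,
  ⟨[[1,1,1,2,4,4]], [q 4,q 3,q 2], [1,-1,-3,-3,-3,-1,1]⟩,
  ⟨[[1,1,1,3,3,3]], [q 6,q 2], [1,-2,-2,1,-2,-2,3]⟩,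
  ⟨[[1,1,1,3,3,4]], [q 6,q 2], [1,-2,-2,1,-2,-2,2]⟩,
  ⟨[[1,1,1,3,4,4]], [q 6,q 2], [1,-2,-2,1,-2,-2,1]⟩, ⟨[[1,1,1,4,4,4]], [q 3,q 2], [1,-2,-2]⟩,
  ⟨[[1,1,2,2,2,2]], [q 4,q 3,q 2], [1,-1,-3,-4,-1,1,3]⟩,
  ⟨[[1,1,2,2,2,3]], [q 6,q 4], [1,-2,-1,-2,-1,-2,1,-2,3]⟩,
  ⟨[[1,1,2,2,2,4]], [q 4,q 3,q 2], [1,-1,-3,-4,-2,0,2]⟩,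
  ⟨[[1,1,2,2,3,3]], [q 6,q 4], [1,-2,-1,-2,-2,-2,1,-2,3]⟩,
  ⟨[[1,1,2,2,3,4]], [q 6,q 4], [1,-2,-1,-2,-2,-2,0,-2,2]⟩,
  ⟨[[1,1,2,2,4,4]], [q 4,q 3,q 2], [1,-1,-3,-4,-3,-1,1]⟩,
  ⟨[[1,1,2,3,3,3]], [q 6,q 4], [1,-2,-1,-2,-3,-2,1,-2,3]⟩,
  ⟨[[1,1,2,3,3,4]], [q 6,q 4], [1,-2,-1,-2,-3,-2,0,-2,2]⟩,
  ⟨[[1,1,2,3,4,4]], [q 6,q 4], [1,-2,-1,-2,-3,-2,-1,-2,1]⟩,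
  ⟨[[1,1,2,4,4,4]], [q 4,q 3,q 2], [1,-1,-3,-4,-4,-2]⟩,
  ⟨[[1,1,3,3,3,3]], [q 6,q 2], [1,-2,-2,0,-2,-2,3]⟩,
  ⟨[[1,1,3,3,3,4]], [q 6,q 2], [1,-2,-2,0,-2,-2,2]⟩,
  ⟨[[1,1,3,3,4,4]], [q 6,q 2], [1,-2,-2,0,-2,-2,1]⟩,
  ⟨[[1,1,3,4,4,4]], [q 6,q 2], [1,-2,-2,0,-2,-2]⟩, ⟨[[1,1,4,4,4,4]], [q 3,q 2], [1,-2,-2,-1]⟩,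
  ⟨[[1,2,2,2,2,2]], [q 4,q 3,q 2], [1,-1,-3,-5,-1,1,3]⟩,
  ⟨[[1,2,2,2,2,3]], [q 6,q 4], [1,-2,-1,-3,0,-3,1,-2,3]⟩,
  ⟨[[1,2,2,2,2,4]], [q 4,q 3,q 2], [1,-1,-3,-5,-2,0,2]⟩,
  ⟨[[1,2,2,2,3,3]], [q 6,q 4], [1,-2,-1,-3,-1,-3,1,-2,3]⟩,
  ⟨[[1,2,2,2,3,4]], [q 6,q 4], [1,-2,-1,-3,-1,-3,0,-2,2]⟩,
  ⟨[[1,2,2,2,4,4]], [q 4,q 3,q 2], [1,-1,-3,-5,-3,-1,1]⟩,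
  ⟨[[1,2,2,3,3,3]], [q 6,q 4], [1,-2,-1,-3,-2,-3,1,-2,3]⟩,
  ⟨[[1,2,2,3,3,4]], [q 6,q 4], [1,-2,-1,-3,-2,-3,0,-2,2]⟩,
  ⟨[[1,2,2,3,4,4]], [q 6,q 4], [1,-2,-1,-3,-2,-3,-1,-2,1]⟩,
  ⟨[[1,2,2,4,4,4]], [q 4,q 3,q 2], [1,-1,-3,-5,-4,-2]⟩,
  ⟨[[1,2,3,3,3,3]], [q 6,q 4], [1,-2,-1,-3,-3,-3,1,-2,3]⟩,
  ⟨[[1,2,3,3,3,4]], [q 6,q 4], [1,-2,-1,-3,-3,-3,0,-2,2]⟩,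
  ⟨[[1,2,3,3,4,4]], [q 6,q 4], [1,-2,-1,-3,-3,-3,-1,-2,1]⟩,
  ⟨[[1,2,3,4,4,4]], [q 6,q 4], [1,-2,-1,-3,-3,-3,-2,-2]⟩,
  ⟨[[1,2,4,4,4,4]], [q 4,q 3,q 2], [1,-1,-3,-5,-5,-3,-1]⟩,
  ⟨[[1,3,3,3,3,3]], [q 6,q 2], [1,-2,-2,-1,-2,-2,3]⟩,
  ⟨[[1,3,3,3,3,4]], [q 6,q 2], [1,-2,-2,-1,-2,-2,2]⟩,
  ⟨[[1,3,3,3,4,4]], [q 6,q 2], [1,-2,-2,-1,-2,-2,1]⟩,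
  ⟨[[1,3,3,4,4,4]], [q 6,q 2], [1,-2,-2,-1,-2,-2]⟩,
  ⟨[[1,3,4,4,4,4]], [q 6,q 2], [1,-2,-2,-1,-2,-2,-1]⟩,
  ⟨[[1,4,4,4,4,4]], [q 3,q 2], [1,-2,-2,-2]⟩, ⟨[[2,2,2,2,2,2]], [q 4,q 2], [1,-2,-2,-2,3]⟩,
  ⟨[[2,2,2,2,2,3]], [q 6,q 4], [1,-2,-1,-4,1,-4,1,-2,3]⟩,
  ⟨[[2,2,2,2,2,4]], [q 4,q 2], [1,-2,-2,-2,2]⟩,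
  ⟨[[2,2,2,2,3,3]], [q 6,q 4], [1,-2,-1,-4,0,-4,1,-2,3]⟩,
  ⟨[[2,2,2,2,3,4]], [q 6,q 4], [1,-2,-1,-4,0,-4,0,-2,2]⟩,
  ⟨[[2,2,2,2,4,4]], [q 4,q 2], [1,-2,-2,-2,1]⟩,
  ⟨[[2,2,2,3,3,3]], [q 6,q 4], [1,-2,-1,-4,-1,-4,1,-2,3]⟩,
  ⟨[[2,2,2,3,3,4]], [q 6,q 4], [1,-2,-1,-4,-1,-4,0,-2,2]⟩,
  ⟨[[2,2,2,3,4,4]], [q 6,q 4], [1,-2,-1,-4,-1,-4,-1,-2,1]⟩,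
  ⟨[[2,2,2,4,4,4]], [q 4,q 2], [1,-2,-2,-2]⟩,
  ⟨[[2,2,3,3,3,3]], [q 6,q 4], [1,-2,-1,-4,-2,-4,1,-2,3]⟩,
  ⟨[[2,2,3,3,3,4]], [q 6,q 4], [1,-2,-1,-4,-2,-4,0,-2,2]⟩,
  ⟨[[2,2,3,3,4,4]], [q 6,q 4], [1,-2,-1,-4,-2,-4,-1,-2,1]⟩,
  ⟨[[2,2,3,4,4,4]], [q 6,q 4], [1,-2,-1,-4,-2,-4,-2,-2]⟩,
  ⟨[[2,2,4,4,4,4]], [q 4,q 2], [1,-2,-2,-2,-1]⟩,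
  ⟨[[2,3,3,3,3,3]], [q 6,q 4], [1,-2,-1,-4,-3,-4,1,-2,3]⟩,
  ⟨[[2,3,3,3,3,4]], [q 6,q 4], [1,-2,-1,-4,-3,-4,0,-2,2]⟩,
  ⟨[[2,3,3,3,4,4]], [q 6,q 4], [1,-2,-1,-4,-3,-4,-1,-2,1]⟩,
  ⟨[[2,3,3,4,4,4]], [q 6,q 4], [1,-2,-1,-4,-3,-4,-2,-2]⟩,
  ⟨[[2,3,4,4,4,4]], [q 6,q 4], [1,-2,-1,-4,-3,-4,-3,-2,-1]⟩,
  ⟨[[2,4,4,4,4,4]], [q 4,q 2], [1,-2,-2,-2,-2]⟩,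
  ⟨[[3,3,3,3,3,3]], [q 6,q 2], [1,-2,-2,-2,-2,-2,3]⟩,
  ⟨[[3,3,3,3,3,4]], [q 6,q 2], [1,-2,-2,-2,-2,-2,2]⟩,
  ⟨[[3,3,3,3,4,4]], [q 6,q 2], [1,-2,-2,-2,-2,-2,1]⟩,
  ⟨[[3,3,3,4,4,4]], [q 6,q 2], [1,-2,-2,-2,-2,-2]⟩,
  ⟨[[3,3,4,4,4,4]], [q 6,q 2], [1,-2,-2,-2,-2,-2,-1]⟩,
  ⟨[[3,4,4,4,4,4]], [q 6,q 2], [1,-2,-2,-2,-2,-2,-2]⟩, ⟨[[4,4,4,4,4,4]], [q 2], [1,-3]⟩]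

end KacMoody

open KacMoody

/-! ### Simple reflections, words, parabolic subgroups and lengths. -/

namespace KacMoody.CartanMat

variable {n : ℕ} (A : CartanMat n)

/-! For a set `J` of indices let `W_J` be the subgroup generated by the `σ_j` with `j ∈ J`, and let
`W_J(t) = ∑ t ^ l(w)` over `w ∈ W_J`, with lengths taken in the whole Weyl group. The computation
rests on the identity `∑_{K ⊆ J} (-1)^|K| / W_K(t) = t^N / W_J(t)` of `sum_invSeries`, where `N` is
the length of the longest element of `W_J`; if there is no such element, the right side is `0`. It
determines `1 / W_J` from proper subsets of `J` and the number `N`, hence recursively from the edge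
labels.

The identity needs two facts: every `w ∈ W_J` factors uniquely, with lengths adding, as an element
of `W_K` times a shortest representative of its coset (`series_parabolic_mul`), and
inclusion-exclusion over the indices that do not shorten `w` (`sum_series_cosetReps`). Both are
derived from the linear action instead of a Coxeter presentation. Call `w` positive at `i` if the
`i`-th coordinate of `w x` is nonnegative for all dominant `x`. Then `σ_i` lengthens `w` if and only
if `w` is positive at `i`; the hard half is `isPos_of_len_le`, which is reduced to dihedral
subgroups, where it is a two-term recurrence.

Whether a longest element exists is decided in two ways. A nonzero nonnegative combination of
coroots of `J` that pairs nonpositively with all simple roots of `J` excludes it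
(`series_longest_eq_zero`); stars, cycles and one kind of path supply all the combinations needed.
In the remaining cases a word found by a greedy search is certified by the orbit of `(1, …, 1)`
(`series_longest_eq_of_word`).

The polynomial `[2][4][6]`, which belongs to `B₃`, is a common multiple of the Poincaré polynomials
of all finite types of rank at most three. Multiplied by it, every `1 / W_J` with `|J| ≤ 3` becomes
a polynomial, and each table entry becomes an identity of integer coefficient lists that is checked
by evaluation. The classification in part (a) is a finite check as well: all patterns of edges are
enumerated, and the labels in the tables, moved by graph automorphisms, are compared with the set of
all lists of labels. -/

theorem simpleReflection_apply (i k : Fin n) (x : Fin n → ℝ) :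
    A.simpleReflection i x k = x k - A.a k i * x i := by
  simp [simpleReflection, Module.reflection_apply, simpleCoroot, simpleRoot, mul_comm]

theorem simpleReflection_apply_self (i : Fin n) (x : Fin n → ℝ) :
    A.simpleReflection i x i = - x i := by
  rw [simpleReflection_apply, A.diag]; push_cast; ring

theorem simpleReflection_mul_self (i : Fin n) :
    A.simpleReflection i * A.simpleReflection i = 1 := by
  ext x k
  simp only [LinearEquiv.mul_apply, LinearEquiv.coe_one, id]
  rw [simpleReflection_apply, simpleReflection_apply_self, simpleReflection_apply]; ring

theorem simpleReflection_inv (i : Fin n) :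
    (A.simpleReflection i)⁻¹ = A.simpleReflection i :=
  inv_eq_of_mul_eq_one_left (A.simpleReflection_mul_self i)

theorem simpleReflection_mul_cancel (i : Fin n) (w : (Fin n → ℝ) ≃ₗ[ℝ] (Fin n → ℝ)) :
    A.simpleReflection i * (A.simpleReflection i * w) = w := by
  rw [← mul_assoc, simpleReflection_mul_self, one_mul]

/-- The product of the simple reflections along a word. -/
noncomputable def wordProd (l : List (Fin n)) : (Fin n → ℝ) ≃ₗ[ℝ] (Fin n → ℝ) :=
  (l.map A.simpleReflection).prod

theorem wordProd_nil : A.wordProd [] = 1 := by simp [wordProd]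

theorem wordProd_cons (i : Fin n) (l : List (Fin n)) :
    A.wordProd (i :: l) = A.simpleReflection i * A.wordProd l := by simp [wordProd]

theorem wordProd_append (l l' : List (Fin n)) :
    A.wordProd (l ++ l') = A.wordProd l * A.wordProd l' := by simp [wordProd]

theorem wordProd_reverse (l : List (Fin n)) : A.wordProd l.reverse = (A.wordProd l)⁻¹ := by
  induction l with
  | nil => simp [wordProd]
  | cons i l ih =>
    rw [List.reverse_cons, wordProd_append, ih, wordProd_cons, wordProd_nil, mul_one,
      wordProd_cons, mul_inv_rev, simpleReflection_inv]

/-- The subgroup generated by the simple reflections with index in `J`. -/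
def parabolic (J : Set (Fin n)) : Subgroup ((Fin n → ℝ) ≃ₗ[ℝ] (Fin n → ℝ)) :=
  Subgroup.closure (A.simpleReflection '' J)

theorem weylGroup_eq : A.weylGroup = A.parabolic Set.univ := by
  simp [weylGroup, parabolic]

variable {A}

theorem parabolic_mono {I J : Set (Fin n)} (h : I ⊆ J) : A.parabolic I ≤ A.parabolic J :=
  Subgroup.closure_mono (Set.image_mono h)

theorem simpleReflection_mem {J : Set (Fin n)} {i : Fin n} (hi : i ∈ J) :
    A.simpleReflection i ∈ A.parabolic J :=
  Subgroup.subset_closure ⟨i, hi, rfl⟩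

theorem wordProd_mem {J : Set (Fin n)} {l : List (Fin n)} (hl : ∀ i ∈ l, i ∈ J) :
    A.wordProd l ∈ A.parabolic J := by
  induction l with
  | nil => rw [wordProd_nil]; exact one_mem _
  | cons i l ih =>
    rw [wordProd_cons]
    exact mul_mem (simpleReflection_mem (hl i (by simp))) (ih fun k hk => hl k (by simp [hk]))

theorem exists_word {J : Set (Fin n)} {w : (Fin n → ℝ) ≃ₗ[ℝ] (Fin n → ℝ)}
    (hw : w ∈ A.parabolic J) : ∃ l : List (Fin n), (∀ i ∈ l, i ∈ J) ∧ A.wordProd l = w := by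
  induction hw using Subgroup.closure_induction with
  | mem x hx =>
    obtain ⟨i, hi, rfl⟩ := hx
    exact ⟨[i], by simpa using hi, by simp [wordProd]⟩
  | one => exact ⟨[], by simp, wordProd_nil A⟩
  | mul x y _ _ hx hy =>
    obtain ⟨l, hl, rfl⟩ := hx
    obtain ⟨l', hl', rfl⟩ := hy
    refine ⟨l ++ l', fun i hi => ?_, wordProd_append A l l'⟩
    rcases List.mem_append.1 hi with h | h
    exacts [hl i h, hl' i h]
  | inv x _ hx =>
    obtain ⟨l, hl, rfl⟩ := hx
    exact ⟨l.reverse, fun i hi => hl i (List.mem_reverse.1 hi), wordProd_reverse A l⟩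

variable (A) in
/-- The length of an element of the subgroup `parabolic J` with respect to the simple reflections
with index in `J`. -/
noncomputable def len (J : Set (Fin n)) (w : (Fin n → ℝ) ≃ₗ[ℝ] (Fin n → ℝ)) : ℕ :=
  sInf {k | ∃ l : List (Fin n), (∀ i ∈ l, i ∈ J) ∧ l.length = k ∧ A.wordProd l = w}

theorem exists_reduced_word {J : Set (Fin n)} {w : (Fin n → ℝ) ≃ₗ[ℝ] (Fin n → ℝ)}
    (hw : w ∈ A.parabolic J) :
    ∃ l : List (Fin n), (∀ i ∈ l, i ∈ J) ∧ l.length = A.len J w ∧ A.wordProd l = w := by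
  obtain ⟨l, hl, h⟩ := exists_word hw
  exact Nat.sInf_mem (s := {k | ∃ l : List (Fin n), (∀ i ∈ l, i ∈ J) ∧ l.length = k ∧
    A.wordProd l = w}) ⟨l.length, l, hl, rfl, h⟩

theorem len_wordProd_le {J : Set (Fin n)} {l : List (Fin n)} (hl : ∀ i ∈ l, i ∈ J) :
    A.len J (A.wordProd l) ≤ l.length :=
  Nat.sInf_le ⟨l, hl, rfl, rfl⟩

theorem len_one (J : Set (Fin n)) : A.len J 1 = 0 := by
  have := len_wordProd_le (A := A) (J := J) (l := []) (by simp)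
  simpa [wordProd_nil] using this

theorem len_simpleReflection_le {J : Set (Fin n)} {i : Fin n} (hi : i ∈ J) :
    A.len J (A.simpleReflection i) ≤ 1 := by
  simpa [wordProd] using len_wordProd_le (A := A) (J := J) (l := [i]) (by simpa using hi)

theorem len_mul_le {J : Set (Fin n)} {v w : (Fin n → ℝ) ≃ₗ[ℝ] (Fin n → ℝ)}
    (hv : v ∈ A.parabolic J) (hw : w ∈ A.parabolic J) :
    A.len J (v * w) ≤ A.len J v + A.len J w := by
  obtain ⟨l, hl, hn, rfl⟩ := exists_reduced_word hv
  obtain ⟨l', hl', hn', rfl⟩ := exists_reduced_word hw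
  rw [← hn, ← hn', ← wordProd_append, ← List.length_append]
  refine len_wordProd_le fun i hi => ?_
  rcases List.mem_append.1 hi with h | h
  exacts [hl i h, hl' i h]

theorem len_simple_mul_le {J : Set (Fin n)} {i : Fin n} (hi : i ∈ J)
    {w : (Fin n → ℝ) ≃ₗ[ℝ] (Fin n → ℝ)} (hw : w ∈ A.parabolic J) :
    A.len J (A.simpleReflection i * w) ≤ A.len J w + 1 := by
  have := len_mul_le (simpleReflection_mem hi) hw
  have := len_simpleReflection_le (A := A) hi
  lia

theorem len_mono {I J : Set (Fin n)} (h : I ⊆ J) {w : (Fin n → ℝ) ≃ₗ[ℝ] (Fin n → ℝ)}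
    (hw : w ∈ A.parabolic I) : A.len J w ≤ A.len I w := by
  obtain ⟨l, hl, hn, rfl⟩ := exists_reduced_word hw
  rw [← hn]
  exact len_wordProd_le fun i hi => h (hl i hi)

theorem exists_len_simple_mul_lt {J : Set (Fin n)} {w : (Fin n → ℝ) ≃ₗ[ℝ] (Fin n → ℝ)}
    (hw : w ∈ A.parabolic J) (h1 : w ≠ 1) :
    ∃ j ∈ J, A.len J (A.simpleReflection j * w) + 1 ≤ A.len J w := by
  obtain ⟨l, hl, hn, rfl⟩ := exists_reduced_word hw
  cases l with
  | nil => exact absurd (wordProd_nil A) h1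
  | cons j l =>
    refine ⟨j, hl j (by simp), ?_⟩
    rw [← hn, wordProd_cons, simpleReflection_mul_cancel, List.length_cons]
    exact Nat.succ_le_succ (len_wordProd_le fun i hi => hl i (by simp [hi]))

/-- The `i`-th coordinate of `w x` is nonnegative on the dominant cone; equivalently, `w⁻¹` maps
the `i`-th simple coroot to a nonnegative combination of simple coroots. -/
def IsPos (w : (Fin n → ℝ) ≃ₗ[ℝ] (Fin n → ℝ)) (i : Fin n) : Prop :=
  ∀ x : Fin n → ℝ, (∀ j, 0 ≤ x j) → 0 ≤ w x i

/-- The alternating word `i, j, i, …` of a given length. -/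
def altWord (i j : Fin n) : ℕ → List (Fin n)
  | 0 => []
  | k + 1 => i :: altWord j i k

theorem length_altWord (i j : Fin n) (k : ℕ) : (altWord i j k).length = k := by
  induction k generalizing i j with
  | zero => rfl
  | succ k ih => simp [altWord, ih]

theorem mem_altWord {i j x : Fin n} {k : ℕ} (h : x ∈ altWord i j k) :
    x ∈ ({i, j} : Set (Fin n)) := by
  induction k generalizing i j with
  | zero => simp [altWord] at h
  | succ k ih =>
    rcases List.mem_cons.1 h with h | h
    · simp [h]
    · rw [Set.pair_comm]; exact ih h

theorem altWord_add (i j : Fin n) (m k : ℕ) :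
    ∃ l, (∀ x ∈ l, x ∈ ({i, j} : Set (Fin n))) ∧ l.length = k ∧
      altWord i j (m + k) = altWord i j m ++ l := by
  induction m generalizing i j with
  | zero => exact ⟨altWord i j k, fun x => mem_altWord, length_altWord _ _ _, by simp [altWord]⟩
  | succ m ih =>
    obtain ⟨l, h1, h2, h3⟩ := ih j i
    refine ⟨l, fun x hx => ?_, h2, ?_⟩
    · rw [Set.pair_comm]; exact h1 x hx
    · rw [Nat.add_right_comm, altWord, h3, altWord, List.cons_append]

/-- Two equal adjacent letters cancel, since the reflections are involutions; a word in two letters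
without such a pair alternates. -/
theorem eq_altWord_or_shorter (i j : Fin n) (l : List (Fin n))
    (hl : ∀ x ∈ l, x ∈ ({i, j} : Set (Fin n))) :
    (l = altWord i j l.length ∨ l = altWord j i l.length) ∨
      ∃ l' : List (Fin n), l'.length < l.length ∧ (∀ x ∈ l', x ∈ ({i, j} : Set (Fin n))) ∧
        A.wordProd l' = A.wordProd l := by
  induction l with
  | nil => simp [altWord]
  | cons x l ih =>
    have hl' : ∀ y ∈ l, y ∈ ({i, j} : Set (Fin n)) := fun y hy => hl y (by simp [hy])
    rcases ih hl' with h | ⟨l', h1, h2, h3⟩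
    · by_cases hd : ∃ l₁, l = x :: l₁
      · obtain ⟨l₁, rfl⟩ := hd
        exact Or.inr ⟨l₁, by simp, fun y hy => hl' y (by simp [hy]),
          by rw [wordProd_cons, wordProd_cons, simpleReflection_mul_cancel]⟩
      · left
        have hx : x = i ∨ x = j := by simpa using hl x (by simp)
        rcases hk : l.length with _ | k
        · rw [List.length_eq_zero_iff] at hk
          subst hk
          rcases hx with rfl | rfl <;> simp [altWord]
        · rw [hk] at h
          simp only [altWord] at h
          rw [List.length_cons, hk]
          simp only [altWord]
          rcases hx with rfl | rfl <;> rcases h with h | h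
          · exact absurd ⟨_, h⟩ hd
          · left; rw [← h]
          · right; rw [← h]
          · exact absurd ⟨_, h⟩ hd
    · refine Or.inr ⟨x :: l', by simpa using h1, fun y hy => ?_, by simp [wordProd_cons, h3]⟩
      rcases List.mem_cons.1 hy with rfl | hy
      exacts [hl _ (by simp), h2 y hy]

end KacMoody.CartanMat

/-! ### Dihedral subgroups and the positivity theorem. -/

namespace KacMoody.CartanMat

variable {n : ℕ} {A : CartanMat n}

theorem wordProd_altWord_apply_succ (i j : Fin n) (k : ℕ) (x : Fin n → ℝ) :
    A.wordProd (altWord i j (k + 1)) x i = - A.wordProd (altWord j i k) x i := by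
  rw [altWord, wordProd_cons, LinearEquiv.mul_apply, simpleReflection_apply_self]

/-- The outermost reflection `σ_j` changes the `i`-th coordinate by a multiple of the `j`-th, and
the next one, `σ_i`, negates the `i`-th. Positivity in rank two thus becomes a question about this
recurrence. -/
theorem wordProd_altWord_apply_add_two (i j : Fin n) (k : ℕ) (x : Fin n → ℝ) :
    A.wordProd (altWord j i (k + 2)) x i =
      - A.a i j * A.wordProd (altWord i j (k + 1)) x j - A.wordProd (altWord j i k) x i := by
  rw [altWord, wordProd_cons, LinearEquiv.mul_apply, simpleReflection_apply,
    wordProd_altWord_apply_succ]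
  ring

theorem wordProd_altWord_apply_one (i j : Fin n) (x : Fin n → ℝ) :
    A.wordProd (altWord j i 1) x i = x i - A.a i j * x j := by
  simp [altWord, wordProd_cons, wordProd_nil, simpleReflection_apply]

/-- For `c * d ≥ 4` the solutions do not oscillate. Nonnegativity alone is not inductive; the growth
bounds make it so, because they say that the subtracted term is at most half of the term it is
subtracted from. -/
theorem nonneg_of_recurrence {c d : ℝ} (hc : 0 ≤ c) (hd : 0 ≤ d) (hcd : 4 ≤ c * d)
    {p q : ℕ → ℝ} (hp0 : 0 ≤ p 0) (hq0 : 0 ≤ q 0) (hp1 : p 1 = p 0 + c * q 0)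
    (hq1 : q 1 = q 0 + d * p 0) (hp : ∀ k, p (k + 2) = c * q (k + 1) - p k)
    (hq : ∀ k, q (k + 2) = d * p (k + 1) - q k) (k : ℕ) :
    0 ≤ p k ∧ 0 ≤ q k ∧ 2 * p k ≤ c * q (k + 1) ∧ 2 * q k ≤ d * p (k + 1) := by
  induction k with
  | zero =>
    have h1 := mul_nonneg hc hq0
    have h2 := mul_nonneg hd hp0
    refine ⟨hp0, hq0, ?_, ?_⟩
    · rw [Nat.zero_add, hq1]; nlinarith
    · rw [Nat.zero_add, hp1]; nlinarith
  | succ k ih =>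
    obtain ⟨h1, h2, h3, h4⟩ := ih
    have hc0 : 0 < c := by
      rcases hc.eq_or_lt with h | h
      · rw [← h] at hcd; linarith
      · exact h
    have hd0 : 0 < d := by
      rcases hd.eq_or_lt with h | h
      · rw [← h] at hcd; linarith
      · exact h
    have hq1' : 0 ≤ q (k + 1) := by
      by_contra h
      have := mul_neg_of_pos_of_neg hc0 (not_le.1 h)
      linarith
    have hp1' : 0 ≤ p (k + 1) := by
      by_contra h
      have := mul_neg_of_pos_of_neg hd0 (not_le.1 h)
      linarith
    refine ⟨hp1', hq1', ?_, ?_⟩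
    · rw [hq]
      have := mul_le_mul_of_nonneg_left h4 hc
      have := mul_nonneg (sub_nonneg.2 hcd) hp1'
      nlinarith
    · rw [hp]
      have := mul_le_mul_of_nonneg_left h3 hd
      have := mul_nonneg (sub_nonneg.2 hcd) hq1'
      nlinarith

/-- The order of `s i * s j` in terms of `a i j * a j i`. -/
theorem braid_of_mul_eq {i j : Fin n} (hij : i ≠ j) {m : ℕ}
    (h : (A.a i j * A.a j i = 0 ∧ m = 2) ∨ (A.a i j * A.a j i = 1 ∧ m = 3) ∨
      (A.a i j * A.a j i = 2 ∧ m = 4) ∨ (A.a i j * A.a j i = 3 ∧ m = 6)) :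
    A.wordProd (altWord i j m) = A.wordProd (altWord j i m) ∧
    ∀ k < m, ∀ x : Fin n → ℝ, 0 ≤ x i → 0 ≤ x j → 0 ≤ A.wordProd (altWord j i k) x i := by
  have hn := A.nonpos i j hij
  have hn' := A.nonpos j i hij.symm
  -- The sign and zero conditions leave only these six pairs of entries with product at most `3`;
  -- for each of them both claims are explicit linear computations.
  have key : ∀ c d : ℤ, A.a i j = -c → A.a j i = -d →
      ((c = 0 ∧ d = 0 ∧ m = 2) ∨ (c = 1 ∧ d = 1 ∧ m = 3) ∨ (c = 1 ∧ d = 2 ∧ m = 4) ∨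
      (c = 2 ∧ d = 1 ∧ m = 4) ∨ (c = 1 ∧ d = 3 ∧ m = 6) ∨ (c = 3 ∧ d = 1 ∧ m = 6)) →
      A.wordProd (altWord i j m) = A.wordProd (altWord j i m) ∧
      ∀ k < m, ∀ x : Fin n → ℝ, 0 ≤ x i → 0 ≤ x j → 0 ≤ A.wordProd (altWord j i k) x i := by
    intro c d hc hd h
    constructor
    · ext x k
      rcases h with ⟨rfl, rfl, rfl⟩ | ⟨rfl, rfl, rfl⟩ | ⟨rfl, rfl, rfl⟩ | ⟨rfl, rfl, rfl⟩ |
        ⟨rfl, rfl, rfl⟩ | ⟨rfl, rfl, rfl⟩ <;>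
      · simp only [altWord, wordProd_cons, wordProd_nil, LinearEquiv.mul_apply,
          LinearEquiv.coe_one, id, simpleReflection_apply, A.diag, hc, hd]
        push_cast
        ring
    · intro k hk x hi hj
      have e0 : A.wordProd (altWord j i 0) x i = x i := by simp [altWord, wordProd_nil]
      have f0 : A.wordProd (altWord i j 0) x j = x j := by simp [altWord, wordProd_nil]
      have e1 := wordProd_altWord_apply_one (A := A) i j x
      have f1 := wordProd_altWord_apply_one (A := A) j i x
      have e2 := fun k => wordProd_altWord_apply_add_two (A := A) i j k x
      have f2 := fun k => wordProd_altWord_apply_add_two (A := A) j i k x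
      have e2' := e2 0
      have f2' := f2 0
      have e3' := e2 1
      have f3' := f2 1
      have e4' := e2 2
      have f4' := f2 2
      have e5' := e2 3
      simp only [hc, hd, Nat.zero_add, Nat.reduceAdd] at e1 f1 e2' f2' e3' f3' e4' f4' e5'
      rcases h with ⟨rfl, rfl, rfl⟩ | ⟨rfl, rfl, rfl⟩ | ⟨rfl, rfl, rfl⟩ | ⟨rfl, rfl, rfl⟩ |
        ⟨rfl, rfl, rfl⟩ | ⟨rfl, rfl, rfl⟩ <;>
      · push_cast at e1 f1 e2' f2' e3' f3' e4' f4' e5'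
        interval_cases k <;> linarith
  refine key (-A.a i j) (-A.a j i) (by ring) (by ring) ?_
  generalize hc : -A.a i j = c at *
  generalize hd : -A.a j i = d at *
  have hc0 : 0 ≤ c := by lia
  have hd0 : 0 ≤ d := by lia
  have hcd : A.a i j * A.a j i = c * d := by rw [← hc, ← hd]; ring
  have hz : c = 0 → d = 0 := fun h => by
    have := A.zero_symm i j (by lia); lia
  have hz' : d = 0 → c = 0 := fun h => by
    have := A.zero_symm j i (by lia); lia
  rw [hcd] at h
  by_cases h0 : c = 0
  · have := hz h0
    subst h0 this
    simpa using h
  have h0' : d ≠ 0 := fun h => h0 (hz' h)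
  have hc3 : c ≤ 3 := by
    have : c * 1 ≤ c * d := Int.mul_le_mul_of_nonneg_left (by lia) hc0
    lia
  have hd3 : d ≤ 3 := by
    have : 1 * d ≤ c * d := Int.mul_le_mul_of_nonneg_right (by lia) hd0
    lia
  interval_cases c <;> interval_cases d <;> simp_all

/-- Rank two case of the positivity theorem. -/
theorem isPos_mul_of_pair {i j : Fin n} (hij : i ≠ j)
    {v u : (Fin n → ℝ) ≃ₗ[ℝ] (Fin n → ℝ)} (hv : v ∈ A.parabolic {i, j})
    (hi : IsPos u i) (hj : IsPos u j)
    (hlen : A.len {i, j} v ≤ A.len {i, j} (A.simpleReflection i * v)) : IsPos (v * u) i := by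
  obtain ⟨l, hl, hn, rfl⟩ := exists_reduced_word hv
  rcases eq_altWord_or_shorter (A := A) i j l hl with (h | h) | ⟨l', h1, h2, h3⟩
  -- A nonempty reduced word that begins with `i` would be shortened by `σ_i`, so only the empty
  -- word survives here.
  · rcases hk : l.length with _ | k
    · rw [List.length_eq_zero_iff] at hk
      subst hk
      simpa [wordProd_nil] using hi
    · rw [hk, altWord] at h
      rw [← hn, h, wordProd_cons, simpleReflection_mul_cancel] at hlen
      have := len_wordProd_le (A := A) (J := {i, j}) (l := altWord j i k)
        fun x hx => by rw [Set.pair_comm]; exact mem_altWord hx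
      simp only [List.length_cons, length_altWord] at hlen this
      lia
  · intro x hx
    rw [LinearEquiv.mul_apply, h]
    have hnn : 0 ≤ A.a i j * A.a j i :=
      mul_nonneg_of_nonpos_of_nonpos (A.nonpos i j hij) (A.nonpos j i hij.symm)
    by_cases h4 : 4 ≤ A.a i j * A.a j i
    · refine (nonneg_of_recurrence (c := -A.a i j) (d := -A.a j i)
        (p := fun k => A.wordProd (altWord j i k) (u x) i)
        (q := fun k => A.wordProd (altWord i j k) (u x) j) ?_ ?_ ?_ ?_ ?_ ?_ ?_ ?_ ?_ _).1
      · have := A.nonpos i j hij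
        exact_mod_cast neg_nonneg.2 this
      · have := A.nonpos j i hij.symm
        exact_mod_cast neg_nonneg.2 this
      · rw [neg_mul_neg]; exact_mod_cast h4
      · simpa [altWord, wordProd_nil] using hi x hx
      · simpa [altWord, wordProd_nil] using hj x hx
      · simp only [wordProd_altWord_apply_one]; simp [altWord, wordProd_nil]; ring
      · simp only [wordProd_altWord_apply_one]; simp [altWord, wordProd_nil]; ring
      · intro k; exact wordProd_altWord_apply_add_two i j k _
      · intro k; exact wordProd_altWord_apply_add_two j i k _
    · obtain ⟨m, hm⟩ : ∃ m, (A.a i j * A.a j i = 0 ∧ m = 2) ∨ (A.a i j * A.a j i = 1 ∧ m = 3) ∨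
          (A.a i j * A.a j i = 2 ∧ m = 4) ∨ (A.a i j * A.a j i = 3 ∧ m = 6) := by
        generalize A.a i j * A.a j i = c at *
        interval_cases c <;> simp
      have hm0 : m ≠ 0 := by rcases hm with h | h | h | h <;> lia
      obtain ⟨hb, hp⟩ := braid_of_mul_eq hij hm
      refine hp _ ?_ _ (hi x hx) (hj x hx)
      -- A word of length at least `m` begins with a full side of the braid relation. Rewritten with
      -- the other side, it begins with `i` and would be shortened by `σ_i`.
      by_contra hlt
      obtain ⟨k, hk⟩ := Nat.exists_eq_add_of_le (not_lt.1 hlt)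
      obtain ⟨l₁, g1, g2, g3⟩ := altWord_add j i m k
      have hl1 : A.simpleReflection i * A.wordProd l =
          A.wordProd (altWord j i (m - 1) ++ l₁) := by
        obtain ⟨m, rfl⟩ := Nat.exists_eq_succ_of_ne_zero hm0
        rw [h, hk, g3, wordProd_append, ← hb, altWord, wordProd_cons, mul_assoc,
          simpleReflection_mul_cancel, wordProd_append]
        simp
      rw [hl1, ← hn, hk] at hlen
      have := len_wordProd_le (A := A) (J := {i, j}) (l := altWord j i (m - 1) ++ l₁) (by
        intro x hx
        rcases List.mem_append.1 hx with h | h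
        · rw [Set.pair_comm]; exact mem_altWord h
        · rw [Set.pair_comm]; exact g1 x h)
      rw [List.length_append, length_altWord, g2] at this
      lia
  · exfalso
    have := len_wordProd_le (A := A) h2
    rw [h3] at this
    lia

/-- An element that is not shortened by `s i` on the left is positive at `i`. -/
theorem isPos_of_len_le {J : Set (Fin n)} (N : ℕ) {w : (Fin n → ℝ) ≃ₗ[ℝ] (Fin n → ℝ)}
    (hw : w ∈ A.parabolic J) (hN : A.len J w = N) {i : Fin n} (hi : i ∈ J)
    (hlen : A.len J w ≤ A.len J (A.simpleReflection i * w)) : IsPos w i := by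
  induction N using Nat.strong_induction_on generalizing w i with
  | _ N ih =>
    by_cases h1 : w = 1
    · subst h1
      intro x hx
      simpa using hx i
    obtain ⟨j, hj, hlt⟩ := exists_len_simple_mul_lt hw h1
    have hij : i ≠ j := by rintro rfl; lia
    have hI : ({i, j} : Set (Fin n)) ⊆ J := by
      intro x hx
      rcases hx with rfl | rfl <;> assumption
    -- The lengths of the possible right factors `v` of `w`, the left factor being dihedral and no
    -- length being lost. A `v` of minimal length is the shortest representative of the coset of
    -- `w`. Since `σ_j w` is a candidate, this `v` is shorter than `w`, so induction applies to it.
    let S : Set ℕ := {k | ∃ v ∈ A.parabolic J, w * v⁻¹ ∈ A.parabolic {i, j} ∧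
      A.len J v + A.len {i, j} (w * v⁻¹) ≤ A.len J w ∧ A.len J v = k}
    have hmem : A.len J (A.simpleReflection j * w) ∈ S := by
      have e : w * (A.simpleReflection j * w)⁻¹ = A.simpleReflection j := by
        rw [mul_inv_rev, mul_inv_cancel_left, simpleReflection_inv]
      refine ⟨_, mul_mem (simpleReflection_mem hj) hw, ?_, ?_, rfl⟩
      · rw [e]; exact simpleReflection_mem (by simp)
      · rw [e]
        have := len_simpleReflection_le (A := A) (J := {i, j}) (i := j) (by simp)
        lia
    have hS : sInf S ∈ S := Nat.sInf_mem ⟨_, hmem⟩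
    have hle : sInf S ≤ _ := Nat.sInf_le hmem
    obtain ⟨v, hv, hx, hsum, hk⟩ := hS
    -- If `σ_t` shortened `v`, moving it to the dihedral factor would give a shorter candidate.
    have step : ∀ t ∈ ({i, j} : Set (Fin n)), IsPos v t := by
      intro t ht
      refine ih (A.len J v) (by lia) hv rfl (hI ht) ?_
      by_contra hcon
      have e : w * (A.simpleReflection t * v)⁻¹ = w * v⁻¹ * A.simpleReflection t := by
        rw [mul_inv_rev, simpleReflection_inv, mul_assoc]
      have h2 : A.len J (A.simpleReflection t * v) ∈ S := by
        refine ⟨_, mul_mem (simpleReflection_mem (hI ht)) hv, ?_, ?_, rfl⟩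
        · rw [e]; exact mul_mem hx (simpleReflection_mem ht)
        · rw [e]
          have := len_mul_le hx (simpleReflection_mem ht)
          have := len_simpleReflection_le (A := A) ht
          lia
      have := Nat.sInf_le h2
      lia
    -- If `σ_i` shortened the dihedral factor, the sum of lengths would bound the length of `σ_i w`
    -- strictly below that of `w`.
    have hpos := isPos_mul_of_pair hij hx (step i (by simp)) (step j (by simp)) (by
      by_contra hcon
      have e : A.simpleReflection i * w = A.simpleReflection i * (w * v⁻¹) * v := by
        simp [mul_assoc]
      have hm := mul_mem (simpleReflection_mem (A := A) (J := {i, j}) (i := i) (by simp)) hx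
      have h3 := len_mul_le (parabolic_mono hI hm) hv
      have h4 := len_mono hI hm
      rw [e] at hlen
      lia)
    simpa using hpos

end KacMoody.CartanMat

/-! ### Descents, coset representatives and additivity of lengths. -/

namespace KacMoody.CartanMat

variable {n : ℕ} {A : CartanMat n}

/-- As `σ_i` negates the `i`-th coordinate, positivity of both elements would make that coordinate
of `w` vanish on the dominant cone, hence on the whole space, which the cone spans; but `w` is
surjective. -/
theorem not_isPos_simple_mul {w : (Fin n → ℝ) ≃ₗ[ℝ] (Fin n → ℝ)} {i : Fin n}
    (h : IsPos w i) : ¬ IsPos (A.simpleReflection i * w) i := by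
  intro h'
  have h0 : ∀ x : Fin n → ℝ, (∀ j, 0 ≤ x j) → w x i = 0 := fun x hx => by
    have h1 := h x hx
    have h2 := h' x hx
    rw [LinearEquiv.mul_apply, simpleReflection_apply_self] at h2
    linarith
  obtain ⟨x, hx⟩ := w.surjective (Pi.single i 1)
  have hsplit : x = (fun j => max (x j) 0) - fun j => max (-x j) 0 := by
    ext j
    simp only [Pi.sub_apply]
    rcases le_total (x j) 0 with h | h
    · rw [max_eq_right h, max_eq_left (by linarith)]; ring
    · rw [max_eq_left h, max_eq_right (by linarith)]; ring
  have h3 : w x i = 0 := by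
    rw [hsplit, map_sub, Pi.sub_apply, h0 _ fun j => le_max_right _ _,
      h0 _ fun j => le_max_right _ _, sub_zero]
  rw [hx] at h3
  simp at h3

theorem isPos_or {J : Set (Fin n)} {w : (Fin n → ℝ) ≃ₗ[ℝ] (Fin n → ℝ)}
    (hw : w ∈ A.parabolic J) {i : Fin n} (hi : i ∈ J) :
    IsPos w i ∨ IsPos (A.simpleReflection i * w) i := by
  rcases le_total (A.len J w) (A.len J (A.simpleReflection i * w)) with h | h
  · exact Or.inl (isPos_of_len_le _ hw rfl hi h)
  · refine Or.inr (isPos_of_len_le _ (mul_mem (simpleReflection_mem hi) hw) rfl hi ?_)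
    rwa [simpleReflection_mul_cancel]

/-- If the length did not grow, `σ_i` would not shorten `σ_i w`, so `σ_i w` would be positive at `i`
together with `w`. -/
theorem len_simple_mul {J : Set (Fin n)} {w : (Fin n → ℝ) ≃ₗ[ℝ] (Fin n → ℝ)}
    (hw : w ∈ A.parabolic J) {i : Fin n} (hi : i ∈ J) (h : IsPos w i) :
    A.len J (A.simpleReflection i * w) = A.len J w + 1 := by
  have h1 := len_simple_mul_le hi hw
  by_contra hne
  refine not_isPos_simple_mul (A := A) h
    (isPos_of_len_le _ (mul_mem (simpleReflection_mem hi) hw) rfl hi ?_)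
  rw [simpleReflection_mul_cancel]
  lia

/-- Building an element from the right end of a reduced word meets only lengthening steps, so
positivity of the current element at the new letter is available in the induction. -/
theorem parabolic_induction {J : Set (Fin n)}
    {p : ((Fin n → ℝ) ≃ₗ[ℝ] (Fin n → ℝ)) → Prop} (one : p 1)
    (mul : ∀ w ∈ A.parabolic J, ∀ i ∈ J, IsPos w i → p w → p (A.simpleReflection i * w))
    {w : (Fin n → ℝ) ≃ₗ[ℝ] (Fin n → ℝ)} (hw : w ∈ A.parabolic J) : p w := by
  induction hN : A.len J w using Nat.strong_induction_on generalizing w with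
  | _ N ih =>
    by_cases h1 : w = 1
    · rwa [h1]
    obtain ⟨j, hj, hlt⟩ := exists_len_simple_mul_lt hw h1
    have hw' := mul_mem (simpleReflection_mem (A := A) hj) hw
    have hp : IsPos (A.simpleReflection j * w) j := by
      refine isPos_of_len_le _ hw' rfl hj ?_
      rw [simpleReflection_mul_cancel]; lia
    have := mul _ hw' j hj hp (ih _ (by lia) hw' rfl)
    rwa [simpleReflection_mul_cancel] at this

theorem eq_one_of_isPos {J : Set (Fin n)} {w : (Fin n → ℝ) ≃ₗ[ℝ] (Fin n → ℝ)}
    (hw : w ∈ A.parabolic J) (h : ∀ i ∈ J, IsPos w i) : w = 1 := by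
  by_contra h1
  obtain ⟨j, hj, hlt⟩ := exists_len_simple_mul_lt hw h1
  have := len_simple_mul hw hj (h j hj)
  lia

/-- A reflection `σ_i` modifies a vector by its `i`-th coordinate only, so for `i ∈ J` the
coordinates outside `J` never influence those in `J`. This allows dominance on `J` alone to replace
full dominance for elements of `W_J`. -/
theorem apply_eq_of_eqOn {J : Set (Fin n)} {w : (Fin n → ℝ) ≃ₗ[ℝ] (Fin n → ℝ)}
    (hw : w ∈ A.parabolic J) {x y : Fin n → ℝ} (h : ∀ k ∈ J, x k = y k) :
    ∀ k ∈ J, w x k = w y k := by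
  refine parabolic_induction (p := fun w => ∀ k ∈ J, w x k = w y k) (by simpa using h) ?_ hw
  · intro w hw i hi hp ih k hk
    rw [LinearEquiv.mul_apply, LinearEquiv.mul_apply, simpleReflection_apply,
      simpleReflection_apply, ih k hk, ih i hi]

theorem IsPos.apply_nonneg {J : Set (Fin n)} {w : (Fin n → ℝ) ≃ₗ[ℝ] (Fin n → ℝ)}
    {i : Fin n} (h : IsPos w i) (hw : w ∈ A.parabolic J) (hi : i ∈ J) {x : Fin n → ℝ}
    (hx : ∀ k ∈ J, 0 ≤ x k) : 0 ≤ w x i := by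
  classical
  rw [apply_eq_of_eqOn hw (y := fun k => if k ∈ J then x k else 0) (by simp +contextual) i hi]
  exact h _ fun k => by split_ifs with hk; exacts [hx k hk, le_rfl]

theorem IsPos.mul {J : Set (Fin n)} {v u : (Fin n → ℝ) ≃ₗ[ℝ] (Fin n → ℝ)} {i : Fin n}
    (h : IsPos v i) (hv : v ∈ A.parabolic J) (hi : i ∈ J) (hu : ∀ k ∈ J, IsPos u k) :
    IsPos (v * u) i :=
  fun x hx => h.apply_nonneg hv hi fun k hk => hu k hk x hx

/-- Lengths add up in `v * u` if `v ∈ W_J` and `u` is shortest in its coset `W_J u`. -/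
theorem len_mul_of_isPos {J : Set (Fin n)} {v u : (Fin n → ℝ) ≃ₗ[ℝ] (Fin n → ℝ)}
    (hv : v ∈ A.parabolic J) (hu' : u ∈ A.parabolic Set.univ) (hu : ∀ k ∈ J, IsPos u k) :
    A.len Set.univ (v * u) = A.len Set.univ v + A.len Set.univ u := by
  refine parabolic_induction (p := fun v =>
    A.len Set.univ (v * u) = A.len Set.univ v + A.len Set.univ u) ?_ ?_ hv
  · rw [one_mul, len_one, zero_add]
  · intro v hv i hi hp ih
    have hv' := parabolic_mono (Set.subset_univ J) hv
    rw [mul_assoc, len_simple_mul (mul_mem hv' hu') (Set.mem_univ i) (hp.mul hv hi hu), ih,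
      len_simple_mul hv' (Set.mem_univ i) hp]
    ring

/-- Letters of `K` are stripped from the left as long as they shorten the element; what remains is
positive on `K`. -/
theorem exists_mul_eq {J K : Set (Fin n)} (hKJ : K ⊆ J)
    {w : (Fin n → ℝ) ≃ₗ[ℝ] (Fin n → ℝ)} (hw : w ∈ A.parabolic J) :
    ∃ v ∈ A.parabolic K, ∃ u ∈ A.parabolic J, (∀ k ∈ K, IsPos u k) ∧ v * u = w := by
  induction hN : A.len J w using Nat.strong_induction_on generalizing w with
  | _ N ih =>
    by_cases h1 : ∀ k ∈ K, IsPos w k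
    · exact ⟨1, one_mem _, w, hw, h1, one_mul w⟩
    push Not at h1
    obtain ⟨k, hk, hk'⟩ := h1
    have hw' := mul_mem (simpleReflection_mem (A := A) (hKJ hk)) hw
    have h2 := len_simple_mul hw' (hKJ hk) ((isPos_or hw (hKJ hk)).resolve_left hk')
    rw [simpleReflection_mul_cancel] at h2
    obtain ⟨v, hv, u, hu, hu', h⟩ := ih _ (by lia) hw' rfl
    refine ⟨A.simpleReflection k * v, mul_mem (simpleReflection_mem hk) hv, u, hu, hu', ?_⟩
    rw [mul_assoc, h, simpleReflection_mul_cancel]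

theorem mul_left_unique {K : Set (Fin n)} {v v' u u' : (Fin n → ℝ) ≃ₗ[ℝ] (Fin n → ℝ)}
    (hv : v ∈ A.parabolic K) (hv' : v' ∈ A.parabolic K) (hu : ∀ k ∈ K, IsPos u k)
    (hu' : ∀ k ∈ K, IsPos u' k) (h : v * u = v' * u') : v = v' ∧ u = u' := by
  have hm := mul_mem (inv_mem hv) hv'
  have hx : u = v⁻¹ * v' * u' := by rw [mul_assoc, ← h, inv_mul_cancel_left]
  -- At an index of `K` where this element is not positive, its product with the reflection is, and
  -- multiplying by `u'` would make both `u` and its reflection positive there.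
  have h1 : v⁻¹ * v' = 1 := by
    refine eq_one_of_isPos hm fun k hk => ?_
    by_contra hn
    have h2 := ((isPos_or hm hk).resolve_left hn).mul (mul_mem (simpleReflection_mem hk) hm) hk hu'
    rw [mul_assoc, ← hx] at h2
    exact not_isPos_simple_mul (hu k hk) h2
  refine ⟨(inv_mul_eq_one.1 h1), ?_⟩
  rw [hx, h1, one_mul]

end KacMoody.CartanMat

/-! ### Length series, the alternating sum formula and longest elements. -/

namespace KacMoody.CartanMat

open PowerSeries

variable {n : ℕ} (A : CartanMat n)

theorem finite_sphere (T : Set ((Fin n → ℝ) ≃ₗ[ℝ] (Fin n → ℝ))) (m : ℕ) :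
    {w | w ∈ T ∧ w ∈ A.parabolic Set.univ ∧ 2 * A.len Set.univ w = m}.Finite := by
  refine ((List.finite_length_le (Fin n) m).image A.wordProd).subset ?_
  rintro w ⟨-, hw, hm⟩
  obtain ⟨l, -, hl, rfl⟩ := exists_reduced_word hw
  exact ⟨l, by simp only [Set.mem_ofPred_eq]; lia, rfl⟩

/-- The elements of `W ∩ T` of length `m / 2`. -/
noncomputable def sphere (T : Set ((Fin n → ℝ) ≃ₗ[ℝ] (Fin n → ℝ))) (m : ℕ) :
    Finset ((Fin n → ℝ) ≃ₗ[ℝ] (Fin n → ℝ)) :=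
  (A.finite_sphere T m).toFinset

theorem mem_sphere {T : Set ((Fin n → ℝ) ≃ₗ[ℝ] (Fin n → ℝ))} {m : ℕ}
    {w : (Fin n → ℝ) ≃ₗ[ℝ] (Fin n → ℝ)} :
    w ∈ A.sphere T m ↔ w ∈ T ∧ w ∈ A.parabolic Set.univ ∧ 2 * A.len Set.univ w = m := by
  rw [sphere, Set.Finite.mem_toFinset]; rfl

/-- The series `∑ q ^ (2 * len w)` over all `w ∈ W ∩ T`. -/
noncomputable def series (T : Set ((Fin n → ℝ) ≃ₗ[ℝ] (Fin n → ℝ))) : ℤ⟦X⟧ :=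
  PowerSeries.mk fun m => ((A.sphere T m).card : ℤ)

theorem poincareSeries_eq : A.poincareSeries = A.series (A.parabolic Set.univ) := by
  ext m
  rw [poincareSeries, series, coeff_mk, coeff_mk, ← Fintype.card_coe,
    ← Nat.card_eq_fintype_card]
  congr 1
  have hlen : ∀ w : A.weylGroup, A.length w = A.len Set.univ w := fun w => by
    simp [length, len, wordProd]
  refine Nat.card_congr
    { toFun := fun w => ⟨w.1, (A.mem_sphere).2 ⟨?_, ?_, ?_⟩⟩
      invFun := fun w => ⟨⟨w.1, ?_⟩, ?_⟩
      left_inv := fun w => rfl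
      right_inv := fun w => rfl }
  · exact A.weylGroup_eq.le w.1.2
  · exact A.weylGroup_eq.le w.1.2
  · rw [← hlen]; exact w.2
  · have := ((A.mem_sphere).1 w.2).1; rw [weylGroup_eq]; exact this
  · rw [hlen]; exact ((A.mem_sphere).1 w.2).2.2

theorem series_mul {T₁ T₂ T : Set ((Fin n → ℝ) ≃ₗ[ℝ] (Fin n → ℝ))}
    (h₁ : T₁ ⊆ A.parabolic Set.univ) (h₂ : T₂ ⊆ A.parabolic Set.univ)
    (hlen : ∀ v ∈ T₁, ∀ u ∈ T₂,
      A.len Set.univ (v * u) = A.len Set.univ v + A.len Set.univ u)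
    (hmul : ∀ v ∈ T₁, ∀ u ∈ T₂, v * u ∈ T)
    (hinj : ∀ v ∈ T₁, ∀ u ∈ T₂, ∀ v' ∈ T₁, ∀ u' ∈ T₂, v * u = v' * u' → v = v' ∧ u = u')
    (hsurj : ∀ w ∈ T, ∃ v ∈ T₁, ∃ u ∈ T₂, v * u = w) :
    A.series T₁ * A.series T₂ = A.series T := by
  ext m
  rw [coeff_mul]
  simp only [series, coeff_mk]
  have : (A.sphere T m).card = ((Finset.HasAntidiagonal.antidiagonal m).sigma fun p =>
      A.sphere T₁ p.1 ×ˢ A.sphere T₂ p.2).card := by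
    symm
    refine Finset.card_bij (fun x _ => x.2.1 * x.2.2) ?_ ?_ ?_
    · rintro ⟨⟨a, b⟩, v, u⟩ hx
      simp only [Finset.mem_sigma, Finset.HasAntidiagonal.mem_antidiagonal, Finset.mem_product, mem_sphere] at hx ⊢
      obtain ⟨hab, ⟨hv, hv', ha⟩, hu, hu', hb⟩ := hx
      refine ⟨hmul v hv u hu, mul_mem hv' hu', ?_⟩
      rw [hlen v hv u hu]; lia
    · rintro ⟨⟨a, b⟩, v, u⟩ hx ⟨⟨a', b'⟩, v', u'⟩ hx' h
      simp only [Finset.mem_sigma, Finset.HasAntidiagonal.mem_antidiagonal, Finset.mem_product,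
        mem_sphere] at hx hx' h
      obtain ⟨hab, ⟨hv, hv', ha⟩, hu, hu', hb⟩ := hx
      obtain ⟨hab', ⟨kv, kv', ka⟩, ku, ku', kb⟩ := hx'
      obtain ⟨rfl, rfl⟩ := hinj v hv u hu v' kv u' ku h
      subst ha hb ka kb
      rfl
    · intro w hw
      obtain ⟨hw, -, hm⟩ := (A.mem_sphere).1 hw
      obtain ⟨v, hv, u, hu, rfl⟩ := hsurj w hw
      rw [hlen v hv u hu] at hm
      refine ⟨⟨(2 * A.len Set.univ v, 2 * A.len Set.univ u), v, u⟩, ?_, rfl⟩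
      simp only [Finset.mem_sigma, Finset.HasAntidiagonal.mem_antidiagonal, Finset.mem_product, mem_sphere]
      exact ⟨by lia, ⟨hv, h₁ hv, trivial⟩, hu, h₂ hu, trivial⟩
  rw [this, Finset.card_sigma]
  push_cast
  simp [Finset.card_product]

/-- The elements of `W_J` that are positive at all indices of `K`. -/
def cosetReps (J K : Finset (Fin n)) : Set ((Fin n → ℝ) ≃ₗ[ℝ] (Fin n → ℝ)) :=
  {w | w ∈ A.parabolic J ∧ ∀ k ∈ K, IsPos w k}

/-- The elements of `W_J` that are shortened by all simple reflections with index in `J`. -/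
def longest (J : Finset (Fin n)) : Set ((Fin n → ℝ) ≃ₗ[ℝ] (Fin n → ℝ)) :=
  {w | w ∈ A.parabolic J ∧ ∀ k ∈ J, ¬ IsPos w k}

/-- This is the unique factorization through shortest coset representatives. All lengths are those
of the whole group, so an agreement with the intrinsic length of a parabolic subgroup is never
required. -/
theorem series_parabolic_mul {J K : Finset (Fin n)} (h : K ⊆ J) :
    A.series (A.parabolic K) * A.series (A.cosetReps J K) = A.series (A.parabolic J) := by
  have hJ : A.parabolic J ≤ A.parabolic Set.univ := parabolic_mono (Set.subset_univ _)
  have hKJ : A.parabolic K ≤ A.parabolic J := parabolic_mono (Finset.coe_subset.2 h)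
  refine A.series_mul (hKJ.trans hJ) (fun w hw => hJ hw.1) ?_ ?_ ?_ ?_
  · exact fun v hv u hu => len_mul_of_isPos hv (hJ hu.1) hu.2
  · exact fun v hv u hu => mul_mem (hKJ hv) hu.1
  · exact fun v hv u hu v' hv' u' hu' h => mul_left_unique hv hv' hu.2 hu'.2 h
  · intro w hw
    obtain ⟨v, hv, u, hu, hu', h⟩ := exists_mul_eq (Finset.coe_subset.2 h) hw
    exact ⟨v, hv, u, ⟨hu, hu'⟩, h⟩

/-- An element `w` of `W_J` contributes to the sets `K` of indices at which it is positive. Its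
signs sum to zero unless it is positive at no index of `J`. -/
theorem sum_series_cosetReps (J : Finset (Fin n)) :
    ∑ K ∈ J.powerset, (-1) ^ K.card * A.series (A.cosetReps J K) = A.series (A.longest J) := by
  classical
  ext m
  have hcoeff : ∀ K : Finset (Fin n), coeff m ((-1) ^ K.card * A.series (A.cosetReps J K)) =
      ∑ w ∈ A.sphere (A.parabolic J) m, if ∀ k ∈ K, IsPos w k then (-1 : ℤ) ^ K.card else 0 := by
    intro K
    have h1 : ((-1) ^ K.card * A.series (A.cosetReps J K) : ℤ⟦X⟧) =
        C ((-1 : ℤ) ^ K.card) * A.series (A.cosetReps J K) := by simp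
    have h2 : A.sphere (A.cosetReps J K) m =
        (A.sphere (A.parabolic J) m).filter fun w => ∀ k ∈ K, IsPos w k := by
      ext w
      simp only [mem_sphere, Finset.mem_filter, cosetReps, Set.mem_ofPred_eq, SetLike.mem_coe]
      tauto
    rw [h1, coeff_C_mul, series, coeff_mk, h2, ← Finset.sum_filter, Finset.sum_const,
      nsmul_eq_mul, mul_comm]
  rw [map_sum, Finset.sum_congr rfl fun K _ => hcoeff K, Finset.sum_comm]
  have hw : ∀ w : (Fin n → ℝ) ≃ₗ[ℝ] (Fin n → ℝ), (∑ K ∈ J.powerset,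
      if ∀ k ∈ K, IsPos w k then (-1 : ℤ) ^ K.card else 0) =
      if ∀ k ∈ J, ¬ IsPos w k then 1 else 0 := by
    intro w
    rw [← Finset.sum_filter]
    have h3 : J.powerset.filter (fun K => ∀ k ∈ K, IsPos w k) =
        (J.filter fun k => IsPos w k).powerset := by
      ext K
      simp only [Finset.mem_filter, Finset.mem_powerset, Finset.subset_iff]
      exact ⟨fun h k hk => ⟨h.1 hk, h.2 k hk⟩, fun h => ⟨fun k hk => (h hk).1, fun k hk => (h hk).2⟩⟩
    rw [h3, Finset.sum_powerset_neg_one_pow_card]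
    simp [Finset.filter_eq_empty_iff]
  have h4 : A.sphere (A.longest J) m =
      (A.sphere (A.parabolic J) m).filter fun w => ∀ k ∈ J, ¬ IsPos w k := by
    ext w
    simp only [mem_sphere, Finset.mem_filter, longest, Set.mem_ofPred_eq, SetLike.mem_coe]
    tauto
  rw [Finset.sum_congr rfl fun w _ => hw w, series, coeff_mk, h4, ← Finset.sum_filter]
  simp

theorem constantCoeff_series_parabolic (J : Finset (Fin n)) :
    constantCoeff (A.series (A.parabolic J)) = 1 := by
  have : A.sphere (A.parabolic J) 0 = {1} := by
    ext w
    simp only [mem_sphere, Finset.mem_singleton]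
    constructor
    · rintro ⟨-, hw, h0⟩
      obtain ⟨l, -, hl, rfl⟩ := exists_reduced_word hw
      rw [List.length_eq_zero_iff.1 (show l.length = 0 by lia), wordProd_nil]
    · rintro rfl
      exact ⟨one_mem _, one_mem _, by rw [len_one]⟩
  rw [← coeff_zero_eq_constantCoeff_apply, series, coeff_mk, this]
  simp

/-- The inverse of the Poincaré series of `W_J`. -/
noncomputable def invSeries (J : Finset (Fin n)) : ℤ⟦X⟧ :=
  invOfUnit (A.series (A.parabolic J)) 1

theorem series_mul_invSeries (J : Finset (Fin n)) :
    A.series (A.parabolic J) * A.invSeries J = 1 :=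
  mul_invOfUnit _ 1 (by rw [constantCoeff_series_parabolic]; rfl)

/-- By the factorization, the series of the coset representatives is the quotient `W_J(t) / W_K(t)`;
dividing the inclusion-exclusion identity by `W_J(t)` gives the recursion for the inverse series. -/
theorem sum_invSeries (J : Finset (Fin n)) :
    ∑ K ∈ J.powerset, (-1) ^ K.card * A.invSeries K =
      A.invSeries J * A.series (A.longest J) := by
  rw [← sum_series_cosetReps, Finset.mul_sum]
  refine Finset.sum_congr rfl fun K hK => ?_
  have h1 := A.series_parabolic_mul (Finset.mem_powerset.1 hK)
  have h2 := A.series_mul_invSeries K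
  have h3 := A.series_mul_invSeries J
  calc (-1) ^ K.card * A.invSeries K
      = (-1) ^ K.card * A.invSeries K * (A.series (A.parabolic J) * A.invSeries J) := by
        rw [h3, mul_one]
    _ = (-1) ^ K.card * (A.series (A.parabolic K) * A.invSeries K) *
          A.series (A.cosetReps J K) * A.invSeries J := by rw [← h1]; ring
    _ = _ := by rw [h2]; ring

variable {A}

/-- The form `∑ c k * x k` is a combination of coroots of `J` that is nonpositive on the simple
roots of `J`. On a dominant vector it can only grow when elements of `W_J` are built by lengthening
steps. At `(1, …, 1)` it is positive, while a longest element would make all coordinates in `J`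
nonpositive. -/
theorem series_longest_eq_zero {J : Finset (Fin n)} (c : Fin n → ℝ) (hc : ∀ i, 0 ≤ c i)
    (hJ : ∀ i ∉ J, c i = 0) (hne : ∃ i, c i ≠ 0)
    (h : ∀ i ∈ J, ∑ k, c k * A.a k i ≤ 0) : A.series (A.longest J) = 0 := by
  have hemp : A.longest J = ∅ := by
    rw [Set.eq_empty_iff_forall_notMem]
    rintro w ⟨hw, hneg⟩
    have hmono : ∀ x : Fin n → ℝ, (∀ j, 0 ≤ x j) → ∑ k, c k * x k ≤ ∑ k, c k * w x k := by
      intro x hx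
      refine parabolic_induction (p := fun w => ∑ k, c k * x k ≤ ∑ k, c k * w x k) le_rfl ?_ hw
      intro w hw i hi hp ih
      refine ih.trans ?_
      have : ∑ k, c k * (A.simpleReflection i * w) x k =
          ∑ k, c k * w x k - (∑ k, c k * A.a k i) * w x i := by
        rw [Finset.sum_mul, ← Finset.sum_sub_distrib]
        refine Finset.sum_congr rfl fun k _ => ?_
        rw [LinearEquiv.mul_apply, simpleReflection_apply]; ring
      rw [this]
      have := mul_nonneg (neg_nonneg.2 (h i hi)) (hp x hx)
      linarith
    have h1 := hmono 1 fun j => zero_le_one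
    obtain ⟨i, hi⟩ := hne
    have h2 : 0 < ∑ k, c k * (1 : Fin n → ℝ) k :=
      Finset.sum_pos' (fun k _ => by simpa using hc k)
        ⟨i, Finset.mem_univ i, by simpa using (hc i).lt_of_ne' hi⟩
    have h3 : ∑ k, c k * w 1 k ≤ 0 := by
      refine Finset.sum_nonpos fun k _ => ?_
      by_cases hk : k ∈ J
      · have h4 := (isPos_or hw hk).resolve_left (hneg k hk) 1 fun j => zero_le_one
        rw [LinearEquiv.mul_apply, simpleReflection_apply_self] at h4
        exact mul_nonpos_of_nonneg_of_nonpos (hc k) (by linarith)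
      · rw [hJ k hk, zero_mul]
    linarith
  ext m
  have : A.sphere (A.longest J) m = ∅ := by
    ext w
    simp [mem_sphere, hemp]
  simp [series, this]

/-- On the coordinates in `J`, both `w` and `w₀⁻¹` turn nonnegative vectors into nonpositive ones,
so `w * w₀⁻¹` is positive on all of `J` and hence trivial. -/
theorem longest_unique {J : Finset (Fin n)} {w w₀ : (Fin n → ℝ) ≃ₗ[ℝ] (Fin n → ℝ)}
    (hw : w ∈ A.longest J) (h₀ : w₀ ∈ A.longest J) : w = w₀ := by
  have hneg : ∀ i ∈ J, ¬ IsPos w₀⁻¹ i := by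
    intro i hi hp
    have h1 : ∀ k ∈ (J : Set (Fin n)), IsPos (A.simpleReflection k * w₀) k :=
      fun k hk => (isPos_or h₀.1 hk).resolve_left (h₀.2 k hk)
    -- The vector `-w₀ 1` is nonnegative on `J`, and `w₀⁻¹` takes it to `(-1, …, -1)`, against
    -- positivity at `i`.
    have h2 := hp.apply_nonneg (inv_mem h₀.1) hi (x := -w₀ 1) fun k hk => by
      have := h1 k hk 1 fun j => zero_le_one
      rwa [LinearEquiv.mul_apply, simpleReflection_apply_self] at this
    rw [map_neg, ← LinearEquiv.mul_apply, inv_mul_cancel] at h2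
    simp only [LinearEquiv.coe_one, id, Pi.neg_apply, Pi.one_apply] at h2
    linarith
  have hm := mul_mem hw.1 (inv_mem h₀.1)
  rw [← mul_inv_eq_one]
  refine eq_one_of_isPos hm fun i hi x hx => ?_
  have h1 : ∀ k ∈ (J : Set (Fin n)), 0 ≤ (-(w₀⁻¹ x)) k := fun k hk => by
    have := (isPos_or (inv_mem h₀.1) hk).resolve_left (hneg k hk) x hx
    rwa [LinearEquiv.mul_apply, simpleReflection_apply_self] at this
  have h2 := ((isPos_or hw.1 hi).resolve_left (hw.2 i hi)).apply_nonneg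
    (mul_mem (simpleReflection_mem hi) hw.1) hi h1
  rw [LinearEquiv.mul_apply, simpleReflection_apply_self, map_neg, Pi.neg_apply, neg_neg] at h2
  exact h2

theorem series_longest_eq_pow {J : Finset (Fin n)} {w₀ : (Fin n → ℝ) ≃ₗ[ℝ] (Fin n → ℝ)}
    (h₀ : w₀ ∈ A.longest J) : A.series (A.longest J) = X ^ (2 * A.len Set.univ w₀) := by
  ext m
  rw [coeff_X_pow, series, coeff_mk]
  have hu := parabolic_mono (Set.subset_univ _) h₀.1
  split_ifs with h
  · have : A.sphere (A.longest J) m = {w₀} := by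
      ext w
      simp only [mem_sphere, Finset.mem_singleton]
      exact ⟨fun hw => longest_unique hw.1 h₀, by rintro rfl; exact ⟨h₀, hu, h.symm⟩⟩
    simp [this]
  · have : A.sphere (A.longest J) m = ∅ := by
      ext w
      simp only [mem_sphere, Finset.notMem_empty, iff_false]
      rintro ⟨hw, -, hm⟩
      rw [longest_unique hw h₀] at hm
      exact h hm.symm
    simp [this]

end KacMoody.CartanMat

/-! ### Edge labels, and criteria for the absence or presence of longest elements. -/

namespace KacMoody.CartanMat

open PowerSeries

variable {n : ℕ} {A : CartanMat n}

theorem edgeLabel_comm (i j : Fin n) : A.edgeLabel i j = A.edgeLabel j i := by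
  rw [edgeLabel, edgeLabel, mul_comm]

theorem edgeLabel_le (i j : Fin n) : A.edgeLabel i j ≤ 4 := min_le_right _ _

theorem mul_nonneg_of_ne {i j : Fin n} (hij : i ≠ j) : 0 ≤ A.a i j * A.a j i :=
  mul_nonneg_of_nonpos_of_nonpos (A.nonpos i j hij) (A.nonpos j i hij.symm)

theorem edgeLabel_le_mul {i j : Fin n} (hij : i ≠ j) :
    (A.edgeLabel i j : ℤ) ≤ A.a i j * A.a j i := by
  have := mul_nonneg_of_ne (A := A) hij
  rw [edgeLabel]
  lia

theorem mul_eq_edgeLabel {i j : Fin n} (hij : i ≠ j) (h : A.edgeLabel i j < 4) :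
    A.a i j * A.a j i = A.edgeLabel i j := by
  have := mul_nonneg_of_ne (A := A) hij
  rw [edgeLabel] at h ⊢
  lia

theorem edgeLabel_eq_zero_iff {i j : Fin n} (hij : i ≠ j) :
    A.edgeLabel i j = 0 ↔ A.a i j = 0 := by
  constructor
  · intro h
    have h1 := mul_eq_edgeLabel (A := A) hij (by lia)
    rw [h, Nat.cast_zero, mul_eq_zero] at h1
    exact h1.elim id (A.zero_symm j i)
  · intro h
    simp [edgeLabel, h]

theorem le_neg_one_of_edgeLabel {i j : Fin n} (hij : i ≠ j) (h : A.edgeLabel i j ≠ 0) :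
    A.a i j ≤ -1 := by
  have h1 := A.nonpos i j hij
  have h2 := mt (edgeLabel_eq_zero_iff hij).2 h
  lia

/-- The pairs of entries `(a i j, a j i)` with a given product less than `4`. -/
def entryPairs : ℕ → List (ℤ × ℤ)
  | 0 => [(0, 0)]
  | 1 => [(-1, -1)]
  | 2 => [(-1, -2), (-2, -1)]
  | 3 => [(-1, -3), (-3, -1)]
  | _ => []

/-- Labels below `4` determine the two entries up to order, so the Cartan matrices behind given
finite labels form a finite list, with both orientations of multiple edges. -/
theorem mem_entryPairs {i j : Fin n} (hij : i ≠ j) (h : A.edgeLabel i j < 4) :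
    (A.a i j, A.a j i) ∈ entryPairs (A.edgeLabel i j) := by
  have h1 := mul_eq_edgeLabel hij h
  have h2 := A.nonpos i j hij
  have h3 := A.nonpos j i hij.symm
  by_cases h0 : A.edgeLabel i j = 0
  · have h4 := (edgeLabel_eq_zero_iff hij).1 h0
    rw [h0, h4, A.zero_symm i j h4]
    simp [entryPairs]
  have h4 := le_neg_one_of_edgeLabel hij h0
  have h5 := le_neg_one_of_edgeLabel hij.symm (by rwa [edgeLabel_comm])
  generalize A.edgeLabel i j = r at *
  generalize A.a i j = c at *
  generalize A.a j i = d at *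
  have hc3 : -3 ≤ c := by nlinarith
  have hd3 : -3 ≤ d := by nlinarith
  clear h0
  interval_cases r <;> interval_cases c <;> interval_cases d <;> simp [entryPairs] at h1 ⊢

/-! Parabolic subgroups without a longest element. -/

/-- Dropping off-diagonal terms can only increase the sum, so in the criteria below only the
neighbours that matter have to be kept. -/
theorem sum_col_le {c : Fin n → ℝ} (hc : ∀ i, 0 ≤ c i) {i : Fin n} {S : Finset (Fin n)}
    (hi : i ∈ S) : ∑ k, c k * A.a k i ≤ ∑ k ∈ S, c k * A.a k i := by
  classical
  rw [← Finset.sum_add_sum_compl S]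
  refine add_le_of_nonpos_right (Finset.sum_nonpos fun k hk => ?_)
  refine mul_nonpos_of_nonneg_of_nonpos (hc k) ?_
  have : k ≠ i := by rintro rfl; exact Finset.mem_compl.1 hk hi
  exact_mod_cast A.nonpos k i this

/-- The weights are `2` at `p` and `-a p i` at the other `i` in `J`. The kept terms cancel in the
column of each such `i`, and in the column of `p` they give `4 - ∑ a p i * a i p`, which the labels
bound above by `0`. Edges among the other indices only help. -/
theorem series_longest_star {J : Finset (Fin n)} {p : Fin n} (hp : p ∈ J)
    (h : 4 ≤ ∑ i ∈ J.erase p, A.edgeLabel p i) : A.series (A.longest J) = 0 := by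
  classical
  let c : Fin n → ℝ := fun i => if i = p then 2 else if i ∈ J then -A.a p i else 0
  have hcp : c p = 2 := by simp [c]
  have hc : ∀ i, 0 ≤ c i := by
    intro i
    simp only [c]
    split_ifs with h1 h2
    · norm_num
    · have := A.nonpos p i (Ne.symm h1)
      exact_mod_cast neg_nonneg.2 this
    · exact le_rfl
  refine series_longest_eq_zero c hc ?_ ⟨p, by rw [hcp]; norm_num⟩ ?_
  · intro i hi
    have : i ≠ p := by rintro rfl; exact hi hp
    simp [c, hi, this]
  · intro i hi
    by_cases hip : i = p
    · subst hip
      refine (sum_col_le hc (S := J) hi).trans ?_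
      rw [← Finset.add_sum_erase _ _ hi, hcp, A.diag]
      have h1 : ∑ k ∈ J.erase i, c k * A.a k i ≤ ∑ k ∈ J.erase i, -(A.edgeLabel i k : ℝ) := by
        refine Finset.sum_le_sum fun k hk => ?_
        obtain ⟨hki, hkJ⟩ := Finset.mem_erase.1 hk
        have h2 := edgeLabel_le_mul (A := A) hki.symm
        have h3 : (A.edgeLabel i k : ℝ) ≤ A.a i k * A.a k i := by exact_mod_cast h2
        simp only [c, hki, hkJ, if_true, if_false]
        linarith
      have h4 : (4 : ℝ) ≤ ∑ k ∈ J.erase i, (A.edgeLabel i k : ℝ) := by exact_mod_cast h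
      rw [Finset.sum_neg_distrib] at h1
      push_cast
      linarith
    · refine (sum_col_le hc (S := {i, p}) (by simp)).trans ?_
      rw [Finset.sum_pair hip, hcp, A.diag]
      simp only [c, hip, hi, if_true, if_false]
      push_cast
      linarith

/-- Weight `1` on `T` suffices: the diagonal entry `2` is outweighed by two neighbours in `T`, each
with an entry at most `-1`. -/
theorem series_longest_cycle {J T : Finset (Fin n)} (hT : T ⊆ J) (hne : T.Nonempty)
    (h : ∀ i ∈ T, ∃ j ∈ T, ∃ k ∈ T, i ≠ j ∧ i ≠ k ∧ j ≠ k ∧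
      A.edgeLabel i j ≠ 0 ∧ A.edgeLabel i k ≠ 0) : A.series (A.longest J) = 0 := by
  classical
  let c : Fin n → ℝ := fun i => if i ∈ T then 1 else 0
  have hc : ∀ i, 0 ≤ c i := fun i => by simp only [c]; split_ifs <;> norm_num
  obtain ⟨t, ht⟩ := hne
  refine series_longest_eq_zero c hc (fun i hi => ?_) ⟨t, by simp [c, ht]⟩ ?_
  · simp only [c]
    rw [if_neg fun h => hi (hT h)]
  · intro i _
    by_cases hi : i ∈ T
    · obtain ⟨j, hj, k, hk, hij, hik, hjk, h1, h2⟩ := h i hi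
      refine (sum_col_le hc (S := {i, j, k}) (by simp)).trans ?_
      rw [Finset.sum_insert (by simp [hij, hik]), Finset.sum_pair hjk, A.diag]
      simp only [c, hi, hj, hk, if_true]
      have h3 := le_neg_one_of_edgeLabel hij.symm (by rwa [edgeLabel_comm])
      have h4 := le_neg_one_of_edgeLabel hik.symm (by rwa [edgeLabel_comm])
      have h3' : (A.a j i : ℝ) ≤ -1 := by exact_mod_cast h3
      have h4' : (A.a k i : ℝ) ≤ -1 := by exact_mod_cast h4
      push_cast
      linarith
    · refine (sum_col_le hc (S := {i}) (by simp)).trans ?_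
      simp [c, hi]

/-- The weights `-a j i, 2, 2, -a k l` cancel the kept terms in the columns of both ends; in the two
middle columns the strong outer edge and the inner edge each contribute at most `-2` against `4`. -/
theorem series_longest_path {i j k l : Fin n} (hij : i ≠ j) (hik : i ≠ k) (hil : i ≠ l)
    (hjk : j ≠ k) (hjl : j ≠ l) (hkl : k ≠ l) (h1 : 2 ≤ A.edgeLabel i j)
    (h2 : A.edgeLabel j k ≠ 0) (h3 : 2 ≤ A.edgeLabel k l) :
    A.series (A.longest {i, j, k, l}) = 0 := by
  classical
  let c : Fin n → ℝ := fun x =>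
    if x = i then -A.a j i else if x = j then 2 else if x = k then 2 else
      if x = l then -A.a k l else 0
  have ci : c i = -A.a j i := by simp [c]
  have cj : c j = 2 := by simp [c, hij.symm]
  have ck : c k = 2 := by simp [c, hik.symm]
  have cl : c l = -A.a k l := by simp [c, hil.symm, hjl.symm, hkl.symm]
  have hji : (A.a j i : ℝ) ≤ 0 := by exact_mod_cast A.nonpos j i hij.symm
  have hkl' : (A.a k l : ℝ) ≤ 0 := by exact_mod_cast A.nonpos k l hkl
  have hc : ∀ x, 0 ≤ c x := by
    intro x
    simp only [c]
    split_ifs <;> linarith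
  have e1 : (2 : ℝ) ≤ A.a i j * A.a j i := by
    exact_mod_cast (Nat.cast_le.2 h1).trans (edgeLabel_le_mul hij)
  have e2 : (A.a j k : ℝ) ≤ -1 := by exact_mod_cast le_neg_one_of_edgeLabel hjk h2
  have e2' : (A.a k j : ℝ) ≤ -1 := by
    exact_mod_cast le_neg_one_of_edgeLabel hjk.symm (by rwa [edgeLabel_comm])
  have e3 : (2 : ℝ) ≤ A.a k l * A.a l k := by
    exact_mod_cast (Nat.cast_le.2 h3).trans (edgeLabel_le_mul hkl)
  refine series_longest_eq_zero c hc ?_ ⟨j, by rw [cj]; norm_num⟩ ?_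
  · intro x hx
    simp only [Finset.mem_insert, Finset.mem_singleton, not_or] at hx
    simp [c, hx]
  · intro x hx
    simp only [Finset.mem_insert, Finset.mem_singleton] at hx
    rcases hx with rfl | rfl | rfl | rfl
    · refine (sum_col_le hc (S := {x, j}) (by simp)).trans ?_
      rw [Finset.sum_pair hij, ci, cj, A.diag]
      push_cast; linarith
    · refine (sum_col_le hc (S := {x, i, k}) (by simp)).trans ?_
      rw [Finset.sum_insert (by simp [hij.symm, hjk]), Finset.sum_pair hik, ci, cj, ck, A.diag]
      push_cast; linarith
    · refine (sum_col_le hc (S := {x, j, l}) (by simp)).trans ?_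
      rw [Finset.sum_insert (by simp [hjk.symm, hkl]), Finset.sum_pair hjl, cl, cj, ck, A.diag]
      push_cast; linarith
    · refine (sum_col_le hc (S := {x, k}) (by simp)).trans ?_
      rw [Finset.sum_pair hkl.symm, cl, ck, A.diag]
      push_cast; linarith

/-! Longest elements found by a greedy search. -/

/-- The coordinates of `wordProd l (1, …, 1)`, for the Cartan matrix `B`. -/
def orbitPoint {k : ℕ} (B : Fin k → Fin k → ℤ) : List (Fin k) → Fin k → ℤ
  | [] => fun _ => 1
  | i :: l => fun p => orbitPoint B l p - B p i * orbitPoint B l i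

/-- Extend a word on the left as long as this makes it longer. -/
def greedyWord {k : ℕ} (B : Fin k → Fin k → ℤ) : ℕ → List (Fin k) → List (Fin k)
  | 0, l => l
  | m + 1, l =>
    match (List.finRange k).find? fun i => decide (0 < orbitPoint B l i) with
    | none => l
    | some i => greedyWord B m (i :: l)

/-- The word `l` is a reduced word of a longest element, for the Cartan matrix `B`. -/
def isLongestWord {k : ℕ} (B : Fin k → Fin k → ℤ) (l : List (Fin k)) : Bool :=
  (l.tails.all fun l' => match l' with
    | [] => true
    | i :: l'' => decide (0 < orbitPoint B l'' i)) &&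
  (List.finRange k).all fun i => decide (orbitPoint B l i < 0)

/-- Since `w` or `σ_i w` is positive at `i`, the sign of the coordinate at the single vector `(1, …,
1)` decides which. This makes positivity computable in integers. -/
theorem isPos_of_apply_one_pos {J : Set (Fin n)} {w : (Fin n → ℝ) ≃ₗ[ℝ] (Fin n → ℝ)}
    (hw : w ∈ A.parabolic J) {i : Fin n} (hi : i ∈ J) (h : 0 < w 1 i) : IsPos w i := by
  refine (isPos_or hw hi).resolve_right fun h' => ?_
  have := h' 1 fun _ => zero_le_one
  rw [LinearEquiv.mul_apply, simpleReflection_apply_self] at this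
  linarith

theorem wordProd_map_apply_one {k : ℕ} {B : Fin k → Fin k → ℤ} {e : Fin k → Fin n}
    (hB : ∀ p q, A.a (e p) (e q) = B p q) (l : List (Fin k)) (p : Fin k) :
    A.wordProd (l.map e) 1 (e p) = orbitPoint B l p := by
  induction l generalizing p with
  | nil => simp [wordProd_nil, orbitPoint]
  | cons i l ih =>
    rw [List.map_cons, wordProd_cons, LinearEquiv.mul_apply, simpleReflection_apply, ih, ih, hB,
      orbitPoint]
    push_cast
    ring

/-- The orbit of `(1, …, 1)` certifies the word: a positive coordinate before each letter makes the
length grow by one, and negative coordinates at the end mean that no letter of `J` lengthens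
further. The way the word was found plays no role. -/
theorem series_longest_eq_of_word {k : ℕ} {B : Fin k → Fin k → ℤ} {e : Fin k → Fin n}
    (hB : ∀ p q, A.a (e p) (e q) = B p q) {J : Finset (Fin n)} (hJ : (J : Set _) = Set.range e)
    {l : List (Fin k)} (hl : isLongestWord B l = true) :
    A.series (A.longest J) = X ^ (2 * l.length) := by
  have hmem : ∀ l : List (Fin k), A.wordProd (l.map e) ∈ A.parabolic J := fun l =>
    wordProd_mem fun i hi => by
      obtain ⟨p, -, rfl⟩ := List.mem_map.1 hi
      rw [hJ]; exact ⟨p, rfl⟩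
  have he : ∀ p, e p ∈ (J : Set (Fin n)) := fun p => by rw [hJ]; exact ⟨p, rfl⟩
  simp only [isLongestWord, Bool.and_eq_true, List.all_eq_true, List.mem_tails,
    List.mem_finRange, decide_eq_true_eq, true_implies] at hl
  have hlen : ∀ l' : List (Fin k), l' <:+ l →
      A.len Set.univ (A.wordProd (l'.map e)) = l'.length := by
    intro l'
    induction l' with
    | nil => intro _; simp [wordProd_nil, len_one]
    | cons i l' ih =>
      intro h
      have h1 := hl.1 _ h
      simp only [decide_eq_true_eq] at h1
      rw [List.map_cons, wordProd_cons, len_simple_mul (J := Set.univ)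
        (parabolic_mono (Set.subset_univ _) (hmem l')) (Set.mem_univ _)
        (isPos_of_apply_one_pos (hmem l') (he i) (by
          rw [wordProd_map_apply_one hB]; exact_mod_cast h1)),
        ih ((List.suffix_cons i l').trans h), List.length_cons]
  rw [← hlen l List.suffix_rfl]
  refine series_longest_eq_pow ⟨hmem l, fun i hi hp => ?_⟩
  have hi' : i ∈ (J : Set (Fin n)) := hi
  rw [hJ] at hi'
  obtain ⟨p, rfl⟩ := hi'
  have h1 := hp 1 fun _ => zero_le_one
  rw [wordProd_map_apply_one hB] at h1
  have h2 := hl.2 p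
  have : (0 : ℤ) ≤ orbitPoint B l p := by exact_mod_cast h1
  lia

/-- The Cartan matrix of rank two with the given off-diagonal entries. -/
def cartan2 (x : ℤ × ℤ) : Fin 2 → Fin 2 → ℤ := ![![2, x.1], ![x.2, 2]]

/-- The Cartan matrix of rank three with the given off-diagonal entries. -/
def cartan3 (x y z : ℤ × ℤ) : Fin 3 → Fin 3 → ℤ :=
  ![![2, x.1, z.1], ![x.2, 2, y.1], ![z.2, y.2, 2]]

/-- The Cartan matrix of rank four with the given off-diagonal entries. -/
def cartan4 (x₁ x₂ x₃ y₂ y₃ z : ℤ × ℤ) : Fin 4 → Fin 4 → ℤ :=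
  ![![2, x₁.1, x₂.1, x₃.1], ![x₁.2, 2, y₂.1, y₃.1], ![x₂.2, y₂.2, 2, z.1], ![x₃.2, y₃.2, z.2, 2]]

/-- The length of the longest element in rank two, in terms of the label. -/
def longest2 : ℕ → Option ℕ
  | 0 => some 2
  | 1 => some 3
  | 2 => some 4
  | 3 => some 6
  | _ => none

/-- The length of the longest element in rank three, in terms of the labels of the edges. -/
def longest3 (r s t : ℕ) : Option ℕ :=
  if r * s * t ≠ 0 then none else
    -- Without a triangle, the finite types are, in this order, `A₁³`, `A₂ × A₁`, `B₂ × A₁`, `A₃`,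
    -- `G₂ × A₁` and `B₃` or `C₃`.
    match r + s + t, max (max r s) t with
    | 0, _ => some 3
    | 1, _ => some 4
    | 2, 2 => some 5
    | 2, _ => some 6
    | 3, 3 => some 7
    | 3, _ => some 9
    | _, _ => none

/-- `X ^ (2 * N)`, or zero. -/
noncomputable def longestTerm : Option ℕ → ℤ⟦X⟧
  | none => 0
  | some N => X ^ (2 * N)

/-- The search bound `6` is the greatest length that occurs, that of `G₂`; in ranks three and four
the bounds `9` and `24` come from `B₃` and `F₄`. -/
theorem greedyWord_cartan2 : ∀ r ∈ List.range 4, ∀ x ∈ entryPairs r,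
    isLongestWord (cartan2 x) (greedyWord (cartan2 x) 6 []) = true ∧
      longest2 r = some (greedyWord (cartan2 x) 6 []).length := by
  decide +kernel

theorem greedyWord_cartan3 : ∀ r ∈ List.range 4, ∀ s ∈ List.range 4, ∀ t ∈ List.range 4,
    r + s + t ≤ 3 → r * s * t = 0 → ∀ x ∈ entryPairs r, ∀ y ∈ entryPairs s, ∀ z ∈ entryPairs t,
    isLongestWord (cartan3 x y z) (greedyWord (cartan3 x y z) 9 []) = true ∧
      longest3 r s t = some (greedyWord (cartan3 x y z) 9 []).length := by
  decide +kernel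

/-- The labels of the finite types in rank four, on the edges `01, 02, 03, 12, 13, 23`, with
the length of the longest element. -/
def finiteTypes4 : List (List ℕ × ℕ) :=
  -- The types `A₄`, `B₄` or `C₄`, `F₄` and `D₄`; decomposable types do not occur in the tables.
  [([1, 0, 0, 1, 0, 1], 10), ([1, 0, 0, 1, 0, 2], 16), ([1, 0, 0, 2, 0, 1], 24),
    ([1, 1, 1, 0, 0, 0], 12)]

theorem greedyWord_cartan4 : ∀ x ∈ finiteTypes4,
    ∀ x₁ ∈ entryPairs (x.1.getD 0 0), ∀ x₂ ∈ entryPairs (x.1.getD 1 0),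
    ∀ x₃ ∈ entryPairs (x.1.getD 2 0), ∀ y₂ ∈ entryPairs (x.1.getD 3 0),
    ∀ y₃ ∈ entryPairs (x.1.getD 4 0), ∀ z ∈ entryPairs (x.1.getD 5 0),
    isLongestWord (cartan4 x₁ x₂ x₃ y₂ y₃ z) (greedyWord (cartan4 x₁ x₂ x₃ y₂ y₃ z) 24 []) = true ∧
      x.2 = (greedyWord (cartan4 x₁ x₂ x₃ y₂ y₃ z) 24 []).length := by
  decide +kernel

end KacMoody.CartanMat

namespace KacMoody

open PowerSeries

/-! Arithmetic of coefficient lists. -/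

/-- The power series in `X ^ 2` with the given coefficients. -/
noncomputable def evalList (c : List ℤ) : ℤ⟦X⟧ :=
  Polynomial.aeval (PowerSeries.X ^ 2 : ℤ⟦X⟧) (ofCoeffs c)

theorem evalList_nil : evalList [] = 0 := by simp [evalList, ofCoeffs]

theorem evalList_cons (a : ℤ) (c : List ℤ) :
    evalList (a :: c) = (a : ℤ⟦X⟧) + X ^ 2 * evalList c := by
  simp [evalList, ofCoeffs]

/-- Sum of coefficient lists. -/
def addList : List ℤ → List ℤ → List ℤ
  | [], d => d
  | c, [] => c
  | a :: c, b :: d => (a + b) :: addList c d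

/-- Multiple of a coefficient list. -/
def smulList (a : ℤ) (c : List ℤ) : List ℤ := c.map (a * ·)

/-- Product of coefficient lists. -/
def mulList : List ℤ → List ℤ → List ℤ
  | [], _ => []
  | a :: c, d => addList (smulList a d) (0 :: mulList c d)

/-- Equality of coefficient lists up to trailing zeros. -/
def eqList (c d : List ℤ) : Bool := (addList c (smulList (-1) d)).all fun a => decide (a = 0)

/-- The coefficients of `t ^ N`. -/
def powList (N : ℕ) : List ℤ := List.replicate N 0 ++ [1]

theorem evalList_add (c d : List ℤ) : evalList (addList c d) = evalList c + evalList d := by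
  fun_induction addList c d with
  | case1 d => simp [evalList_nil]
  | case2 c => simp [evalList_nil]
  | case3 a c b d ih => rw [evalList_cons, evalList_cons, evalList_cons, ih]; push_cast; ring

theorem evalList_smul (a : ℤ) (c : List ℤ) : evalList (smulList a c) = a * evalList c := by
  induction c with
  | nil => simp [smulList, evalList_nil]
  | cons b c ih =>
    have : smulList a (b :: c) = (a * b) :: smulList a c := rfl
    rw [this, evalList_cons, evalList_cons, ih]; push_cast; ring

theorem evalList_mul (c d : List ℤ) : evalList (mulList c d) = evalList c * evalList d := by
  induction c with
  | nil => simp [mulList, evalList_nil]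
  | cons a c ih =>
    rw [mulList, evalList_add, evalList_smul, evalList_cons, evalList_cons, ih]; push_cast; ring

theorem evalList_eq_zero {c : List ℤ} (h : (c.all fun a => decide (a = 0)) = true) :
    evalList c = 0 := by
  induction c with
  | nil => exact evalList_nil
  | cons a c ih =>
    simp only [List.all_cons, Bool.and_eq_true, decide_eq_true_eq] at h
    rw [evalList_cons, ih h.2, h.1]; simp

theorem evalList_eq {c d : List ℤ} (h : eqList c d = true) : evalList c = evalList d := by
  have := evalList_eq_zero h
  rw [evalList_add, evalList_smul] at this
  push_cast at this
  linear_combination this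

theorem evalList_pow (N : ℕ) : evalList (powList N) = X ^ (2 * N) := by
  induction N with
  | zero => simp [powList, evalList_cons, evalList_nil]
  | succ N ih =>
    have : powList (N + 1) = 0 :: powList N := by simp [powList, List.replicate_succ]
    rw [this, evalList_cons, ih]; push_cast; ring

theorem evalList_prod (L : List (List ℤ)) :
    evalList (L.foldr mulList [1]) = Polynomial.aeval (X ^ 2 : ℤ⟦X⟧) (L.map ofCoeffs).prod := by
  induction L with
  | nil => simp [evalList_cons, evalList_nil]
  | cons c L ih => rw [List.foldr_cons, evalList_mul, ih]; simp [evalList]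

theorem constantCoeff_evalList (c : List ℤ) : constantCoeff (evalList c) = c.headD 0 := by
  cases c with
  | nil => simp [evalList_nil]
  | cons a c =>
    rw [evalList_cons, map_add, map_mul, map_pow, constantCoeff_X]
    simp

theorem evalList_ne_zero {c : List ℤ} (h : c.headD 0 ≠ 0) : evalList c ≠ 0 := by
  intro h0
  rw [← constantCoeff_evalList, h0, map_zero] at h
  exact h rfl

/-- Division of coefficient lists, verified after the fact. -/
theorem eq_evalList_of_mul {G : ℤ⟦X⟧} {d g h : List ℤ} (hG : G * evalList d = evalList h)
    (hd : d.headD 0 ≠ 0) (hg : eqList (mulList g d) h = true) : G = evalList g := by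
  have := evalList_eq hg
  rw [evalList_mul, ← hG] at this
  exact (mul_right_cancel₀ (evalList_ne_zero hd) this).symm

/-- The coefficients of the common denominator `[2][4][6]`. -/
def denom : List ℤ := mulList (q 2) (mulList (q 4) (q 6))

/-- `[2][4][6] / [2]`. -/
def numer1 : List ℤ := mulList (q 4) (q 6)

/-- `[2][4][6]` divided by the Poincaré polynomial or series in rank two with the given label. -/
def numer2 : ℕ → List ℤ
  | 0 => mulList [1, 0, 1] (q 6)
  | 1 => mulList (q 4) [1, 0, 0, 1]
  | 2 => q 6
  | 3 => q 4
  -- The infinite dihedral group, whose inverse series is `2 / [2] - 1`.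
  | _ => addList (smulList 2 numer1) (smulList (-1) denom)

/-- The contribution of the proper parabolic subgroups in rank three. -/
def proper3 (r s t : ℕ) : List ℤ :=
  addList denom (addList (smulList (-3) numer1) (addList (numer2 r) (addList (numer2 s) (numer2 t))))

/-- `[2][4][6]` divided by the Poincaré polynomial or series in rank three with the given
labels. -/
def numer3 (r s t : ℕ) : List ℤ :=
  match CartanMat.longest3 r s t with
  | none => proper3 r s t
  -- The longest length identifies the finite type. The quotients are by `[2]³`, `[2]²[3]`,
  -- `[2]²[4]`, `[2][3][4]`, `[2]²[6]` and, for length `9`, by `[2][4][6]` itself.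
  | some 3 => mulList [1, 0, 1] [1, 0, 1, 0, 1]
  | some 4 => mulList [1, 0, 1] [1, 0, 0, 1]
  | some 5 => [1, 0, 1, 0, 1]
  | some 6 => [1, 0, 0, 1]
  | some 7 => [1, 0, 1]
  | some _ => [1]

/-- The contribution of the proper parabolic subgroups in rank four; the labels belong to the
edges `01, 02, 03, 12, 13, 23`. -/
def proper4 (a b c d e f : ℕ) : List ℤ :=
  addList denom (addList (smulList (-4) numer1)
    (addList (addList (addList (numer2 a) (addList (numer2 b) (numer2 c)))
      (addList (numer2 d) (addList (numer2 e) (numer2 f))))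
    (smulList (-1) (addList (addList (numer3 a d b) (numer3 a e c))
      (addList (numer3 b f c) (numer3 d f e))))))

/-- The coefficients of `t ^ N`, or zero. -/
def longestList : Option ℕ → List ℤ
  | none => []
  | some N => powList N

theorem evalList_longestList (o : Option ℕ) : evalList (longestList o) = CartanMat.longestTerm o := by
  cases o with
  | none => exact evalList_nil
  | some N => exact evalList_pow N

end KacMoody

/-! ### Longest elements in ranks one to three, and inverse series up to rank four. -/

namespace KacMoody.CartanMat

open PowerSeries

variable {n : ℕ} {A : CartanMat n}

theorem series_longest_singleton (i : Fin n) : A.series (A.longest {i}) = longestTerm (some 1) := by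
  refine series_longest_eq_of_word (k := 1) (B := fun _ _ => 2) (e := fun _ => i) (l := [0])
    (fun p q => A.diag i) ?_ (by decide +kernel)
  simp

theorem series_longest_pair {i j : Fin n} (hij : i ≠ j) :
    A.series (A.longest {i, j}) = longestTerm (longest2 (A.edgeLabel i j)) := by
  by_cases h : A.edgeLabel i j < 4
  · have hx := mem_entryPairs hij h
    obtain ⟨h1, h2⟩ := greedyWord_cartan2 _ (List.mem_range.2 h) _ hx
    rw [h2]
    refine series_longest_eq_of_word (k := 2) (e := ![i, j]) ?_ ?_ h1
    · intro p q
      fin_cases p <;> fin_cases q <;> simp [cartan2, A.diag]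
    · ext x; simp [Matrix.range_cons, Matrix.range_empty, or_comm]
  · have h4 : A.edgeLabel i j = 4 := le_antisymm (edgeLabel_le i j) (not_lt.1 h)
    have he : ({i, j} : Finset (Fin n)).erase i = {j} := by
      rw [Finset.erase_insert]; simpa using hij
    rw [h4]
    exact series_longest_star (p := i) (by simp) (by rw [he]; simp [h4])

theorem longest3_eq_none : ∀ r ∈ List.range 5, ∀ s ∈ List.range 5, ∀ t ∈ List.range 5,
    (r * s * t ≠ 0 ∨ 4 ≤ r + s + t) → longest3 r s t = none := by
  decide +kernel

/-- Three nonzero labels form a cycle; with a label missing and total at least `4`, the other two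
edges form a star; all remaining labels are of finite type. -/
theorem series_longest_triple {i j k : Fin n} (hij : i ≠ j) (hik : i ≠ k) (hjk : j ≠ k) :
    A.series (A.longest {i, j, k}) =
      longestTerm (longest3 (A.edgeLabel i j) (A.edgeLabel j k) (A.edgeLabel i k)) := by
  by_cases h : A.edgeLabel i j * A.edgeLabel j k * A.edgeLabel i k ≠ 0 ∨
      4 ≤ A.edgeLabel i j + A.edgeLabel j k + A.edgeLabel i k
  · rw [longest3_eq_none _ (List.mem_range.2 (Nat.lt_succ_of_le (edgeLabel_le i j)))
      _ (List.mem_range.2 (Nat.lt_succ_of_le (edgeLabel_le j k)))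
      _ (List.mem_range.2 (Nat.lt_succ_of_le (edgeLabel_le i k))) h]
    by_cases h0 : A.edgeLabel i j * A.edgeLabel j k * A.edgeLabel i k ≠ 0
    · have h1 : A.edgeLabel i j ≠ 0 := fun h => h0 (by simp [h])
      have h2 : A.edgeLabel j k ≠ 0 := fun h => h0 (by simp [h])
      have h3 : A.edgeLabel i k ≠ 0 := fun h => h0 (by simp [h])
      refine series_longest_cycle (T := {i, j, k}) subset_rfl (by simp) fun x hx => ?_
      simp only [Finset.mem_insert, Finset.mem_singleton] at hx
      rcases hx with rfl | rfl | rfl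
      · exact ⟨j, by simp, k, by simp, hij, hik, hjk, h1, h3⟩
      · exact ⟨i, by simp, k, by simp, hij.symm, hjk, hik, by rwa [edgeLabel_comm], h2⟩
      · exact ⟨i, by simp, j, by simp, hik.symm, hjk.symm, hij, by rwa [edgeLabel_comm],
          by rwa [edgeLabel_comm]⟩
    · have hs := h.resolve_left h0
      have e1 : ({i, j, k} : Finset (Fin n)).erase i = {j, k} := by
        rw [Finset.erase_insert]; simp [hij, hik]
      have e2 : ({i, j, k} : Finset (Fin n)).erase j = {i, k} := by
        rw [Finset.insert_comm, Finset.erase_insert]; simp [hij.symm, hjk]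
      have e3 : ({i, j, k} : Finset (Fin n)).erase k = {i, j} := by
        rw [Finset.pair_comm j k, Finset.insert_comm, Finset.erase_insert]
        simp [hik.symm, hjk.symm]
      simp only [ne_eq, not_not, mul_eq_zero] at h0
      -- The centre of the star is the vertex opposite to the missing edge.
      rcases h0 with (h0 | h0) | h0
      · refine series_longest_star (p := k) (by simp) ?_
        rw [e3, Finset.sum_pair hij, edgeLabel_comm k, edgeLabel_comm k]; lia
      · refine series_longest_star (p := i) (by simp) ?_
        rw [e1, Finset.sum_pair hjk]; lia
      · refine series_longest_star (p := j) (by simp) ?_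
        rw [e2, Finset.sum_pair hik, edgeLabel_comm j i]; lia
  · push Not at h
    have hx := mem_entryPairs (A := A) hij (by lia)
    have hy := mem_entryPairs (A := A) hjk (by lia)
    have hz := mem_entryPairs (A := A) hik (by lia)
    obtain ⟨h1, h2⟩ := greedyWord_cartan3 _ (List.mem_range.2 (by lia)) _
      (List.mem_range.2 (by lia)) _ (List.mem_range.2 (by lia)) (by lia) h.1 _ hx _ hy _ hz
    rw [h2]
    refine series_longest_eq_of_word (k := 3) (e := ![i, j, k]) ?_ ?_ h1
    · intro p q
      fin_cases p <;> fin_cases q <;> simp [cartan3, A.diag]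
    · ext x; simp [Matrix.range_cons, Matrix.range_empty]; tauto

/-! The inverse series of the parabolic subgroups of rank at most four. -/

theorem invSeries_empty : A.invSeries ∅ = 1 := by
  have h1 := A.series_mul_invSeries ∅
  have h2 : A.series (A.parabolic (∅ : Finset (Fin n))) = 1 := by
    ext m
    have : A.sphere (A.parabolic (∅ : Finset (Fin n))) m = if m = 0 then {1} else ∅ := by
      ext w
      simp only [mem_sphere, parabolic, Finset.coe_empty, Set.image_empty, Subgroup.closure_empty,
        Subgroup.coe_bot, Set.mem_singleton_iff]
      split_ifs with h
      · subst h
        simp only [Finset.mem_singleton, and_iff_left_iff_imp]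
        rintro rfl
        exact ⟨one_mem _, by rw [len_one]⟩
      · simp only [Finset.notMem_empty, iff_false]
        rintro ⟨rfl, -, h0⟩
        rw [len_one] at h0
        exact h h0.symm
    rw [series, coeff_mk, this, coeff_one]
    split_ifs <;> simp
  rwa [h2, one_mul] at h1

/-- The alternating sum over the subsets of `s`. -/
noncomputable def altSum (s : Finset (Fin n)) (f : Finset (Fin n) → ℤ⟦X⟧) : ℤ⟦X⟧ :=
  ∑ K ∈ s.powerset, (-1) ^ K.card * f K

theorem altSum_singleton (i : Fin n) (f : Finset (Fin n) → ℤ⟦X⟧) :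
    altSum {i} f = f ∅ - f {i} := by
  rw [← insert_empty_eq, altSum, Finset.sum_powerset_insert (by simp)]
  simp [sub_eq_add_neg]

/-- Subsets are split according to whether they contain `i`. Repeated use turns the sum over a power
set into explicit terms for `{i}`, `{i, j}` and so on, in the form in which their inverse series are
known. -/
theorem altSum_insert {s : Finset (Fin n)} {i : Fin n} (hi : i ∉ s)
    (f : Finset (Fin n) → ℤ⟦X⟧) :
    altSum (insert i s) f = altSum s f - altSum s fun K => f (insert i K) := by
  rw [altSum, Finset.sum_powerset_insert hi, sub_eq_add_neg]
  simp only [altSum]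
  rw [← Finset.sum_neg_distrib]
  congr 1
  refine Finset.sum_congr rfl fun K hK => ?_
  rw [Finset.card_insert_of_notMem fun h => hi (Finset.mem_powerset.1 hK h), pow_succ]
  ring

theorem altSum_invSeries (J : Finset (Fin n)) :
    altSum J A.invSeries = A.invSeries J * A.series (A.longest J) := A.sum_invSeries J

theorem evalList_one : evalList [1] = 1 := by simp [evalList_cons, evalList_nil]

theorem invSeries_singleton (i : Fin n) :
    evalList denom * A.invSeries {i} = evalList numer1 := by
  have h := altSum_invSeries (A := A) {i}
  rw [series_longest_singleton, ← evalList_longestList, altSum_singleton, invSeries_empty] at h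
  refine eq_evalList_of_mul (d := addList [1] (longestList (some 1))) (h := denom) ?_ (by decide)
    (by decide +kernel)
  rw [evalList_add, evalList_one]
  linear_combination -evalList denom * h

/-- In even rank the summand for `J` itself has sign `+`, so collecting it with the right side of
the recursion leaves `F * (1 - t^N) = 2 / [2] - 1` for the inverse series `F`. -/
theorem numer2_mul : ∀ r ∈ List.range 5,
    (addList [1] (smulList (-1) (longestList (longest2 r)))).headD 0 ≠ 0 ∧
    eqList (mulList (numer2 r) (addList [1] (smulList (-1) (longestList (longest2 r)))))
      (addList (smulList 2 numer1) (smulList (-1) denom)) = true := by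
  decide +kernel

theorem invSeries_pair {i j : Fin n} (hij : i ≠ j) :
    evalList denom * A.invSeries {i, j} = evalList (numer2 (A.edgeLabel i j)) := by
  have h := altSum_invSeries (A := A) {i, j}
  rw [series_longest_pair hij, ← evalList_longestList, altSum_insert (by simpa using hij)] at h
  simp only [altSum_singleton, insert_empty_eq, invSeries_empty] at h
  obtain ⟨h1, h2⟩ := numer2_mul _ (List.mem_range.2 (Nat.lt_succ_of_le (A.edgeLabel_le i j)))
  refine eq_evalList_of_mul ?_ h1 h2
  have hi := invSeries_singleton (A := A) i
  have hj := invSeries_singleton (A := A) j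
  rw [evalList_add, evalList_one, evalList_smul, evalList_add, evalList_smul, evalList_smul]
  push_cast
  linear_combination evalList denom * h + hi + hj

theorem evalList_proper3 (r s t : ℕ) : evalList (proper3 r s t) =
    evalList denom - 3 * evalList numer1 + evalList (numer2 r) + evalList (numer2 s) +
      evalList (numer2 t) := by
  simp only [proper3, evalList_add, evalList_smul]
  push_cast
  ring

theorem numer3_mul : ∀ r ∈ List.range 5, ∀ s ∈ List.range 5, ∀ t ∈ List.range 5,
    (addList [1] (longestList (longest3 r s t))).headD 0 ≠ 0 ∧
    eqList (mulList (numer3 r s t) (addList [1] (longestList (longest3 r s t))))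
      (proper3 r s t) = true := by
  decide +kernel

/-- In odd rank the summand for `J` has sign `-`, which makes the factor `1 + t^N`. This undivided
form serves the tables of rank three; the quotient `numer3` is needed only as an input to rank four.
-/
theorem invSeries_triple_mul {i j k : Fin n} (hij : i ≠ j) (hik : i ≠ k) (hjk : j ≠ k) :
    evalList denom * A.invSeries {i, j, k} * evalList (addList [1] (longestList
      (longest3 (A.edgeLabel i j) (A.edgeLabel j k) (A.edgeLabel i k)))) =
    evalList (proper3 (A.edgeLabel i j) (A.edgeLabel j k) (A.edgeLabel i k)) := by
  have h := altSum_invSeries (A := A) {i, j, k}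
  rw [series_longest_triple hij hik hjk, ← evalList_longestList,
    altSum_insert (by simp [hij, hik]), altSum_insert (by simpa using hjk),
    altSum_insert (by simpa using hjk)] at h
  simp only [altSum_singleton, insert_empty_eq, invSeries_empty] at h
  have hi := invSeries_singleton (A := A) i
  have hj := invSeries_singleton (A := A) j
  have hk := invSeries_singleton (A := A) k
  have hij' := invSeries_pair (A := A) hij
  have hik' := invSeries_pair (A := A) hik
  have hjk' := invSeries_pair (A := A) hjk
  rw [evalList_add, evalList_one, evalList_proper3]
  linear_combination -evalList denom * h - hi - hj - hk + hij' + hik' + hjk'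

theorem invSeries_triple {i j k : Fin n} (hij : i ≠ j) (hik : i ≠ k) (hjk : j ≠ k) :
    evalList denom * A.invSeries {i, j, k} =
      evalList (numer3 (A.edgeLabel i j) (A.edgeLabel j k) (A.edgeLabel i k)) := by
  obtain ⟨h1, h2⟩ := numer3_mul _ (List.mem_range.2 (Nat.lt_succ_of_le (A.edgeLabel_le i j)))
    _ (List.mem_range.2 (Nat.lt_succ_of_le (A.edgeLabel_le j k)))
    _ (List.mem_range.2 (Nat.lt_succ_of_le (A.edgeLabel_le i k)))
  exact eq_evalList_of_mul (invSeries_triple_mul hij hik hjk) h1 h2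

theorem evalList_proper4 (a b c d e f : ℕ) : evalList (proper4 a b c d e f) =
    evalList denom - 4 * evalList numer1 + (evalList (numer2 a) + evalList (numer2 b) +
      evalList (numer2 c) + evalList (numer2 d) + evalList (numer2 e) + evalList (numer2 f)) -
      (evalList (numer3 a d b) + evalList (numer3 a e c) + evalList (numer3 b f c) +
        evalList (numer3 d f e)) := by
  simp only [proper4, evalList_add, evalList_smul]
  push_cast
  ring

/-- The factor is `t^N - 1` for even rank, and `-1` without a longest element. No division follows:
`[2][4][6]` need not clear denominators in rank four, as `A₄` shows with its factor `[5]`. -/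
theorem invSeries_quadruple_mul {i j k l : Fin n} (hij : i ≠ j) (hik : i ≠ k) (hil : i ≠ l)
    (hjk : j ≠ k) (hjl : j ≠ l) (hkl : k ≠ l) {o : Option ℕ}
    (ho : A.series (A.longest {i, j, k, l}) = longestTerm o) :
    evalList denom * A.invSeries {i, j, k, l} * evalList (addList [-1] (longestList o)) =
    evalList (proper4 (A.edgeLabel i j) (A.edgeLabel i k) (A.edgeLabel i l) (A.edgeLabel j k)
      (A.edgeLabel j l) (A.edgeLabel k l)) := by
  have h := altSum_invSeries (A := A) {i, j, k, l}
  have h1' : i ∉ ({j, k, l} : Finset (Fin n)) := by simp [hij, hik, hil]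
  have h2' : j ∉ ({k, l} : Finset (Fin n)) := by simp [hjk, hjl]
  have h3' : k ∉ ({l} : Finset (Fin n)) := by simpa using hkl
  rw [ho, ← evalList_longestList] at h
  simp only [altSum_insert h1', altSum_insert h2', altSum_insert h3', altSum_singleton,
    insert_empty_eq, invSeries_empty] at h
  have hi := invSeries_singleton (A := A) i
  have hj := invSeries_singleton (A := A) j
  have hk := invSeries_singleton (A := A) k
  have hl := invSeries_singleton (A := A) l
  have h1 := invSeries_pair (A := A) hij
  have h2 := invSeries_pair (A := A) hik
  have h3 := invSeries_pair (A := A) hil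
  have h4 := invSeries_pair (A := A) hjk
  have h5 := invSeries_pair (A := A) hjl
  have h6 := invSeries_pair (A := A) hkl
  have t1 := invSeries_triple (A := A) hij hik hjk
  have t2 := invSeries_triple (A := A) hij hil hjl
  have t3 := invSeries_triple (A := A) hik hil hkl
  have t4 := invSeries_triple (A := A) hjk hjl hkl
  have hm : evalList [-1] = -1 := by simp [evalList_cons, evalList_nil]
  rw [evalList_add, hm, evalList_proper4]
  linear_combination -evalList denom * h - hi - hj - hk - hl + h1 + h2 + h3 + h4 + h5 + h6
    - t1 - t2 - t3 - t4

end KacMoody.CartanMat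

/-! ### Verification of the rational functions in the tables. -/

namespace KacMoody

open PowerSeries

/-- The identity of coefficient lists behind an entry of the tables, for a Poincaré series
`P = [2][4][6] * u / v`. -/
def checkEntry (x : Entry) (u v : List ℤ) : Bool :=
  decide (u.headD 0 ≠ 0) && decide (x.den.headD 0 = 1) &&
    eqList (mulList denom (mulList x.den u)) (mulList (x.num.foldr mulList [1]) v)

/-- With `F = 1 / P`, the relation for `F` says `P = [2][4][6] * u / v`. The check is the
cross-multiplied equality with `N / D`; the nonzero constant terms of `u` and `[2][4][6]` permit
cancellation, and the constant term `1` makes `D` a unit. -/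
theorem Entry.represents_of_check {x : Entry} {u v : List ℤ} (h : checkEntry x u v = true)
    {P F : ℤ⟦X⟧} (hPF : P * F = 1) (huv : evalList denom * F * evalList u = evalList v) :
    x.Represents P := by
  simp only [checkEntry, Bool.and_eq_true, decide_eq_true_eq] at h
  obtain ⟨⟨hu, hd⟩, he⟩ := h
  have h1 := evalList_eq he
  rw [evalList_mul, evalList_mul, evalList_mul, evalList_prod] at h1
  have hD : Polynomial.aeval (X ^ 2 : ℤ⟦X⟧) x.D = evalList x.den := rfl
  have hN : Polynomial.aeval (X ^ 2 : ℤ⟦X⟧) x.N =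
    Polynomial.aeval (X ^ 2 : ℤ⟦X⟧) (x.num.map ofCoeffs).prod := rfl
  refine ⟨?_, ?_⟩
  · rw [hD, PowerSeries.isUnit_iff_constantCoeff, constantCoeff_evalList, hd]
    exact isUnit_one
  · rw [hD, hN]
    refine mul_left_cancel₀ (evalList_ne_zero (c := denom) (by decide)) ?_
    refine mul_right_cancel₀ (evalList_ne_zero hu) ?_
    calc evalList denom * (P * evalList x.den) * evalList u
        = P * (evalList denom * (evalList x.den * evalList u)) := by ring
      _ = P * F * evalList denom * evalList u *
          Polynomial.aeval (X ^ 2 : ℤ⟦X⟧) (x.num.map ofCoeffs).prod := by rw [h1, ← huv]; ring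
      _ = _ := by rw [hPF]; ring

/-- The label of the pair `i, j` in the graph with the edges `E` and the labels `r`. -/
def labelAt {n : ℕ} (E : List (Fin n × Fin n)) (r : List ℕ) (i j : Fin n) : ℕ :=
  match (E.zip r).find? fun y => y.1 = (i, j) || y.1 = (j, i) with
  | some y => y.2
  | none => 0

/-- Adjacency in the graph with the edges `E`. -/
def isEdge {n : ℕ} (E : List (Fin n × Fin n)) (i j : Fin n) : Bool :=
  E.any fun p => p = (i, j) || p = (j, i)

theorem not_mem_of_isEdge {n : ℕ} {E : List (Fin n × Fin n)} {i j : Fin n}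
    (h : isEdge E i j = false) : (i, j) ∉ E ∧ (j, i) ∉ E := by
  simp only [isEdge, List.any_eq_false, Bool.or_eq_true, decide_eq_true_eq, not_or] at h
  exact ⟨fun h' => (h _ h').1 rfl, fun h' => (h _ h').2 rfl⟩

theorem isEdge_eq_false {n : ℕ} {E : List (Fin n × Fin n)} {i j : Fin n}
    (h : (i, j) ∉ E ∧ (j, i) ∉ E) : isEdge E i j = false := by
  simp only [isEdge, List.any_eq_false, Bool.or_eq_true, decide_eq_true_eq, not_or]
  exact fun p hp => ⟨fun h' => h.1 (h' ▸ hp), fun h' => h.2 (h' ▸ hp)⟩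

theorem labelAt_map {n : ℕ} {E : List (Fin n × Fin n)} {f : Fin n → Fin n → ℕ}
    (hsymm : ∀ i j, f i j = f j i) {i j : Fin n}
    (h0 : (i, j) ∉ E → (j, i) ∉ E → f i j = 0) :
    labelAt E (E.map fun p => f p.1 p.2) i j = f i j := by
  rw [labelAt]
  have hz : ∀ L : List (Fin n × Fin n), L.zip (L.map fun p => f p.1 p.2) =
      L.map fun p => (p, f p.1 p.2) := by
    intro L
    induction L with
    | nil => rfl
    | cons p L ih => rw [List.map_cons, List.zip_cons_cons, ih, List.map_cons]
  rw [hz]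
  split
  · next y hy =>
    have h1 := List.find?_some hy
    obtain ⟨p, -, rfl⟩ := List.mem_map.1 (List.mem_of_find?_eq_some hy)
    simp only [Bool.or_eq_true, decide_eq_true_eq] at h1
    rcases h1 with rfl | rfl
    · rfl
    · exact hsymm _ _
  · next hn =>
    rw [List.find?_eq_none] at hn
    symm
    refine h0 (fun h => ?_) fun h => ?_
    · exact hn _ (List.mem_map.2 ⟨_, h, rfl⟩) (by simp)
    · exact hn _ (List.mem_map.2 ⟨_, h, rfl⟩) (by simp)

/-- Sufficient conditions for the Weyl group to be infinite in rank four; the labels belong to the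
edges `01, 02, 03, 12, 13, 23`. -/
def isInfinite4 (a b c d e f : ℕ) : Bool :=
  -- All stars and triangles are tested, but only the 4-cycle `0 1 2 3` and the path `0 1 2 3`; the
  -- tables number their 4-cycle and their path in this way.
  decide (4 ≤ a + b + c) || decide (4 ≤ a + d + e) || decide (4 ≤ b + d + f) ||
  decide (4 ≤ c + e + f) || decide (a * d * b ≠ 0) || decide (a * e * c ≠ 0) ||
  decide (b * f * c ≠ 0) || decide (d * f * e ≠ 0) || decide (a * d * f * c ≠ 0) ||
  (decide (2 ≤ a) && decide (d ≠ 0) && decide (2 ≤ f))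

/-- The check for an entry of a table in rank three. -/
def checkRow3 (x : Entry) (r s t : ℕ) : Bool :=
  checkEntry x (addList [1] (longestList (CartanMat.longest3 r s t))) (proper3 r s t)

/-- The check for an entry of a table in rank four. -/
def checkRow4 (x : Entry) (a b c d e f : ℕ) : Bool :=
  (isInfinite4 a b c d e f && checkEntry x [-1] (proper4 a b c d e f)) ||
    CartanMat.finiteTypes4.any fun y => decide (y.1 = [a, b, c, d, e, f]) &&
      checkEntry x (addList [-1] (powList y.2)) (proper4 a b c d e f)

/-- The check for a table in rank three. -/
def checkTable3 (E : List (Fin 3 × Fin 3)) (T : List Entry) : Bool :=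
  T.all fun x => x.labels.all fun r =>
    checkRow3 x (labelAt E r 0 1) (labelAt E r 1 2) (labelAt E r 0 2)

/-- The check for a table in rank four. -/
def checkTable4 (E : List (Fin 4 × Fin 4)) (T : List Entry) : Bool :=
  T.all fun x => x.labels.all fun r =>
    checkRow4 x (labelAt E r 0 1) (labelAt E r 0 2) (labelAt E r 0 3) (labelAt E r 1 2)
      (labelAt E r 1 3) (labelAt E r 2 3)

/-- The check for a table of complete graphs in rank four. -/
def checkTableComplete (T : List Entry) : Bool :=
  T.all fun x => x.labels.all fun r => (r.all fun a => decide (a ≠ 0)) &&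
    match r with
    | [a, b, c, d, e, f] => checkEntry x [-1] (proper4 a b c d e f)
    | _ => false

theorem checkTable3_I : checkTable3 graph3I table3I = true := by decide +kernel
theorem checkTable3_II : checkTable3 graph3II table3II = true := by decide +kernel
theorem checkTable4_I : checkTable4 graph4I table4I = true := by decide +kernel
theorem checkTable4_II : checkTable4 graph4II table4II = true := by decide +kernel
theorem checkTable4_III : checkTable4 graph4III table4III = true := by decide +kernel
theorem checkTable4_IV : checkTable4 graph4IV table4IV = true := by decide +kernel
theorem checkTable4_V : checkTable4 graph4V table4V = true := by decide +kernel
theorem checkTable4_VI : checkTableComplete table4VI = true := by decide +kernel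

namespace CartanMat

theorem series_univ_mul {n : ℕ} {A : CartanMat n} {J : Finset (Fin n)} (hJ : J = Finset.univ) :
    A.poincareSeries * A.invSeries J = 1 := by
  rw [poincareSeries_eq, ← series_mul_invSeries A J, hJ, Finset.coe_univ]

theorem HasCoxeterGraph.edgeLabel_eq {n : ℕ} {A : CartanMat n} {E : List (Fin n × Fin n)}
    {r : List ℕ} {e : Equiv.Perm (Fin n)}
    (h : E.map (fun p => A.edgeLabel (e p.1) (e p.2)) = r ∧
      ∀ i j, i ≠ j → (i, j) ∉ E → (j, i) ∉ E → A.edgeLabel (e i) (e j) = 0)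
    {i j : Fin n} (hij : i ≠ j) : A.edgeLabel (e i) (e j) = labelAt E r i j := by
  rw [← h.1]
  exact (labelAt_map (f := fun i j => A.edgeLabel (e i) (e j)) (fun i j => edgeLabel_comm _ _)
    (h.2 i j hij)).symm

theorem represents_of_checkTable3 {A : CartanMat 3} {E : List (Fin 3 × Fin 3)} {T : List Entry}
    (hT : checkTable3 E T = true) {x : Entry} (hx : x ∈ T) {r : List ℕ} (hr : r ∈ x.labels)
    (h : A.HasCoxeterGraph E r) : x.Represents A.poincareSeries := by
  obtain ⟨e, he⟩ := h
  have hc := List.all_eq_true.1 (List.all_eq_true.1 hT x hx) r hr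
  rw [← HasCoxeterGraph.edgeLabel_eq he (by decide), ← HasCoxeterGraph.edgeLabel_eq he (by decide),
    ← HasCoxeterGraph.edgeLabel_eq he (by decide)] at hc
  have hne : ∀ {i j : Fin 3}, i ≠ j → e i ≠ e j := fun h h' => h (e.injective h')
  refine Entry.represents_of_check hc (series_univ_mul (J := {e 0, e 1, e 2}) ?_)
    (invSeries_triple_mul (hne (by decide)) (hne (by decide)) (hne (by decide)))
  refine Finset.eq_univ_iff_forall.2 fun i => ?_
  obtain ⟨j, rfl⟩ := e.surjective i
  fin_cases j <;> simp

theorem series_longest_infinite {n : ℕ} {A : CartanMat n} {i j k l : Fin n} (hij : i ≠ j)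
    (hik : i ≠ k) (hil : i ≠ l) (hjk : j ≠ k) (hjl : j ≠ l) (hkl : k ≠ l)
    (h : isInfinite4 (A.edgeLabel i j) (A.edgeLabel i k) (A.edgeLabel i l) (A.edgeLabel j k)
      (A.edgeLabel j l) (A.edgeLabel k l) = true) :
    A.series (A.longest {i, j, k, l}) = longestTerm none := by
  have star : ∀ {p a b c : Fin n}, ({i, j, k, l} : Finset (Fin n)) = {p, a, b, c} → p ≠ a →
      p ≠ b → p ≠ c → a ≠ b → a ≠ c → b ≠ c →
      4 ≤ A.edgeLabel p a + A.edgeLabel p b + A.edgeLabel p c →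
      A.series (A.longest {i, j, k, l}) = longestTerm none := by
    intro p a b c hs h1 h2 h3 h4 h5 h6 h
    rw [hs]
    refine series_longest_star (p := p) (by simp) ?_
    rw [Finset.erase_insert (by simp [h1, h2, h3]), Finset.sum_insert (by simp [h4, h5]),
      Finset.sum_pair h6]
    lia
  have tri : ∀ {a b c : Fin n}, ({a, b, c} : Finset (Fin n)) ⊆ {i, j, k, l} → a ≠ b →
      a ≠ c → b ≠ c → A.edgeLabel a b * A.edgeLabel b c * A.edgeLabel a c ≠ 0 →
      A.series (A.longest {i, j, k, l}) = longestTerm none := by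
    intro a b c hs hab hac hbc h0
    have h1 : A.edgeLabel a b ≠ 0 := fun h => h0 (by simp [h])
    have h2 : A.edgeLabel b c ≠ 0 := fun h => h0 (by simp [h])
    have h3 : A.edgeLabel a c ≠ 0 := fun h => h0 (by simp [h])
    refine series_longest_cycle hs (by simp) fun x hx => ?_
    simp only [Finset.mem_insert, Finset.mem_singleton] at hx
    rcases hx with rfl | rfl | rfl
    · exact ⟨b, by simp, c, by simp, hab, hac, hbc, h1, h3⟩
    · exact ⟨a, by simp, c, by simp, hab.symm, hbc, hac, by rwa [edgeLabel_comm], h2⟩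
    · exact ⟨a, by simp, b, by simp, hac.symm, hbc.symm, hab, by rwa [edgeLabel_comm],
        by rwa [edgeLabel_comm]⟩
  simp only [isInfinite4, Bool.or_eq_true, Bool.and_eq_true, decide_eq_true_eq] at h
  rcases h with ((((((((h | h) | h) | h) | h) | h) | h) | h) | h) | h
  · exact star rfl hij hik hil hjk hjl hkl h
  · refine star (Finset.insert_comm _ _ _) hij.symm hjk hjl hik hil hkl ?_
    rwa [edgeLabel_comm j i]
  · refine star (p := k) (a := i) (b := j) (c := l) ?_ hik.symm hjk.symm hkl hij hil hjl ?_
    · ext; simp; tauto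
    · rwa [edgeLabel_comm k i, edgeLabel_comm k j]
  · refine star (p := l) (a := i) (b := j) (c := k) ?_ hil.symm hjl.symm hkl.symm hij hik hjk ?_
    · ext; simp; tauto
    · rwa [edgeLabel_comm l i, edgeLabel_comm l j, edgeLabel_comm l k]
  · exact tri (a := i) (b := j) (c := k) (by intro x; simp; tauto) hij hik hjk h
  · exact tri (a := i) (b := j) (c := l) (by intro x; simp; tauto) hij hil hjl h
  · exact tri (a := i) (b := k) (c := l) (by intro x; simp; tauto) hik hil hkl h
  · exact tri (a := j) (b := k) (c := l) (by intro x; simp; tauto) hjk hjl hkl h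
  · have h1 : A.edgeLabel i j ≠ 0 := fun h' => h (by simp [h'])
    have h2 : A.edgeLabel j k ≠ 0 := fun h' => h (by simp [h'])
    have h3 : A.edgeLabel k l ≠ 0 := fun h' => h (by simp [h'])
    have h4 : A.edgeLabel i l ≠ 0 := fun h' => h (by simp [h'])
    refine series_longest_cycle subset_rfl (by simp) fun x hx => ?_
    simp only [Finset.mem_insert, Finset.mem_singleton] at hx
    rcases hx with rfl | rfl | rfl | rfl
    · exact ⟨j, by simp, l, by simp, hij, hil, hjl, h1, h4⟩
    · exact ⟨i, by simp, k, by simp, hij.symm, hjk, hik, by rwa [edgeLabel_comm], h2⟩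
    · exact ⟨j, by simp, l, by simp, hjk.symm, hkl, hjl, by rwa [edgeLabel_comm], h3⟩
    · exact ⟨i, by simp, k, by simp, hil.symm, hkl.symm, hik, by rwa [edgeLabel_comm],
        by rwa [edgeLabel_comm]⟩
  · exact series_longest_path hij hik hil hjk hjl hkl h.1.1 h.1.2 h.2

theorem series_longest_finite {n : ℕ} {A : CartanMat n} {i j k l : Fin n} (hij : i ≠ j)
    (hik : i ≠ k) (hil : i ≠ l) (hjk : j ≠ k) (hjl : j ≠ l) (hkl : k ≠ l)
    {y : List ℕ × ℕ} (hy : y ∈ finiteTypes4)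
    (h : y.1 = [A.edgeLabel i j, A.edgeLabel i k, A.edgeLabel i l, A.edgeLabel j k,
      A.edgeLabel j l, A.edgeLabel k l]) :
    A.series (A.longest {i, j, k, l}) = longestTerm (some y.2) := by
  have hlt : ∀ a ∈ y.1, a < 4 := by
    revert y
    simp [finiteTypes4]
  rw [h] at hlt
  simp only [List.mem_cons, List.not_mem_nil, or_false, forall_eq_or_imp, forall_eq] at hlt
  have hg := greedyWord_cartan4 y hy
  simp only [h, List.getD_cons_zero, List.getD_cons_succ] at hg
  obtain ⟨h1, h2⟩ := hg _ (mem_entryPairs hij hlt.1) _ (mem_entryPairs hik hlt.2.1)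
    _ (mem_entryPairs hil hlt.2.2.1) _ (mem_entryPairs hjk hlt.2.2.2.1)
    _ (mem_entryPairs hjl hlt.2.2.2.2.1) _ (mem_entryPairs hkl hlt.2.2.2.2.2)
  rw [h2]
  refine series_longest_eq_of_word (k := 4) (e := ![i, j, k, l]) ?_ ?_ h1
  · intro p q
    fin_cases p <;> fin_cases q <;> simp [cartan4, A.diag]
  · ext x; simp [Matrix.range_cons, Matrix.range_empty]; tauto

theorem insert_perm_eq_univ (e : Equiv.Perm (Fin 4)) :
    ({e 0, e 1, e 2, e 3} : Finset (Fin 4)) = Finset.univ := by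
  refine Finset.eq_univ_iff_forall.2 fun i => ?_
  obtain ⟨j, rfl⟩ := e.surjective i
  fin_cases j <;> simp

theorem represents_of_checkTable4 {A : CartanMat 4} {E : List (Fin 4 × Fin 4)} {T : List Entry}
    (hT : checkTable4 E T = true) {x : Entry} (hx : x ∈ T) {r : List ℕ} (hr : r ∈ x.labels)
    (h : A.HasCoxeterGraph E r) : x.Represents A.poincareSeries := by
  obtain ⟨e, he⟩ := h
  have hc := List.all_eq_true.1 (List.all_eq_true.1 hT x hx) r hr
  have hl : ∀ {i j : Fin 4}, i ≠ j → labelAt E r i j = A.edgeLabel (e i) (e j) :=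
    fun h => (HasCoxeterGraph.edgeLabel_eq he h).symm
  have hne : ∀ {i j : Fin 4}, i ≠ j → e i ≠ e j := fun h h' => h (e.injective h')
  have h01 := hne (show (0 : Fin 4) ≠ 1 by decide)
  have h02 := hne (show (0 : Fin 4) ≠ 2 by decide)
  have h03 := hne (show (0 : Fin 4) ≠ 3 by decide)
  have h12 := hne (show (1 : Fin 4) ≠ 2 by decide)
  have h13 := hne (show (1 : Fin 4) ≠ 3 by decide)
  have h23 := hne (show (2 : Fin 4) ≠ 3 by decide)
  have hP := series_univ_mul (A := A) (insert_perm_eq_univ e)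
  rw [hl (by decide), hl (by decide), hl (by decide), hl (by decide), hl (by decide),
    hl (by decide), checkRow4, Bool.or_eq_true, Bool.and_eq_true] at hc
  rcases hc with ⟨h1, h2⟩ | h
  · exact Entry.represents_of_check h2 hP (invSeries_quadruple_mul h01 h02 h03 h12 h13 h23
      (o := none) (series_longest_infinite h01 h02 h03 h12 h13 h23 h1))
  · obtain ⟨y, hy, h⟩ := List.any_eq_true.1 h
    rw [Bool.and_eq_true, decide_eq_true_eq] at h
    exact Entry.represents_of_check h.2 hP (invSeries_quadruple_mul h01 h02 h03 h12 h13 h23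
      (o := some y.2) (series_longest_finite h01 h02 h03 h12 h13 h23 hy h.1))

/-- No triangle with nonzero labels has a longest element, so its inverse series is a sum over its
edges. Each edge lies in two of the four triangles, and the total depends on the labels
symmetrically. This is why their order does not matter for the complete graph. -/
theorem evalList_proper4_of_ne_zero {a b c d e f : ℕ} (h : ∀ x ∈ [a, b, c, d, e, f], x ≠ 0) :
    evalList (proper4 a b c d e f) = -3 * evalList denom + 8 * evalList numer1 -
      ([a, b, c, d, e, f].map fun x => evalList (numer2 x)).sum := by
  simp only [List.mem_cons, List.not_mem_nil, or_false, forall_eq_or_imp, forall_eq] at h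
  obtain ⟨ha, hb, hc, hd, he, hf⟩ := h
  have hn : ∀ {r s t : ℕ}, r ≠ 0 → s ≠ 0 → t ≠ 0 → evalList (numer3 r s t) =
      evalList (proper3 r s t) := by
    intro r s t hr hs ht
    rw [numer3, longest3, if_pos (by simp [hr, hs, ht])]
  rw [evalList_proper4, hn ha hd hb, hn ha he hc, hn hb hf hc, hn hd hf he]
  simp only [evalList_proper3, List.map_cons, List.map_nil, List.sum_cons, List.sum_nil]
  ring

theorem represents_of_checkTableComplete {A : CartanMat 4} {T : List Entry}
    (hT : checkTableComplete T = true) {x : Entry} (hx : x ∈ T) {r : List ℕ} (hr : r ∈ x.labels)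
    (h : A.HasCoxeterGraphUpToOrder graph4VI r) : x.Represents A.poincareSeries := by
  obtain ⟨r', hperm, e, he, -⟩ := h
  have hc := List.all_eq_true.1 (List.all_eq_true.1 hT x hx) r hr
  rw [Bool.and_eq_true, List.all_eq_true] at hc
  obtain ⟨h0, hc⟩ := hc
  split at hc
  · next a b c d e' f =>
    have hne : ∀ {i j : Fin 4}, i ≠ j → e i ≠ e j := fun h h' => h (e.injective h')
    have h01 := hne (show (0 : Fin 4) ≠ 1 by decide)
    have h02 := hne (show (0 : Fin 4) ≠ 2 by decide)
    have h03 := hne (show (0 : Fin 4) ≠ 3 by decide)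
    have h12 := hne (show (1 : Fin 4) ≠ 2 by decide)
    have h13 := hne (show (1 : Fin 4) ≠ 3 by decide)
    have h23 := hne (show (2 : Fin 4) ≠ 3 by decide)
    have hP := series_univ_mul (A := A) (insert_perm_eq_univ e)
    simp only [graph4VI, List.map_cons, List.map_nil] at he
    subst he
    have h0' : ∀ x ∈ [a, b, c, d, e', f], x ≠ 0 := fun x hx => by simpa using h0 x hx
    have h0'' := fun x hx => h0' x (hperm.mem_iff.1 hx)
    refine Entry.represents_of_check hc hP ?_
    have hinf := series_longest_infinite (A := A) h01 h02 h03 h12 h13 h23 (by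
      simp only [List.mem_cons, List.not_mem_nil, or_false, forall_eq_or_imp, forall_eq] at h0''
      simp [isInfinite4, h0''])
    have h1 := invSeries_quadruple_mul h01 h02 h03 h12 h13 h23 (o := none) hinf
    rw [evalList_proper4_of_ne_zero h0''] at h1
    rw [evalList_proper4_of_ne_zero h0', ← (hperm.map fun x => evalList (numer2 x)).sum_eq]
    exact h1
  · simp at hc

end CartanMat

end KacMoody

/-! ### Finite checks that the tables are exhaustive. -/

namespace KacMoody

/-- All lists of length `k` with entries in `L`. -/
def allLists (L : List ℕ) : ℕ → List (List ℕ)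
  | 0 => [[]]
  | k + 1 => L.flatMap fun a => (allLists L k).map (a :: ·)

theorem mem_allLists {L r : List ℕ} (h : ∀ a ∈ r, a ∈ L) : r ∈ allLists L r.length := by
  induction r with
  | nil => simp [allLists]
  | cons a r ih =>
    simp only [List.length_cons, allLists, List.mem_flatMap, List.mem_map]
    exact ⟨a, h a (by simp), r, ih fun b hb => h b (by simp [hb]), rfl⟩

/-- All nondecreasing lists of length `k` with entries in `L` that are at least `m`. -/
def ascendingLists (L : List ℕ) : ℕ → ℕ → List (List ℕ)
  | _, 0 => [[]]
  | m, k + 1 => L.flatMap fun a => if m ≤ a then (ascendingLists L a k).map (a :: ·) else []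

theorem mem_ascendingLists {L r : List ℕ} {m : ℕ} (h : ∀ a ∈ r, a ∈ L)
    (hr : r.Pairwise (· ≤ ·)) (hm : ∀ a ∈ r, m ≤ a) : r ∈ ascendingLists L m r.length := by
  induction r generalizing m with
  | nil => simp [ascendingLists]
  | cons a r ih =>
    simp only [List.length_cons, ascendingLists, List.mem_flatMap]
    rw [List.pairwise_cons] at hr
    refine ⟨a, h a (by simp), ?_⟩
    rw [if_pos (hm a (by simp))]
    exact List.mem_map.2 ⟨r, ih (fun b hb => h b (by simp [hb])) hr.2 hr.1, rfl⟩

/-- The number with the base four digits `a - 1`, for the elements `a` of the list. -/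
def labelCode : List ℕ → ℕ
  | [] => 0
  | a :: r => (a - 1) + 4 * labelCode r

theorem labelCode_lt {r : List ℕ} (h : ∀ a ∈ r, 1 ≤ a ∧ a ≤ 4) : labelCode r < 4 ^ r.length := by
  induction r with
  | nil => simp [labelCode]
  | cons a r ih =>
    have h1 := h a (by simp)
    have h2 := ih fun b hb => h b (by simp [hb])
    rw [labelCode, List.length_cons, pow_succ]
    lia

theorem labelCode_injective {r s : List ℕ} (hr : ∀ a ∈ r, 1 ≤ a ∧ a ≤ 4)
    (hs : ∀ a ∈ s, 1 ≤ a ∧ a ≤ 4) (hl : r.length = s.length) (h : labelCode r = labelCode s) :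
    r = s := by
  induction r generalizing s with
  | nil => exact (List.length_eq_zero_iff.1 hl.symm).symm
  | cons a r ih =>
    cases s with
    | nil => simp at hl
    | cons b s =>
      have h1 := hr a (by simp)
      have h2 := hs b (by simp)
      simp only [labelCode] at h
      have hab : a = b := by lia
      rw [hab, ih (s := s) (fun c hc => hr c (by simp [hc])) (fun c hc => hs c (by simp [hc]))
        (by simpa using hl) (by lia)]

/-- The bitmask of a list of natural numbers. -/
def bitmask (L : List ℕ) : ℕ := L.foldr (fun c m => 2 ^ c ||| m) 0

/-- A set of codes is stored in the bits of one number, so that exhaustiveness becomes a single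
equality of natural numbers. -/
theorem mem_of_testBit_bitmask {L : List ℕ} {c : ℕ} (h : (bitmask L).testBit c = true) :
    c ∈ L := by
  induction L with
  | nil => simp [bitmask] at h
  | cons a L ih =>
    rw [bitmask, List.foldr_cons, Nat.testBit_or, Nat.testBit_two_pow, Bool.or_eq_true,
      decide_eq_true_eq] at h
    rcases h with rfl | h
    · simp
    · exact List.mem_cons_of_mem _ (ih h)

/-- The permutations of three vertices. -/
def perms3 : List (Equiv.Perm (Fin 3)) :=
  [0, 1, 2].flatMap fun a => [1, 2].map fun b => Equiv.swap 0 a * Equiv.swap 1 b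

/-- The permutations of four vertices. -/
def perms4 : List (Equiv.Perm (Fin 4)) :=
  [0, 1, 2, 3].flatMap fun a => [1, 2, 3].flatMap fun b => [2, 3].map fun c =>
    Equiv.swap 0 a * Equiv.swap 1 b * Equiv.swap 2 c

/-- The permutation `σ` carries non-edges of `E` to non-edges. -/
def isAutomorphism {n : ℕ} (E : List (Fin n × Fin n)) (σ : Equiv.Perm (Fin n)) : Bool :=
  (List.finRange n).all fun i => (List.finRange n).all fun j =>
    isEdge E i j || !isEdge E (σ i) (σ j)

/-- The labels of `E` after a renumbering of the vertices. -/
def permuteLabels {n : ℕ} (E : List (Fin n × Fin n)) (r : List ℕ) (σ : Equiv.Perm (Fin n)) :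
    List ℕ :=
  E.map fun p => labelAt E r (σ p.1) (σ p.2)

/-- All lists of labels that occur in a table. -/
def allLabels (T : List Entry) : List (List ℕ) := T.flatMap Entry.labels

/-- Every list of labels of `E` occurs in the table `T`, up to an automorphism of `E` in `S`. -/
def checkComplete {n : ℕ} (E : List (Fin n × Fin n)) (T : List Entry)
    (S : List (Equiv.Perm (Fin n))) : Bool :=
  S.all (isAutomorphism E) &&
  (allLabels T).all (fun r => decide (permuteLabels E r 1 = r) &&
    S.all fun σ => (permuteLabels E r σ).all fun a => decide (1 ≤ a) && decide (a ≤ 4)) &&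
  -- Every one of the `4 ^ E.length` codes is attained.
  decide (bitmask ((allLabels T).flatMap fun r => S.map fun σ => labelCode (permuteLabels E r σ)) =
    2 ^ 4 ^ E.length - 1)

/-- Every pattern of edges is disconnected, or one of the given graphs after a renumbering; the
list `K` consists of all pairs of vertices. -/
def checkPatterns {n : ℕ} (K : List (Fin n × Fin n)) (G : List (List (Fin n × Fin n)))
    (S : List (Equiv.Perm (Fin n))) : Bool :=
  (allLists [0, 1] K.length).all fun s =>
    -- A nonempty proper set `I` of vertices without edges to its complement witnesses that the
    -- pattern is disconnected.
    ((List.finRange n).sublists.any fun I => decide (I ≠ []) &&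
      ((List.finRange n).any fun j => !I.elem j) &&
      I.all fun i => (List.finRange n).all fun j => I.elem j || decide (labelAt K s i j = 0)) ||
    S.any fun σ => G.any fun E => K.all fun p =>
      decide (labelAt K s (σ p.1) (σ p.2) ≠ 0) == isEdge E p.1 p.2

theorem checkPatterns3 : checkPatterns graph3II [graph3I, graph3II] perms3 = true := by
  decide +kernel

theorem checkPatterns4 : checkPatterns graph4VI
    [graph4I, graph4II, graph4III, graph4IV, graph4V, graph4VI] perms4 = true := by
  decide +kernel

theorem checkComplete3_I : checkComplete graph3I table3I [1, Equiv.swap 0 2] = true := by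
  decide +kernel

theorem checkComplete3_II : checkComplete graph3II table3II perms3 = true := by
  decide +kernel

theorem checkComplete4_I : checkComplete graph4I table4I
    [1, Equiv.swap 0 3 * Equiv.swap 1 2] = true := by
  decide +kernel

theorem checkComplete4_II : checkComplete graph4II table4II
    [1, Equiv.swap 1 2, Equiv.swap 1 3, Equiv.swap 2 3, Equiv.swap 1 2 * Equiv.swap 2 3,
      Equiv.swap 2 3 * Equiv.swap 1 2] = true := by
  decide +kernel

theorem checkComplete4_III : checkComplete graph4III table4III [1, Equiv.swap 2 3] = true := by
  decide +kernel

theorem checkComplete4_IV : checkComplete graph4IV table4IV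
    (perms4.filter (isAutomorphism graph4IV)) = true := by
  decide +kernel

theorem checkComplete4_V : checkComplete graph4V table4V
    [1, Equiv.swap 0 2, Equiv.swap 1 3, Equiv.swap 0 2 * Equiv.swap 1 3] = true := by
  decide +kernel

/-- The labels of the complete graph may be taken in any order, so only nondecreasing lists have to
be found in the table. -/
theorem checkComplete4_VI : ((ascendingLists [1, 2, 3, 4] 0 6).all fun r =>
    (allLabels table4VI).elem r) = true := by
  decide +kernel

end KacMoody

/-! ### From the finite checks to the classification of Cartan matrices. -/

namespace KacMoody

theorem labelAt_comm {n : ℕ} (E : List (Fin n × Fin n)) (r : List ℕ) (i j : Fin n) :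
    labelAt E r i j = labelAt E r j i := by
  simp only [labelAt, Bool.or_comm]

theorem labelAt_eq_zero {n : ℕ} {E : List (Fin n × Fin n)} {i j : Fin n} (r : List ℕ)
    (h1 : (i, j) ∉ E) (h2 : (j, i) ∉ E) : labelAt E r i j = 0 := by
  rw [labelAt]
  split
  · next y hy =>
    have h3 := List.find?_some hy
    have h4 := (List.of_mem_zip (List.mem_of_find?_eq_some hy)).1
    simp only [Bool.or_eq_true, decide_eq_true_eq] at h3
    rcases h3 with h | h
    · exact absurd (h ▸ h4) h1
    · exact absurd (h ▸ h4) h2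
  · rfl

namespace CartanMat

/-- If a table is complete up to automorphisms, then it contains the labels of every Cartan matrix
with the given reduced Coxeter graph. -/
theorem exists_entry_of_checkComplete {n : ℕ} {A : CartanMat n} {E : List (Fin n × Fin n)}
    {T : List Entry} {S : List (Equiv.Perm (Fin n))} (hc : checkComplete E T S = true)
    (hE : ∀ p ∈ E, p.1 ≠ p.2) {r : List ℕ} (hr : ∀ a ∈ r, 1 ≤ a ∧ a ≤ 4)
    (h : A.HasCoxeterGraph E r) : ∃ x ∈ T, ∃ l ∈ x.labels, A.HasCoxeterGraph E l := by
  obtain ⟨e, he⟩ := h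
  simp only [checkComplete, Bool.and_eq_true, List.all_eq_true, decide_eq_true_eq] at hc
  obtain ⟨⟨hS, hT⟩, hmask⟩ := hc
  have hlen : r.length = E.length := by rw [← he.1, List.length_map]
  -- The full mask contains the code of `r`, so `r` is a table row moved by some `σ`.
  have hbit : (2 ^ 4 ^ E.length - 1).testBit (labelCode r) = true := by
    rw [Nat.testBit_two_pow_sub_one, decide_eq_true_eq, ← hlen]
    exact labelCode_lt hr
  rw [← hmask] at hbit
  obtain ⟨l, hl, hl'⟩ := List.mem_flatMap.1 (mem_of_testBit_bitmask hbit)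
  obtain ⟨σ, hσ, hcode⟩ := List.mem_map.1 hl'
  obtain ⟨x, hx, hlx⟩ := List.mem_flatMap.1 hl
  obtain ⟨hl1, hl4⟩ := hT l hl
  have haut : ∀ i j, (i, j) ∉ E → (j, i) ∉ E → (σ i, σ j) ∉ E ∧ (σ j, σ i) ∉ E := by
    intro i j h1 h2
    have h3 := hS σ hσ
    simp only [isAutomorphism, List.all_eq_true, List.mem_finRange, true_implies, Bool.or_eq_true,
      Bool.not_eq_true'] at h3
    exact not_mem_of_isEdge ((h3 i j).resolve_left (by simp [isEdge_eq_false ⟨h1, h2⟩]))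
  have hlab : ∀ i j, labelAt E (permuteLabels E l σ) i j = labelAt E l (σ i) (σ j) := by
    intro i j
    exact labelAt_map (f := fun i j => labelAt E l (σ i) (σ j)) (fun i j => labelAt_comm _ _ _ _)
      fun h1 h2 => labelAt_eq_zero l (haut i j h1 h2).1 (haut i j h1 h2).2
  have hlr : permuteLabels E l σ = r := by
    refine labelCode_injective (fun a ha => ?_) hr (by rw [hlen, permuteLabels, List.length_map])
      hcode
    exact hl4 σ hσ a ha
  have key : ∀ i j, i ≠ j → A.edgeLabel (e (σ⁻¹ i)) (e (σ⁻¹ j)) = labelAt E l i j := by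
    intro i j hij
    rw [HasCoxeterGraph.edgeLabel_eq he (fun h => hij (σ⁻¹.injective h)), ← hlr, hlab]
    simp
  -- As `r` is `l` moved by `σ`, undoing `σ` before the numbering `e` gives a numbering with the
  -- labels `l`.
  refine ⟨x, hx, l, hlx, σ⁻¹.trans e, ?_, ?_⟩
  · rw [← hl1]
    exact List.map_congr_left fun p hp => key p.1 p.2 (hE p hp)
  · intro i j hij h1 h2
    exact (key i j hij).trans (labelAt_eq_zero l h1 h2)

/-- An indecomposable Cartan matrix has one of the given reduced Coxeter graphs. -/
theorem exists_graph_of_checkPatterns {n : ℕ} {A : CartanMat n} (hA : A.Indecomposable)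
    {K : List (Fin n × Fin n)} {G : List (List (Fin n × Fin n))} {S : List (Equiv.Perm (Fin n))}
    (hc : checkPatterns K G S = true) (hK : ∀ p ∈ K, p.1 ≠ p.2)
    (hK' : ∀ i j, i ≠ j → (i, j) ∈ K ∨ (j, i) ∈ K) (hG : ∀ E ∈ G, ∀ p ∈ E, p.1 ≠ p.2) :
    ∃ E ∈ G, ∃ r, (∀ a ∈ r, 1 ≤ a ∧ a ≤ 4) ∧ A.HasCoxeterGraph E r := by
  -- Only the presence of an edge matters here, which reduces the matrix to one of finitely many 0/1
  -- patterns.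
  let f : Fin n → Fin n → ℕ := fun i j => min 1 (A.edgeLabel i j)
  have hs : K.map (fun p => f p.1 p.2) ∈ allLists [0, 1] K.length := by
    have := mem_allLists (L := [0, 1]) (r := K.map fun p => f p.1 p.2) (by
      intro a ha
      obtain ⟨p, -, rfl⟩ := List.mem_map.1 ha
      simp only [f, List.mem_cons, List.not_mem_nil, or_false]
      lia)
    rwa [List.length_map] at this
  have hf : ∀ i j, i ≠ j → labelAt K (K.map fun p => f p.1 p.2) i j = f i j := by
    intro i j hij
    refine labelAt_map (fun i j => by simp only [f, edgeLabel_comm]) fun h1 h2 => ?_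
    exact absurd (hK' i j hij) (by simp [h1, h2])
  have h := List.all_eq_true.1 hc _ hs
  rw [Bool.or_eq_true] at h
  rcases h with h | h
  · exfalso
    obtain ⟨I, -, hI⟩ := List.any_eq_true.1 h
    simp only [Bool.and_eq_true, decide_eq_true_eq, List.any_eq_true, List.mem_finRange, true_and,
      Bool.not_eq_true', List.elem_eq_mem, decide_eq_false_iff_not, List.all_eq_true,
      Bool.or_eq_true, true_implies] at hI
    obtain ⟨⟨h1, j, hj⟩, h2⟩ := hI
    refine hA ⟨{i | i ∈ I}, List.exists_mem_of_ne_nil I h1, ⟨j, hj⟩, fun i hi k hk => ?_⟩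
    have hik : i ≠ k := by rintro rfl; exact hk hi
    have h3 := (h2 i hi k).resolve_left hk
    rw [hf i k hik] at h3
    have h4 : A.a i k = 0 := (edgeLabel_eq_zero_iff hik).1 (by simp only [f] at h3; lia)
    exact ⟨h4, A.zero_symm i k h4⟩
  · obtain ⟨σ, -, hσ⟩ := List.any_eq_true.1 h
    obtain ⟨E, hE, h⟩ := List.any_eq_true.1 hσ
    have key : ∀ i j, i ≠ j → (A.edgeLabel (σ i) (σ j) ≠ 0 ↔ isEdge E i j = true) := by
      have h0 : ∀ p ∈ K, (A.edgeLabel (σ p.1) (σ p.2) ≠ 0 ↔ isEdge E p.1 p.2 = true) := by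
        intro p hp
        have h1 := List.all_eq_true.1 h p hp
        rw [hf _ _ fun h' => hK p hp (σ.injective h'), beq_iff_eq] at h1
        rw [← h1, decide_eq_true_eq]
        simp only [f]
        lia
      intro i j hij
      rcases hK' i j hij with h1 | h1
      · exact h0 _ h1
      · have h2 := h0 _ h1
        have h3 : isEdge E j i = isEdge E i j := by simp only [isEdge, Bool.or_comm]
        rwa [edgeLabel_comm, h3] at h2
    refine ⟨E, hE, E.map fun p => A.edgeLabel (σ p.1) (σ p.2), fun a ha => ?_, σ, rfl, ?_⟩
    · obtain ⟨p, hp, rfl⟩ := List.mem_map.1 ha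
      have h1 := (key p.1 p.2 (hG E hE p hp)).2
        (List.any_eq_true.2 ⟨p, hp, by simp⟩)
      exact ⟨Nat.one_le_iff_ne_zero.2 h1, edgeLabel_le _ _⟩
    · intro i j hij h1 h2
      by_contra h3
      have h4 := (key i j hij).1 h3
      rw [isEdge_eq_false ⟨h1, h2⟩] at h4
      exact absurd h4 (by simp)

theorem exists_entry_complete {A : CartanMat 4} {r : List ℕ} (hr : ∀ a ∈ r, 1 ≤ a ∧ a ≤ 4)
    (h : A.HasCoxeterGraph graph4VI r) :
    ∃ x ∈ table4VI, ∃ l ∈ x.labels, A.HasCoxeterGraphUpToOrder graph4VI l := by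
  have hlen : r.length = 6 := by
    obtain ⟨e, he, -⟩ := h
    rw [← he, List.length_map]
    rfl
  have hp := r.perm_insertionSort (· ≤ ·)
  have hm := mem_ascendingLists (L := [1, 2, 3, 4]) (r := r.insertionSort (· ≤ ·)) (m := 0)
    (fun a ha => by
      have := hr a (hp.mem_iff.1 ha)
      simp only [List.mem_cons, List.not_mem_nil, or_false]
      lia)
    (List.pairwise_insertionSort _ _) fun a _ => Nat.zero_le a
  rw [hp.length_eq, hlen] at hm
  have h1 := List.all_eq_true.1 checkComplete4_VI _ hm
  rw [List.elem_eq_mem, decide_eq_true_eq] at h1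
  obtain ⟨x, hx, hl⟩ := List.mem_flatMap.1 h1
  -- The row is the sorted list, and `r` itself is the rearrangement that the matrix realizes.
  exact ⟨x, hx, _, hl, r, hp.symm, h⟩

end CartanMat

end KacMoody

theorem mainTheorem6 :
    -- every indecomposable Cartan matrix of rank 3 or 4 occurs in one of the tables
    (∀ A : CartanMat 3, A.Indecomposable →
      (∃ x ∈ table3I, ∃ r ∈ x.labels, A.HasCoxeterGraph graph3I r) ∨
      (∃ x ∈ table3II, ∃ r ∈ x.labels, A.HasCoxeterGraph graph3II r)) ∧
    (∀ A : CartanMat 4, A.Indecomposable →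
      (∃ x ∈ table4I, ∃ r ∈ x.labels, A.HasCoxeterGraph graph4I r) ∨
      (∃ x ∈ table4II, ∃ r ∈ x.labels, A.HasCoxeterGraph graph4II r) ∨
      (∃ x ∈ table4III, ∃ r ∈ x.labels, A.HasCoxeterGraph graph4III r) ∨
      (∃ x ∈ table4IV, ∃ r ∈ x.labels, A.HasCoxeterGraph graph4IV r) ∨
      (∃ x ∈ table4V, ∃ r ∈ x.labels, A.HasCoxeterGraph graph4V r) ∨
      (∃ x ∈ table4VI, ∃ r ∈ x.labels, A.HasCoxeterGraphUpToOrder graph4VI r)) ∧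
    -- every entry of every table is the Poincaré series of every Cartan matrix it stands for
    (∀ A : CartanMat 3, ∀ x ∈ table3I, ∀ r ∈ x.labels,
      A.HasCoxeterGraph graph3I r → x.Represents A.poincareSeries) ∧
    (∀ A : CartanMat 3, ∀ x ∈ table3II, ∀ r ∈ x.labels,
      A.HasCoxeterGraph graph3II r → x.Represents A.poincareSeries) ∧
    (∀ A : CartanMat 4, ∀ x ∈ table4I, ∀ r ∈ x.labels,
      A.HasCoxeterGraph graph4I r → x.Represents A.poincareSeries) ∧
    (∀ A : CartanMat 4, ∀ x ∈ table4II, ∀ r ∈ x.labels,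
      A.HasCoxeterGraph graph4II r → x.Represents A.poincareSeries) ∧
    (∀ A : CartanMat 4, ∀ x ∈ table4III, ∀ r ∈ x.labels,
      A.HasCoxeterGraph graph4III r → x.Represents A.poincareSeries) ∧
    (∀ A : CartanMat 4, ∀ x ∈ table4IV, ∀ r ∈ x.labels,
      A.HasCoxeterGraph graph4IV r → x.Represents A.poincareSeries) ∧
    (∀ A : CartanMat 4, ∀ x ∈ table4V, ∀ r ∈ x.labels,
      A.HasCoxeterGraph graph4V r → x.Represents A.poincareSeries) ∧
    (∀ A : CartanMat 4, ∀ x ∈ table4VI, ∀ r ∈ x.labels,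
      A.HasCoxeterGraphUpToOrder graph4VI r → x.Represents A.poincareSeries) := by
  refine ⟨fun A hA => ?_, fun A hA => ?_,
    fun A x hx r hr h => CartanMat.represents_of_checkTable3 checkTable3_I hx hr h,
    fun A x hx r hr h => CartanMat.represents_of_checkTable3 checkTable3_II hx hr h,
    fun A x hx r hr h => CartanMat.represents_of_checkTable4 checkTable4_I hx hr h,
    fun A x hx r hr h => CartanMat.represents_of_checkTable4 checkTable4_II hx hr h,
    fun A x hx r hr h => CartanMat.represents_of_checkTable4 checkTable4_III hx hr h,
    fun A x hx r hr h => CartanMat.represents_of_checkTable4 checkTable4_IV hx hr h,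
    fun A x hx r hr h => CartanMat.represents_of_checkTable4 checkTable4_V hx hr h,
    fun A x hx r hr h => CartanMat.represents_of_checkTableComplete checkTable4_VI hx hr h⟩
  · obtain ⟨E, hE, r, hr, h⟩ := CartanMat.exists_graph_of_checkPatterns hA checkPatterns3
      (by decide) (by decide) (by decide)
    simp only [List.mem_cons, List.not_mem_nil, or_false] at hE
    rcases hE with rfl | rfl
    · exact Or.inl (CartanMat.exists_entry_of_checkComplete checkComplete3_I (by decide) hr h)
    · exact Or.inr (CartanMat.exists_entry_of_checkComplete checkComplete3_II (by decide) hr h)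
  · obtain ⟨E, hE, r, hr, h⟩ := CartanMat.exists_graph_of_checkPatterns hA checkPatterns4
      (by decide) (by decide) (by decide)
    simp only [List.mem_cons, List.not_mem_nil, or_false] at hE
    rcases hE with rfl | rfl | rfl | rfl | rfl | rfl
    · exact Or.inl (CartanMat.exists_entry_of_checkComplete checkComplete4_I (by decide) hr h)
    · exact Or.inr (Or.inl
        (CartanMat.exists_entry_of_checkComplete checkComplete4_II (by decide) hr h))
    · exact Or.inr (Or.inr (Or.inl
        (CartanMat.exists_entry_of_checkComplete checkComplete4_III (by decide) hr h)))
    · exact Or.inr (Or.inr (Or.inr (Or.inl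
        (CartanMat.exists_entry_of_checkComplete checkComplete4_IV (by decide) hr h))))
    · exact Or.inr (Or.inr (Or.inr (Or.inr (Or.inl
        (CartanMat.exists_entry_of_checkComplete checkComplete4_V (by decide) hr h)))))
    · exact Or.inr (Or.inr (Or.inr (Or.inr (Or.inr (CartanMat.exists_entry_complete hr h)))))
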